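/- Let $k$ be an associative ring with unit, not necessarily commutative ($k$-modules are left modules), and let $X$ be a connected, locally simply connected topological space; here a space is called simply connected if it is connected and each of its coverings is trivial, and $X$ is locally simply connected if its simply connected open subsets form a basis of its topology. Let $\phi\colon \widetilde X\to X$ be a universal covering (a covering with $\widetilde X$ simply connected) and $G=\operatorname{Aut}_X\widetilde X$. Let $\operatorname{Shv}_k(X)$ be the category of sheaves of $k$-modules on $X$, let $D^+(X)$ be its bounded below derived category, and let $\operatorname{Qcoh}_k(X)\subset\operatorname{Shv}_k(X)$ be the full subcategory of quasi-coherent sheaves, i.e. of the sheaves $F$ such that every point of $X$ has an open neighbourhood $U$ with an exact sequence $k_U^{\oplus I}\to k_U^{\oplus J}\to F|_U\to 0$ for some sets $I,J$; it is an abelian subcategory. Let $\operatorname{Mod}_k(G)$ be the category of $k$-linear representations of $G$. For $F\in D^+(X)$ and $i\in\mathbb Z$, the group $G$ acts on $H^i(\widetilde X,\phi^{-1}F)=H^i(\mathbb R\Gamma(\widetilde X,\phi^{-1}F))$, an element $g$ acting by the pullback along $g^{-1}\colon \widetilde X\to\widetilde X$; likewise $G$ acts on $\Gamma(\widetilde X,\phi^{-1}L)$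 for a sheaf $L$ on $X$. Then: (a) The functor $L\mapsto \Gamma(\widetilde X,\phi^{-1}L)$ is an equivalence $\operatorname{Qcoh}_k(X)\simeq\operatorname{Mod}_k(G)$. (b) The inclusion $\operatorname{Qcoh}_k(X)\hookrightarrow\operatorname{Shv}_k(X)$ has a right adjoint $\operatorname{Qc}$. (c) Let $\mathbb R\operatorname{Qc}\colon D^+(X)\to D^+(\operatorname{Qcoh}_k(X))$ be the right derived functor of $\operatorname{Qc}$ and $R^i\operatorname{Qc}(F)=H^i(\mathbb R\operatorname{Qc}(F))$. For every $i\in\mathbb Z$ there is an isomorphism of $G$-modules, natural in $F\in D^+(X)$, between $H^i(\widetilde X,\phi^{-1}F)$ and the $G$-module that corresponds to $R^i\operatorname{Qc}(F)$ under the equivalence of (a): $$\Gamma\bigl(\widetilde X,\phi^{-1}R^i\operatorname{Qc}(F)\bigr)\;\cong\; H^i(\widetilde X,\phi^{-1}F).$$ (d) For every covering map $\psi\colon Y'\to Y$ of topological spaces, the functor $\psi^{-1}\colon\operatorname{Shv}_k(Y)\to\operatorname{Shv}_k(Y')$ sends injective sheaves to injective sheaves. -/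

import Mathlib

open CategoryTheory Limits TopologicalSpace Opposite
universe u
noncomputable section
namespace LocSys

section Derived

variable {C D E : Type*} [Category* C] [Category* D] [Category* E]

section Additive

variable [Preadditive C] [Preadditive D] [Preadditive E]

/-- The natural transformation on bounded below complexes up to homotopy induced by a
natural transformation of additive functors, whose target is a composite. -/
def mapPlusTo {F : C ⥤ E} {A : C ⥤ D} {B : D ⥤ E} [F.Additive] [A.Additive] [B.Additive]
    (τ : F ⟶ A ⋙ B) :
    F.mapHomotopyCategoryPlus ⟶ A.mapHomotopyCategoryPlus ⋙ B.mapHomotopyCategoryPlus :=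
  { app K := ObjectProperty.homMk
      ((NatTrans.mapHomotopyCategory τ (ComplexShape.up ℤ)).app K.obj)
    naturality K L f := by
      obtain ⟨K, rfl⟩ := HomotopyCategory.Plus.quotient_obj_surjective K
      obtain ⟨L, rfl⟩ := HomotopyCategory.Plus.quotient_obj_surjective L
      obtain ⟨f, rfl⟩ := (HomotopyCategory.Plus.quotient C).map_surjective f
      ext
      exact (NatTrans.mapHomotopyCategory τ (ComplexShape.up ℤ)).naturality
        ((HomotopyCategory.Plus.quotient C).map f).hom }

/-- The natural transformation on bounded below complexes up to homotopy induced by a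
natural transformation of additive functors, whose source is a composite. -/
def mapPlusFrom {F : C ⥤ E} {A : C ⥤ D} {B : D ⥤ E} [F.Additive] [A.Additive] [B.Additive]
    (τ : A ⋙ B ⟶ F) :
    A.mapHomotopyCategoryPlus ⋙ B.mapHomotopyCategoryPlus ⟶ F.mapHomotopyCategoryPlus :=
  { app K := ObjectProperty.homMk
      ((NatTrans.mapHomotopyCategory τ (ComplexShape.up ℤ)).app K.obj)
    naturality K L f := by
      obtain ⟨K, rfl⟩ := HomotopyCategory.Plus.quotient_obj_surjective K
      obtain ⟨L, rfl⟩ := HomotopyCategory.Plus.quotient_obj_surjective L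
      obtain ⟨f, rfl⟩ := (HomotopyCategory.Plus.quotient C).map_surjective f
      ext
      exact (NatTrans.mapHomotopyCategory τ (ComplexShape.up ℤ)).naturality
        ((HomotopyCategory.Plus.quotient C).map f).hom }

/-- The natural transformation on bounded below complexes up to homotopy induced by a
natural transformation of additive functors, whose target is the identity functor. -/
def mapPlusId {A : C ⥤ C} [A.Additive] (τ : A ⟶ 𝟭 C) :
    A.mapHomotopyCategoryPlus ⟶ 𝟭 _ :=
  { app K := ObjectProperty.homMk
      ((NatTrans.mapHomotopyCategory τ (ComplexShape.up ℤ)).app K.obj)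
    naturality K L f := by
      obtain ⟨K, rfl⟩ := HomotopyCategory.Plus.quotient_obj_surjective K
      obtain ⟨L, rfl⟩ := HomotopyCategory.Plus.quotient_obj_surjective L
      obtain ⟨f, rfl⟩ := (HomotopyCategory.Plus.quotient C).map_surjective f
      ext
      exact (NatTrans.mapHomotopyCategory τ (ComplexShape.up ℤ)).naturality
        ((HomotopyCategory.Plus.quotient C).map f).hom }

end Additive

variable [Abelian C] [Abelian D] [Abelian E]
  [HasDerivedCategory D] [HasDerivedCategory E]

open DerivedCategory.Plus

lemma exact_inverts (F : C ⥤ D) [F.Additive] [PreservesFiniteLimits F]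
    [PreservesFiniteColimits F] :
    (HomotopyCategory.Plus.quasiIso C).IsInvertedBy (F.mapHomotopyCategoryPlus ⋙ Qh) := by
  intro K L f hf
  apply Localization.inverts Qh (HomotopyCategory.Plus.quasiIso D)
  obtain ⟨K, rfl⟩ := HomotopyCategory.Plus.quotient_obj_surjective K
  obtain ⟨L, rfl⟩ := HomotopyCategory.Plus.quotient_obj_surjective L
  obtain ⟨f, rfl⟩ := (HomotopyCategory.Plus.quotient C).map_surjective f
  have h1 : QuasiIso f.hom := by
    rw [← HomologicalComplex.mem_quasiIso_iff, ← HomotopyCategory.quotient_map_mem_quasiIso_iff]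
    exact hf
  have h2 : QuasiIso ((F.mapHomologicalComplex (ComplexShape.up ℤ)).map f.hom) := inferInstance
  rw [← HomologicalComplex.mem_quasiIso_iff, ← HomotopyCategory.quotient_map_mem_quasiIso_iff] at h2
  exact h2

section Exact

variable [HasDerivedCategory C]

/-- The functor `D⁺(C) ⥤ D⁺(D)` induced by an exact functor, termwise on complexes. -/
def exactDerived (F : C ⥤ D) [F.Additive] [PreservesFiniteLimits F] [PreservesFiniteColimits F] :
    DerivedCategory.Plus C ⥤ DerivedCategory.Plus D :=
  Localization.lift (F.mapHomotopyCategoryPlus ⋙ Qh) (exact_inverts F) Qh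

/-- `exactDerived F` is computed by applying `F` termwise to bounded below complexes. -/
def exactDerivedFac (F : C ⥤ D) [F.Additive] [PreservesFiniteLimits F]
    [PreservesFiniteColimits F] :
    Qh ⋙ exactDerived F ≅ F.mapHomotopyCategoryPlus ⋙ Qh :=
  Localization.fac _ (exact_inverts F) Qh

instance (F : C ⥤ D) [F.Additive] [PreservesFiniteLimits F] [PreservesFiniteColimits F]
    {M : Type*} [Category* M] (G : DerivedCategory.Plus D ⥤ M) :
    Localization.Lifting Qh (HomotopyCategory.Plus.quasiIso C)
      (F.mapHomotopyCategoryPlus ⋙ Qh ⋙ G) (exactDerived F ⋙ G) :=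
  ⟨Functor.isoWhiskerRight (exactDerivedFac F) G⟩

end Exact

section Desc

variable [HasDerivedCategory C] [EnoughInjectives C] (Γ : C ⥤ E) [Γ.Additive]
  {H : HomotopyCategory.Plus C ⥤ DerivedCategory.Plus E}

/-- The universal property of `RΓ`, on the level of complexes: a natural morphism
`Γ(K) ⟶ H(K)`, where `H` inverts quasi-isomorphisms, extends uniquely to `RΓ(K) ⟶ H(K)`. -/
def derivedDesc (hH : (HomotopyCategory.Plus.quasiIso C).IsInvertedBy H)
    (β : Γ.mapHomotopyCategoryPlus ⋙ Qh ⟶ H) :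
    Qh ⋙ Γ.rightDerivedFunctorPlus ⟶ H :=
  Functor.whiskerLeft Qh (Γ.rightDerivedFunctorPlus.rightDerivedDesc Γ.rightDerivedFunctorPlusUnit
    (HomotopyCategory.Plus.quasiIso C) (Localization.lift H hH Qh)
      (β ≫ (Localization.fac H hH Qh).inv)) ≫ (Localization.fac H hH Qh).hom

lemma derivedDesc_fac (hH : (HomotopyCategory.Plus.quasiIso C).IsInvertedBy H)
    (β : Γ.mapHomotopyCategoryPlus ⋙ Qh ⟶ H) :
    Γ.rightDerivedFunctorPlusUnit ≫ derivedDesc Γ hH β = β := by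
  simp [derivedDesc]

lemma derived_hom_ext (hH : (HomotopyCategory.Plus.quasiIso C).IsInvertedBy H)
    (γ γ' : Qh ⋙ Γ.rightDerivedFunctorPlus ⟶ H)
    (h : Γ.rightDerivedFunctorPlusUnit ≫ γ = Γ.rightDerivedFunctorPlusUnit ≫ γ') : γ = γ' := by
  let e := Localization.fac H hH Qh
  obtain ⟨δ, hδ⟩ := ((Localization.whiskeringLeftFunctor' Qh
    (HomotopyCategory.Plus.quasiIso C) _).map_surjective (γ ≫ e.inv))
  obtain ⟨δ', hδ'⟩ := ((Localization.whiskeringLeftFunctor' Qh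
    (HomotopyCategory.Plus.quasiIso C) _).map_surjective (γ' ≫ e.inv))
  have : δ = δ' := by
    refine Functor.rightDerived_ext _ Γ.rightDerivedFunctorPlusUnit
      (HomotopyCategory.Plus.quasiIso C) _ _ _ ?_
    refine (congrArg (Γ.rightDerivedFunctorPlusUnit ≫ ·) hδ).trans
      (Eq.trans ?_ (congrArg (Γ.rightDerivedFunctorPlusUnit ≫ ·) hδ').symm)
    exact (reassoc_of% h) e.inv
  rw [← cancel_mono e.inv]
  exact hδ.symm.trans ((by rw [this]) : _ = _) |>.trans hδ'

end Desc

section Operator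

variable [EnoughInjectives D] (Γ : D ⥤ E) [Γ.Additive]
  (T : C ⥤ D) [T.Additive]

/-- For an exact functor `A` with a natural map `u : Γ(P) ⟶ Γ(A(P))`, the induced map
`RΓ(P) ⟶ RΓ(A(P))` for bounded below complexes `P`. -/
def derivedPull (A : D ⥤ D) [A.Additive] [PreservesFiniteLimits A] [PreservesFiniteColimits A]
    (u : Γ ⟶ A ⋙ Γ) :
    Qh ⋙ Γ.rightDerivedFunctorPlus ⟶
      A.mapHomotopyCategoryPlus ⋙ Qh ⋙ Γ.rightDerivedFunctorPlus :=
  derivedDesc Γ (H := A.mapHomotopyCategoryPlus ⋙ Qh ⋙ Γ.rightDerivedFunctorPlus)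
    (fun _ _ f hf ↦ by
      have := exact_inverts A f hf
      exact inferInstanceAs (IsIso (Γ.rightDerivedFunctorPlus.map
        ((A.mapHomotopyCategoryPlus ⋙ Qh).map f))))
    (Functor.whiskerRight (mapPlusTo u) Qh ≫
      Functor.whiskerLeft A.mapHomotopyCategoryPlus Γ.rightDerivedFunctorPlusUnit)

/-- For `b : A(T(F)) ⟶ T(F)`, the composite `RΓ(T(K)) ⟶ RΓ(A(T(K))) ⟶ RΓ(T(K))`. -/
def derivedOp (A : D ⥤ D) [A.Additive] [PreservesFiniteLimits A] [PreservesFiniteColimits A]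
    (u : Γ ⟶ A ⋙ Γ) (b : T ⋙ A ⟶ T) :
    End (T.mapHomotopyCategoryPlus ⋙ Qh ⋙ Γ.rightDerivedFunctorPlus) :=
  Functor.whiskerLeft T.mapHomotopyCategoryPlus (derivedPull Γ A u) ≫
    Functor.whiskerRight (mapPlusFrom b) (Qh ⋙ Γ.rightDerivedFunctorPlus)

/-- The composite `Γ(T(F)) ⟶ Γ(A(T(F))) ⟶ Γ(T(F))`. -/
def sectionsOp {C D E : Type*} [Category* C] [Category* D] [Category* E]
    (Γ : D ⥤ E) (T : C ⥤ D) (A : D ⥤ D) (u : Γ ⟶ A ⋙ Γ) (b : T ⋙ A ⟶ T) : End (T ⋙ Γ) :=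
  Functor.whiskerLeft T u ≫ Functor.whiskerRight b Γ

section

variable {C D E : Type*} [Category* C] [Category* D] [Category* E] (Γ : D ⥤ E) (T : C ⥤ D)
  {A A' A'' : D ⥤ D} {u : Γ ⟶ A ⋙ Γ} {u' : Γ ⟶ A' ⋙ Γ} {u'' : Γ ⟶ A'' ⋙ Γ}
  {b : T ⋙ A ⟶ T} {b' : T ⋙ A' ⟶ T} {b'' : T ⋙ A'' ⟶ T}

lemma sectionsOp_comp (θ : A ⋙ A' ⟶ A'')
    (hu : ∀ P, u.app P ≫ u'.app (A.obj P) ≫ Γ.map (θ.app P) = u''.app P)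
    (hb : ∀ F, A'.map (b.app F) ≫ b'.app F = θ.app (T.obj F) ≫ b''.app F) :
    sectionsOp Γ T A u b ≫ sectionsOp Γ T A' u' b' = sectionsOp Γ T A'' u'' b'' := by
  refine NatTrans.ext (funext fun F ↦ ?_)
  have h2 := u'.naturality (b.app F)
  simp only [sectionsOp, NatTrans.comp_app, Functor.whiskerLeft_app, Functor.whiskerRight_app,
    Category.assoc, Functor.comp_map] at h2 ⊢
  rw [← hu, reassoc_of% h2]
  simp only [Category.assoc, ← Functor.map_comp, hb]

lemma sectionsOp_id (θ : A ⟶ 𝟭 D)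
    (hu : ∀ P, u.app P ≫ Γ.map (θ.app P) = 𝟙 _)
    (hb : ∀ F, b.app F = θ.app (T.obj F)) :
    sectionsOp Γ T A u b = 𝟙 _ := by
  refine NatTrans.ext (funext fun F ↦ ?_)
  simp only [sectionsOp, NatTrans.comp_app, Functor.whiskerLeft_app, Functor.whiskerRight_app, hb]
  exact hu _

end

section

variable {A A' A'' : D ⥤ D}
  [A.Additive] [PreservesFiniteLimits A] [PreservesFiniteColimits A]
  [A'.Additive] [PreservesFiniteLimits A'] [PreservesFiniteColimits A']
  [A''.Additive] [PreservesFiniteLimits A''] [PreservesFiniteColimits A'']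
  {u : Γ ⟶ A ⋙ Γ} {u' : Γ ⟶ A' ⋙ Γ} {u'' : Γ ⟶ A'' ⋙ Γ}
  {b : T ⋙ A ⟶ T} {b' : T ⋙ A' ⟶ T} {b'' : T ⋙ A'' ⟶ T}


lemma derivedPull_fac_app (P : HomotopyCategory.Plus D) :
    Γ.rightDerivedFunctorPlusUnit.app P ≫ (derivedPull Γ A u).app P =
      Qh.map ((mapPlusTo u).app P) ≫
        Γ.rightDerivedFunctorPlusUnit.app (A.mapHomotopyCategoryPlus.obj P) := by
  have := NatTrans.congr_app (derivedDesc_fac Γ (H := A.mapHomotopyCategoryPlus ⋙ Qh ⋙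
    Γ.rightDerivedFunctorPlus) (fun _ _ f hf ↦ by
      have := exact_inverts A f hf
      exact inferInstanceAs (IsIso (Γ.rightDerivedFunctorPlus.map
        ((A.mapHomotopyCategoryPlus ⋙ Qh).map f))))
    (Functor.whiskerRight (mapPlusTo u) Qh ≫
      Functor.whiskerLeft A.mapHomotopyCategoryPlus Γ.rightDerivedFunctorPlusUnit)) P
  refine this.trans ?_
  simp

/-- Composition law for `derivedPull`. -/
lemma derivedPull_comp (θ : A ⋙ A' ⟶ A'')
    (hu : ∀ P, u.app P ≫ u'.app (A.obj P) ≫ Γ.map (θ.app P) = u''.app P)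
    (P : HomotopyCategory.Plus D) :
    (derivedPull Γ A u).app P ≫ (derivedPull Γ A' u').app (A.mapHomotopyCategoryPlus.obj P) ≫
      Γ.rightDerivedFunctorPlus.map (Qh.map ((mapPlusFrom θ).app P)) = (derivedPull Γ A'' u'').app P := by
  let γ : Qh ⋙ Γ.rightDerivedFunctorPlus ⟶
      A''.mapHomotopyCategoryPlus ⋙ Qh ⋙ Γ.rightDerivedFunctorPlus :=
    derivedPull Γ A u ≫ Functor.whiskerLeft A.mapHomotopyCategoryPlus (derivedPull Γ A' u') ≫
      Functor.whiskerRight (mapPlusFrom θ) (Qh ⋙ Γ.rightDerivedFunctorPlus)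
  have : γ = derivedPull Γ A'' u'' := by
    refine derived_hom_ext Γ (fun _ _ f hf ↦ by
      have := exact_inverts A'' f hf
      exact inferInstanceAs (IsIso (Γ.rightDerivedFunctorPlus.map
        ((A''.mapHomotopyCategoryPlus ⋙ Qh).map f)))) _ _ ?_
    ext1
    ext1 P
    refine Eq.trans ?_ (derivedPull_fac_app Γ P).symm
    have h1 := derivedPull_fac_app Γ (u := u) P
    have h2 := derivedPull_fac_app Γ (u := u') (A.mapHomotopyCategoryPlus.obj P)
    have h3 := Γ.rightDerivedFunctorPlusUnit.naturality ((mapPlusFrom θ).app P)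
    have h4 : (mapPlusTo u).app P ≫ (mapPlusTo u').app (A.mapHomotopyCategoryPlus.obj P) ≫
        Γ.mapHomotopyCategoryPlus.map ((mapPlusFrom θ).app P) = (mapPlusTo u'').app P := by
      obtain ⟨P, rfl⟩ := HomotopyCategory.Plus.quotient_obj_surjective P
      ext
      have e : (NatTrans.mapHomologicalComplex u (ComplexShape.up ℤ)).app P.obj ≫
          (NatTrans.mapHomologicalComplex u' (ComplexShape.up ℤ)).app
            ((A.mapHomologicalComplex _).obj P.obj) ≫ (Γ.mapHomologicalComplex _).map
            ((NatTrans.mapHomologicalComplex θ (ComplexShape.up ℤ)).app P.obj) =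
          (NatTrans.mapHomologicalComplex u'' (ComplexShape.up ℤ)).app P.obj := by
        ext n
        exact hu _
      have e' := congrArg (HomotopyCategory.quotient _ (ComplexShape.up ℤ)).map e
      exact e'
    calc Γ.rightDerivedFunctorPlusUnit.app P ≫ γ.app P
        = (Γ.rightDerivedFunctorPlusUnit.app P ≫ (derivedPull Γ A u).app P) ≫
          (derivedPull Γ A' u').app (A.mapHomotopyCategoryPlus.obj P) ≫
          Γ.rightDerivedFunctorPlus.map (Qh.map ((mapPlusFrom θ).app P)) := by
          simp [γ]
      _ = Qh.map ((mapPlusTo u).app P) ≫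
        (Γ.rightDerivedFunctorPlusUnit.app (A.mapHomotopyCategoryPlus.obj P)  ≫
          (derivedPull Γ A' u').app (A.mapHomotopyCategoryPlus.obj P)) ≫
          Γ.rightDerivedFunctorPlus.map (Qh.map ((mapPlusFrom θ).app P)) := by
          rw [h1]; simp only [Category.assoc]
      _ = Qh.map ((mapPlusTo u).app P) ≫ Qh.map ((mapPlusTo u').app (A.mapHomotopyCategoryPlus.obj P)) ≫
          (Γ.rightDerivedFunctorPlusUnit.app _  ≫
          Γ.rightDerivedFunctorPlus.map (Qh.map ((mapPlusFrom θ).app P))) := by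
          rw [h2]; simp only [Category.assoc]
      _ = Qh.map ((mapPlusTo u).app P) ≫ Qh.map ((mapPlusTo u').app (A.mapHomotopyCategoryPlus.obj P)) ≫
           Qh.map (Γ.mapHomotopyCategoryPlus.map ((mapPlusFrom θ).app P)) ≫
             Γ.rightDerivedFunctorPlusUnit.app _ := by
          congr 2; exact h3.symm
      _ = _ := by
        rw [← h4]; simp only [Functor.map_comp, Category.assoc]
  have h := NatTrans.congr_app this P
  refine Eq.trans ?_ h
  simp [γ]

lemma derivedOp_comp (θ : A ⋙ A' ⟶ A'')
    (hu : ∀ P, u.app P ≫ u'.app (A.obj P) ≫ Γ.map (θ.app P) = u''.app P)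
    (hb : ∀ F, A'.map (b.app F) ≫ b'.app F = θ.app (T.obj F) ≫ b''.app F) :
    derivedOp Γ T A u b ≫ derivedOp Γ T A' u' b' = derivedOp Γ T A'' u'' b'' := by
  ext1
  ext1 K
  have h1 := derivedPull_comp Γ θ hu (T.mapHomotopyCategoryPlus.obj K)
  have h2 := (derivedPull Γ A' u').naturality ((mapPlusFrom b).app K)
  have h3 : A'.mapHomotopyCategoryPlus.map ((mapPlusFrom b).app K) ≫ (mapPlusFrom b').app K =
      (mapPlusFrom θ).app (T.mapHomotopyCategoryPlus.obj K) ≫ (mapPlusFrom b'').app K := by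
    obtain ⟨K, rfl⟩ := HomotopyCategory.Plus.quotient_obj_surjective K
    ext
    have e : (A'.mapHomologicalComplex _).map
          ((NatTrans.mapHomologicalComplex b (ComplexShape.up ℤ)).app K.obj) ≫
        (NatTrans.mapHomologicalComplex b' (ComplexShape.up ℤ)).app K.obj =
        (NatTrans.mapHomologicalComplex θ (ComplexShape.up ℤ)).app
          ((T.mapHomologicalComplex _).obj K.obj) ≫
        (NatTrans.mapHomologicalComplex b'' (ComplexShape.up ℤ)).app K.obj := by
      ext n
      exact hb _
    exact congrArg (HomotopyCategory.quotient _ (ComplexShape.up ℤ)).map e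
  simp only [derivedOp, NatTrans.comp_app, Functor.whiskerLeft_app, Functor.whiskerRight_app,
    Category.assoc, Functor.comp_map] at h2 ⊢
  rw [← h1, reassoc_of% h2]
  simp only [Category.assoc, ← Functor.map_comp, h3]

lemma derivedOp_id (θ : A ⟶ 𝟭 D)
    (hu : ∀ P, u.app P ≫ Γ.map (θ.app P) = 𝟙 _)
    (hb : ∀ F, b.app F = θ.app (T.obj F)) :
    derivedOp Γ T A u b = 𝟙 _ := by
  let γ : Qh ⋙ Γ.rightDerivedFunctorPlus ⟶ Qh ⋙ Γ.rightDerivedFunctorPlus :=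
    derivedPull Γ A u ≫ Functor.whiskerRight (mapPlusId θ) (Qh ⋙ Γ.rightDerivedFunctorPlus)
  have hγ : γ = 𝟙 _ := by
    refine derived_hom_ext Γ (fun _ _ f hf ↦ by
      have := Localization.inverts Qh (HomotopyCategory.Plus.quasiIso D) f hf
      exact inferInstanceAs (IsIso (Γ.rightDerivedFunctorPlus.map (Qh.map f)))) _ _ ?_
    ext1
    ext1 P
    have h1 := derivedPull_fac_app Γ (u := u) P
    have h3 := Γ.rightDerivedFunctorPlusUnit.naturality ((mapPlusId θ).app P)
    have h4 : (mapPlusTo u).app P ≫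
        Γ.mapHomotopyCategoryPlus.map ((mapPlusId θ).app P) = 𝟙 _ := by
      obtain ⟨P, rfl⟩ := HomotopyCategory.Plus.quotient_obj_surjective P
      ext
      have e : (NatTrans.mapHomologicalComplex u (ComplexShape.up ℤ)).app P.obj ≫
          (Γ.mapHomologicalComplex _).map
            ((NatTrans.mapHomologicalComplex θ (ComplexShape.up ℤ)).app P.obj) = 𝟙 _ := by
        ext n
        exact hu _
      exact congrArg (HomotopyCategory.quotient _ (ComplexShape.up ℤ)).map e
    simp only [Functor.comp_map, Functor.id_obj] at h3
    simp only [γ, NatTrans.comp_app, Functor.whiskerRight_app, reassoc_of% h1,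
      Functor.comp_map, Category.comp_id]
    refine (congrArg (Qh.map ((mapPlusTo u).app P) ≫ ·) h3.symm).trans ?_
    refine (Category.assoc _ _ _).symm.trans ?_
    refine (congrArg (· ≫ _) ((Qh.map_comp _ _).symm.trans (congrArg Qh.map h4))).trans ?_
    refine (congrArg (· ≫ _) (Qh.map_id _)).trans (Category.id_comp _)
  refine NatTrans.ext (funext fun K ↦ ?_)
  have h := NatTrans.congr_app hγ (T.mapHomotopyCategoryPlus.obj K)
  have h3 : (mapPlusFrom b).app K = (mapPlusId θ).app (T.mapHomotopyCategoryPlus.obj K) := by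
    obtain ⟨K, rfl⟩ := HomotopyCategory.Plus.quotient_obj_surjective K
    ext
    have e : (NatTrans.mapHomologicalComplex b (ComplexShape.up ℤ)).app K.obj =
        (NatTrans.mapHomologicalComplex θ (ComplexShape.up ℤ)).app
          ((T.mapHomologicalComplex _).obj K.obj) := by
      ext n
      exact hb _
    exact congrArg (HomotopyCategory.quotient _ (ComplexShape.up ℤ)).map e
  simp only [derivedOp, NatTrans.comp_app, Functor.whiskerLeft_app, Functor.whiskerRight_app, h3]
  exact h

end

end Operator
end Derived

section Sheaves

/-- The category of sheaves of `k`-modules on `X`. -/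
abbrev Shv (k : Type u) [Ring k] (X : TopCat.{u}) := TopCat.Sheaf (ModuleCat.{u} k) X

variable (k : Type u) [Ring k] {X Y Z W : TopCat.{u}}

/-- The inverse image `f⁻¹ : Shv_k(Y) ⥤ Shv_k(X)`. -/
abbrev inverseImage (f : X ⟶ Y) : Shv k Y ⥤ Shv k X :=
  TopCat.Sheaf.pullback (ModuleCat.{u} k) f

/-- The adjunction `f⁻¹ ⊣ f_*`. -/
abbrev inverseImageAdj (f : X ⟶ Y) :
    inverseImage k f ⊣ TopCat.Sheaf.pushforward (ModuleCat.{u} k) f :=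
  TopCat.Sheaf.pullbackPushforwardAdjunction (ModuleCat.{u} k) f

instance (f : X ⟶ Y) : PreservesFiniteLimits (inverseImage k f) := by
  have : ReflectsLimits (forget (ModuleCat.{u} k)) := reflectsLimits_of_reflectsIsomorphisms
  have : PreservesFiniteLimits ((Opens.map f).op.lan : (_ ⥤ _ ⥤ ModuleCat.{u} k)) :=
    lan_preservesFiniteLimits_of_flat _ _
  exact Functor.sheafPullbackConstruction.preservesFiniteLimits (Opens.map f) (ModuleCat.{u} k)
    (Opens.grothendieckTopology Y) (Opens.grothendieckTopology X)

instance (f : X ⟶ Y) : PreservesFiniteColimits (inverseImage k f) := inferInstance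

instance (f : X ⟶ Y) : (inverseImage k f).Additive :=
  Functor.additive_of_preserves_binary_products _

/-- Global sections `Γ(X, -)`. -/
def globalSections (X : TopCat.{u}) : Shv k X ⥤ ModuleCat.{u} k :=
  (sheafSections (Opens.grothendieckTopology X) (ModuleCat.{u} k)).obj (op ⊤)

instance (X : TopCat.{u}) : (globalSections k X).Additive where
  map_add := rfl

/-- Pullback of sections `Γ(Y, F) ⟶ Γ(X, f⁻¹F)`, given by the unit `F ⟶ f_* f⁻¹ F`. -/
def sectionsPull (f : X ⟶ Y) : globalSections k Y ⟶ inverseImage k f ⋙ globalSections k X :=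
  Functor.whiskerRight (inverseImageAdj k f).unit (globalSections k Y)

/-- The canonical isomorphism `f⁻¹ g⁻¹ ≅ h⁻¹` when `h = g ∘ f`. -/
def inverseImageComp {f : X ⟶ Y} {g : Y ⟶ Z} {h : X ⟶ Z} (w : f ≫ g = h) :
    inverseImage k g ⋙ inverseImage k f ≅ inverseImage k h :=
  ((inverseImageAdj k g).comp (inverseImageAdj k f)).leftAdjointUniq
    (w ▸ inverseImageAdj k h)

/-- The canonical isomorphism `id⁻¹ ≅ id`. -/
def inverseImageId (X : TopCat.{u}) : inverseImage k (𝟙 X) ≅ 𝟭 (Shv k X) :=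
  (inverseImageAdj k (𝟙 X)).leftAdjointUniq Adjunction.id

lemma sectionsPull_comp {f : X ⟶ Y} {g : Y ⟶ Z} {h : X ⟶ Z} (w : f ≫ g = h) (P : Shv k Z) :
    (sectionsPull k g).app P ≫ (sectionsPull k f).app ((inverseImage k g).obj P) ≫
      (globalSections k X).map ((inverseImageComp k w).hom.app P) = (sectionsPull k h).app P := by
  subst w
  have h := Adjunction.unit_leftAdjointUniq_hom_app
    ((inverseImageAdj k g).comp (inverseImageAdj k f)) (inverseImageAdj k (f ≫ g)) P
  have h' := congrArg (globalSections k Z).map h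
  rw [Adjunction.comp_unit_app, Category.assoc, Functor.map_comp, Functor.map_comp] at h'
  exact h'

lemma sectionsPull_id (P : Shv k X) :
    (sectionsPull k (𝟙 X)).app P ≫
      (globalSections k X).map ((inverseImageId k X).hom.app P) = 𝟙 _ := by
  have h := Adjunction.unit_leftAdjointUniq_hom_app (inverseImageAdj k (𝟙 X)) Adjunction.id P
  have h' := congrArg (globalSections k X).map h
  rw [Functor.map_comp] at h'
  exact h'

lemma leftAdjointUniq_assoc {𝓧 𝓨 𝓩 𝓦 : Type*} [Category* 𝓧] [Category* 𝓨] [Category* 𝓩]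
    [Category* 𝓦] {Lf : 𝓨 ⥤ 𝓧} {Rf : 𝓧 ⥤ 𝓨} {Lg : 𝓩 ⥤ 𝓨} {Rg : 𝓨 ⥤ 𝓩} {Lh : 𝓦 ⥤ 𝓩} {Rh : 𝓩 ⥤ 𝓦}
    (af : Lf ⊣ Rf) (ag : Lg ⊣ Rg) (ah : Lh ⊣ Rh) {Lp : 𝓩 ⥤ 𝓧} {Lq : 𝓦 ⥤ 𝓨} {Lr : 𝓦 ⥤ 𝓧}
    (ap : Lp ⊣ Rf ⋙ Rg) (aq : Lq ⊣ Rg ⋙ Rh) (ar : Lr ⊣ Rf ⋙ Rg ⋙ Rh) (F : 𝓦) :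
    Lf.map (((ah.comp ag).leftAdjointUniq aq).hom.app F) ≫
      ((aq.comp af).leftAdjointUniq ar).hom.app F =
    ((ag.comp af).leftAdjointUniq ap).hom.app (Lh.obj F) ≫
      ((ah.comp ap).leftAdjointUniq ar).hom.app F := by
  have h1 := Adjunction.unit_leftAdjointUniq_hom_app (ag.comp af) ap (Lh.obj F)
  have h2 := Adjunction.unit_leftAdjointUniq_hom_app (ah.comp ag) aq F
  have h3 := Adjunction.unit_leftAdjointUniq_hom_app (ah.comp ap) ar F
  have h4 := Adjunction.unit_leftAdjointUniq_hom_app (aq.comp af) ar F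
  apply (((ah.comp ag).comp af).homEquiv _ _).injective
  rw [Adjunction.homEquiv_unit, Adjunction.homEquiv_unit]
  simp only [Adjunction.comp_unit_app, Functor.comp_obj, Functor.comp_map, Category.assoc,
    Functor.map_comp] at h1 h2 h3 h4 ⊢
  have n := af.unit.naturality (((ah.comp ag).leftAdjointUniq aq).hom.app F)
  have h1' := congrArg Rh.map h1
  have n' := congrArg (fun x ↦ Rh.map (Rg.map x)) n
  simp only [Functor.map_comp, Functor.id_map, Functor.comp_map, Functor.id_obj,
    Functor.comp_obj] at h1' n'
  rw [← reassoc_of% n', reassoc_of% h2, h4, reassoc_of% h1', h3]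

lemma inverseImageComp_assoc {f : X ⟶ Y} {g : Y ⟶ Z} {h : Z ⟶ W} {p : X ⟶ Z} {q : Y ⟶ W}
    {r : X ⟶ W} (w₁ : f ≫ g = p) (w₂ : g ≫ h = q) (w₃ : p ≫ h = r) (w₄ : f ≫ q = r)
    (F : Shv k W) :
    (inverseImage k f).map ((inverseImageComp k w₂).hom.app F) ≫
      (inverseImageComp k w₄).hom.app F =
    (inverseImageComp k w₁).hom.app ((inverseImage k h).obj F) ≫
      (inverseImageComp k w₃).hom.app F := by
  subst w₁ w₂ w₃
  exact leftAdjointUniq_assoc (inverseImageAdj k f) (inverseImageAdj k g) (inverseImageAdj k h)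
    (inverseImageAdj k (f ≫ g)) (inverseImageAdj k (g ≫ h)) (inverseImageAdj k (f ≫ g ≫ h)) F

lemma inverseImageComp_id (f : X ⟶ Y) (F : Shv k Y) :
    (inverseImageComp k (Category.id_comp f)).hom.app F =
      (inverseImageId k X).hom.app ((inverseImage k f).obj F) := by
  have h1 := Adjunction.unit_leftAdjointUniq_hom_app (inverseImageAdj k (𝟙 X)) Adjunction.id
    ((inverseImage k f).obj F)
  have h2 := Adjunction.unit_leftAdjointUniq_hom_app
    ((inverseImageAdj k f).comp (inverseImageAdj k (𝟙 X))) (inverseImageAdj k (𝟙 X ≫ f)) F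
  apply (((inverseImageAdj k f).comp (inverseImageAdj k (𝟙 X))).homEquiv _ _).injective
  rw [Adjunction.homEquiv_unit, Adjunction.homEquiv_unit]
  refine h2.trans ?_
  have h1' := congrArg (TopCat.Sheaf.pushforward (ModuleCat.{u} k) f).map h1
  rw [Functor.map_comp] at h1'
  rw [Adjunction.comp_unit_app, Category.assoc]
  exact ((congrArg ((inverseImageAdj k f).unit.app F ≫ ·) h1').trans
    ((congrArg _ (CategoryTheory.Functor.map_id _ _)).trans (Category.comp_id _))).symm

end Sheaves

section Deck

variable (k : Type u) [Ring k] {X X' : TopCat.{u}} (φ : X' ⟶ X)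

/-- `Aut_X(X')`, the group of homeomorphisms of `X'` commuting with `φ : X' ⟶ X`. -/
def deckGroup : Subgroup (X' ≃ₜ X') where
  carrier := {g | ∀ x, φ (g x) = φ x}
  one_mem' _ := rfl
  mul_mem' {g h} hg hh x := (hg (h x)).trans (hh x)
  inv_mem' {g} hg x := by
    have := hg (g⁻¹ x)
    rw [← this]
    exact congrArg φ (g.apply_symm_apply x)

variable {φ} in
/-- The continuous map underlying a deck transformation. -/
abbrev deckMap (g : deckGroup φ) : X' ⟶ X' := TopCat.ofHom ⟨g.1, g.1.continuous⟩

variable {φ} in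
lemma deckMap_comp (g : deckGroup φ) : deckMap g ≫ φ = φ := by
  ext x
  exact g.2 x

variable {φ} in
/-- The canonical isomorphism `g⁻¹ φ⁻¹ ≅ φ⁻¹` for a deck transformation `g`. -/
abbrev deckIso (g : deckGroup φ) : inverseImage k φ ⋙ inverseImage k (deckMap g) ≅ inverseImage k φ :=
  inverseImageComp k (deckMap_comp g)

lemma inverseImageComp_deck (g h : deckGroup φ) (F : Shv k X) :
    (inverseImage k (deckMap h)).map ((deckIso k g).hom.app F) ≫ (deckIso k h).hom.app F =
      (inverseImageComp k (rfl : deckMap h ≫ deckMap g = deckMap (g * h))).hom.app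
        ((inverseImage k φ).obj F) ≫ (deckIso k (g * h)).hom.app F :=
  inverseImageComp_assoc k _ _ _ _ F

/-- The pullback of sections `s ↦ g^* s = s ∘ g` on `Γ(X', φ⁻¹F)` for a deck transformation `g`:
the composite `Γ(X', φ⁻¹F) ⟶ Γ(X', g⁻¹φ⁻¹F) ≅ Γ(X', φ⁻¹F)`. -/
def deckSections (g : deckGroup φ) : End (inverseImage k φ ⋙ globalSections k X') :=
  sectionsOp (globalSections k X') (inverseImage k φ) (inverseImage k (deckMap g))
    (sectionsPull k (deckMap g)) (deckIso k g).hom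

/-- The left action of `Aut_X(X')` on `Γ(X', φ⁻¹F)`, natural in `F`; `g` acts by `s ↦ s ∘ g⁻¹`. -/
def deckSectionsHom : deckGroup φ →* End (inverseImage k φ ⋙ globalSections k X') where
  toFun g := deckSections k φ g⁻¹
  map_one' := by
    rw [inv_one]
    exact sectionsOp_id _ _ (inverseImageId k X').hom (sectionsPull_id k)
      (inverseImageComp_id k φ)
  map_mul' g h := by
    rw [mul_inv_rev]
    exact (sectionsOp_comp _ _ (inverseImageComp k rfl).hom (sectionsPull_comp k rfl)
      (inverseImageComp_deck k φ h⁻¹ g⁻¹)).symm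

open DerivedCategory.Plus

/-- Hypercohomology: the functor `RΓ(X, -)` on the bounded below derived category. -/
abbrev derivedSections (X : TopCat.{u}) [HasDerivedCategory (Shv k X)]
    [HasDerivedCategory (ModuleCat.{u} k)] :
    DerivedCategory.Plus (Shv k X) ⥤ DerivedCategory.Plus (ModuleCat.{u} k) :=
  (globalSections k X).rightDerivedFunctorPlus

variable [HasDerivedCategory (Shv k X')] [HasDerivedCategory (ModuleCat.{u} k)]

/-- The pullback `g^*` on `RΓ(X', φ⁻¹K)` for a deck transformation `g` and a bounded below complex
`K` of sheaves on `X`: the composite `RΓ(X', φ⁻¹K) ⟶ RΓ(X', g⁻¹φ⁻¹K) ≅ RΓ(X', φ⁻¹K)`, where the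
first map is induced by the pullback of sections. -/
def deckDerived (g : deckGroup φ) :
    End ((inverseImage k φ).mapHomotopyCategoryPlus ⋙ Qh ⋙ derivedSections k X') :=
  derivedOp (globalSections k X') (inverseImage k φ) (inverseImage k (deckMap g))
    (sectionsPull k (deckMap g)) (deckIso k g).hom

/-- The left action of `Aut_X(X')` on `RΓ(X', φ⁻¹K)`; `g` acts by pullback along `g⁻¹`. -/
def deckDerivedHom :
    deckGroup φ →* End ((inverseImage k φ).mapHomotopyCategoryPlus ⋙ Qh ⋙ derivedSections k X') where
  toFun g := deckDerived k φ g⁻¹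
  map_one' := by
    rw [inv_one]
    exact derivedOp_id _ _ (inverseImageId k X').hom (sectionsPull_id k)
      (inverseImageComp_id k φ)
  map_mul' g h := by
    rw [mul_inv_rev]
    exact (derivedOp_comp _ _ (inverseImageComp k rfl).hom (sectionsPull_comp k rfl)
      (inverseImageComp_deck k φ h⁻¹ g⁻¹)).symm

variable [HasDerivedCategory (Shv k X)]

/-- The cohomology functor `K ↦ Hⁱ(X', φ⁻¹K)`, `D⁺(X) ⥤ Mod(k)`. -/
abbrev pullbackCohomology (i : ℤ) : DerivedCategory.Plus (Shv k X) ⥤ ModuleCat.{u} k :=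
  (exactDerived (inverseImage k φ) ⋙ derivedSections k X') ⋙ homologyFunctor (ModuleCat.{u} k) i

/-- The left action of `Aut_X(X')` on `Hⁱ(X', φ⁻¹K)` for `K` in `D⁺(X)`. -/
def deckCohomologyHom (i : ℤ) : deckGroup φ →* End (pullbackCohomology k φ i) where
  toFun g := Functor.whiskerRight (Localization.liftNatTrans Qh
    (HomotopyCategory.Plus.quasiIso (Shv k X)) _ _ _ _ (deckDerivedHom k φ g))
      (homologyFunctor (ModuleCat.{u} k) i)
  map_one' := by
    rw [map_one]
    exact (congrArg (Functor.whiskerRight · _)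
      (Localization.liftNatTrans_id Qh _ _ _)).trans (Functor.whiskerRight_id' _)
  map_mul' g h := by
    rw [map_mul]
    exact (congrArg (Functor.whiskerRight · _)
      (Localization.comp_liftNatTrans Qh (HomotopyCategory.Plus.quasiIso (Shv k X))
        _ _ _ _ _ _ (deckDerivedHom k φ h) (deckDerivedHom k φ g)).symm).trans
      (Functor.whiskerRight_comp _ _ _)

/-- A functor to `k`-modules with an action of `G` by natural endomorphisms, as a functor to
`k`-linear representations of `G`. -/
def toRep {C : Type*} [Category* C] {G : Type u} [Group G] (Φ : C ⥤ ModuleCat.{u} k)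
    (ρ : G →* End Φ) : C ⥤ Rep.{u} k G where
  obj F := Rep.of (
    { toFun g := ((ρ g).app F).hom
      map_one' := by rw [map_one]; rfl
      map_mul' g h := by rw [map_mul]; rfl } : Representation k G (Φ.obj F))
  map {F F'} f := Rep.ofHom
    { toLinearMap := (Φ.map f).hom
      isIntertwining' g := by
        ext x
        exact (ConcreteCategory.congr_hom ((ρ g).naturality f) x).symm }
  map_id F := by
    ext x
    exact ConcreteCategory.congr_hom (Φ.map_id F) x
  map_comp f f' := by
    ext x
    exact ConcreteCategory.congr_hom (Φ.map_comp f f') x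

end Deck

section Constant

variable (k : Type u) [Ring k]

/-- The constant sheaf functor `M ↦ M_X`. -/
abbrev constSheaf (X : TopCat.{u}) : ModuleCat.{u} k ⥤ Shv k X :=
  constantSheaf (Opens.grothendieckTopology X) (ModuleCat.{u} k)

variable {X Y : TopCat.{u}}

/-- The adjunction `(-)_X ⊣ Γ(X, -)`. -/
def constSheafAdj (X : TopCat.{u}) : constSheaf k X ⊣ globalSections k X :=
  constantSheafAdj _ _ (isTerminalTop (α := Opens X))

instance (X : TopCat.{u}) : (constSheaf k X).IsLeftAdjoint := (constSheafAdj k X).isLeftAdjoint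

set_option synthInstance.maxHeartbeats 200000 in
instance (X : TopCat.{u}) : PreservesFiniteLimits (constSheaf k X) := by
  have : PreservesFiniteLimits (presheafToSheaf (Opens.grothendieckTopology X) (ModuleCat.{u} k)) :=
    inferInstance
  have h2 : PreservesFiniteLimits (Functor.const (Opens X)ᵒᵖ : ModuleCat.{u} k ⥤ _) :=
    ⟨fun _ _ _ => inferInstance⟩
  exact @comp_preservesFiniteLimits _ _ _ _ _ _ _ _ h2 this

variable {k} in
/-- The map from a module to the sections of its constant sheaf. -/
abbrev constEta (M : ModuleCat.{u} k) (X : TopCat.{u}) :=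
  toSheafify (Opens.grothendieckTopology X) ((Functor.const (Opens X)ᵒᵖ).obj M)

variable {k} in
lemma constEta_inj (M : ModuleCat.{u} k) {V : Opens X} {x : X} (hx : x ∈ V) (s t : M)
    (h : (constEta M X).app (op V) s = (constEta M X).app (op V) t) : s = t := by
  obtain ⟨W, f, hf, hxW⟩ := Presheaf.equalizerSieve_mem (Opens.grothendieckTopology X)
    (constEta M X) (X := op V) s t h x hx
  exact hf

variable {k} in
lemma constEta_map (M : ModuleCat.{u} k) {V W : Opens X} (f : V ⟶ W) (s : M) :
    (sheafify (Opens.grothendieckTopology X) ((Functor.const (Opens X)ᵒᵖ).obj M)).map f.op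
      ((constEta M X).app (op W) s) = (constEta M X).app (op V) s :=
  (ConcreteCategory.congr_hom ((constEta M X).naturality f.op) s).symm

lemma const_unit_bijective [ConnectedSpace X] (M : ModuleCat.{u} k) :
    Function.Bijective ((constSheafAdj k X).unit.app M) := by
  have hu : (constSheafAdj k X).unit.app M = (constEta M X).app (op ⊤) := by
    refine (Adjunction.comp_unit_app _ _ _).trans ?_
    refine Category.id_comp _
  rw [hu]
  refine ⟨fun s t h ↦ constEta_inj M (Opens.mem_top (Classical.arbitrary X)) s t h, fun (s : ToType
    ((sheafify (Opens.grothendieckTopology X) ((Functor.const (Opens X)ᵒᵖ).obj M)).obj (op ⊤))) ↦ ?_⟩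
  have hs := Presheaf.imageSieve_mem (Opens.grothendieckTopology X) (constEta M X) (U := op ⊤) s
  choose V f hf hxV using fun x : X ↦ hs x (Opens.mem_top x)
  choose c hc using hf
  let c' : X → M := c
  replace hc (x : X) : (constEta M X).app (op (V x)) (c' x) = _ := hc x
  have hloc : IsLocallyConstant c' := by
    rw [IsLocallyConstant.iff_exists_open]
    refine fun x ↦ ⟨V x, (V x).isOpen, hxV x, fun y hy ↦ ?_⟩
    refine Eq.symm <| constEta_inj M (V := V x ⊓ V y) (x := y) ⟨hy, hxV y⟩ _ _ ?_
    rw [← constEta_map M (Opens.infLELeft _ _), ← constEta_map M (Opens.infLERight _ _), hc, hc,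
      ← ConcreteCategory.comp_apply, ← ConcreteCategory.comp_apply, ← Functor.map_comp,
      ← Functor.map_comp]
    rfl
  refine ⟨c' (Classical.arbitrary X), ?_⟩
  refine TopCat.Sheaf.eq_of_locally_eq' ((constSheaf k X).obj M) V ⊤ f (fun x _ ↦ ?_) _ _ fun x ↦ ?_
  · simpa using ⟨x, hxV x⟩
  · refine (constEta_map M (f x) _).trans ?_
    rw [hloc.apply_eq_of_preconnectedSpace _ x]
    exact hc x

instance [ConnectedSpace X] : IsIso (constSheafAdj k X).unit := by
  have (M : ModuleCat.{u} k) : IsIso ((constSheafAdj k X).unit.app M) :=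
    (ConcreteCategory.isIso_iff_bijective _).mpr (const_unit_bijective k M)
  exact NatIso.isIso_of_isIso_app _

instance [ConnectedSpace X] : (constSheaf k X).Full := (constSheafAdj k X).fullyFaithfulLOfIsIsoUnit.full
instance [ConnectedSpace X] : (constSheaf k X).Faithful := (constSheafAdj k X).fullyFaithfulLOfIsIsoUnit.faithful

/-- The inverse image of a constant sheaf is constant. -/
def inverseImageConst (f : X ⟶ Y) : constSheaf k Y ⋙ inverseImage k f ≅ constSheaf k X :=
  ((constSheafAdj k Y).comp (inverseImageAdj k f)).leftAdjointUniq (constSheafAdj k X)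

end Constant

section Quasicoherent

variable (k : Type u) [Ring k] (X : TopCat.{u})

/-- The restriction `F ↦ F|_U` to an open subset. -/
abbrev restrict {X : TopCat.{u}} (U : Opens X) :
    Shv k X ⥤ Shv k ((Opens.toTopCat X).obj U) :=
  inverseImage k U.inclusion'

/-- A sheaf of `k`-modules `F` is quasi-coherent if every point has an open neighbourhood `U` with
an exact sequence `k_U^{⊕ I} ⟶ k_U^{⊕ J} ⟶ F|_U ⟶ 0`. -/
def isQuasicoherent : ObjectProperty (Shv k X) := fun F ↦
  ∀ x : X, ∃ U : Opens X, x ∈ U ∧ ∃ (I J : Type u)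
    (a : (∐ fun _ : I ↦ (constSheaf k ((Opens.toTopCat X).obj U)).obj (ModuleCat.of k k)) ⟶
      ∐ fun _ : J ↦ (constSheaf k ((Opens.toTopCat X).obj U)).obj (ModuleCat.of k k))
    (b : (∐ fun _ : J ↦ (constSheaf k ((Opens.toTopCat X).obj U)).obj (ModuleCat.of k k)) ⟶
      (restrict k U).obj F) (w : a ≫ b = 0), (ShortComplex.mk a b w).Exact ∧ Epi b

variable {X}

/-- The sheaves whose restriction to the open subset `W` is constant. -/
abbrev isConstOn (W : Opens X) : ObjectProperty (Shv k X) :=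
  (constSheaf k ((Opens.toTopCat X).obj W)).essImage.inverseImage (restrict k W)

instance (W : Opens X) (J : Type) [SmallCategory J] [FinCategory J]
    [ConnectedSpace ((Opens.toTopCat X).obj W)] :
    (isConstOn k W).IsClosedUnderLimitsOfShape J := inferInstance

instance (W : Opens X) (J : Type) [SmallCategory J] [FinCategory J]
    [ConnectedSpace ((Opens.toTopCat X).obj W)] :
    (isConstOn k W).IsClosedUnderColimitsOfShape J := inferInstance

lemma coprod_const_mem (X : TopCat.{u}) (I : Type u) (M : ModuleCat.{u} k) :
    (constSheaf k X).essImage (∐ fun _ : I ↦ (constSheaf k X).obj M) :=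
  ⟨∐ fun _ : I ↦ M, ⟨PreservesCoproduct.iso (constSheaf k X) _⟩⟩

lemma isConst_cokernel (X : TopCat.{u}) [ConnectedSpace X] {A B C : Shv k X} {a : A ⟶ B} {b : B ⟶ C}
    {w : a ≫ b = 0} (h : (ShortComplex.mk a b w).Exact) (hb : Epi b)
    (hA : (constSheaf k X).essImage A) (hB : (constSheaf k X).essImage B) :
    (constSheaf k X).essImage C := by
  have hc := h.gIsCokernel
  refine ObjectProperty.prop_of_isColimit (J := WalkingParallelPair) _ hc ?_
  rintro (_ | _)
  · exact hA
  · exact hB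

lemma isConst_pull {X Y : TopCat.{u}} (f : X ⟶ Y) {F : Shv k Y}
    (h : (constSheaf k Y).essImage F) : (constSheaf k X).essImage ((inverseImage k f).obj F) := by
  obtain ⟨M, ⟨e⟩⟩ := h
  exact ⟨M, ⟨((inverseImageConst k f).app M).symm ≪≫ (inverseImage k f).mapIso e⟩⟩

lemma exists_epi_coprod (N : ModuleCat.{u} k) :
    ∃ (J : Type u) (p : (∐ fun _ : J ↦ ModuleCat.of k k) ⟶ N), Epi p := by
  let q (n : N) : ModuleCat.of k k ⟶ N := ModuleCat.ofHom (LinearMap.toSpanSingleton k N n)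
  refine ⟨N, Sigma.desc q, (ModuleCat.epi_iff_surjective _).mpr fun n ↦
    ⟨Sigma.ι (fun _ : N ↦ ModuleCat.of k k) n (1 : k), ?_⟩⟩
  refine (ConcreteCategory.congr_hom (Sigma.ι_desc q n) (1 : k)).trans ?_
  exact one_smul k n

lemma exists_presentation (M : ModuleCat.{u} k) :
    ∃ (I J : Type u) (a : (∐ fun _ : I ↦ ModuleCat.of k k) ⟶ ∐ fun _ : J ↦ ModuleCat.of k k)
      (b : (∐ fun _ : J ↦ ModuleCat.of k k) ⟶ M) (w : a ≫ b = 0),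
      (ShortComplex.mk a b w).Exact ∧ Epi b := by
  obtain ⟨J, b, hb⟩ := exists_epi_coprod k M
  obtain ⟨I, a, ha⟩ := exists_epi_coprod k (kernel b)
  refine ⟨I, J, a ≫ kernel.ι b, b, by simp, ?_, hb⟩
  let S := ShortComplex.mk (kernel.ι b) b (by simp)
  let g : ShortComplex.mk (a ≫ kernel.ι b) b (by simp) ⟶ S :=
    { τ₁ := a, τ₂ := 𝟙 _, τ₃ := 𝟙 _ }
  have : Epi g.τ₁ := ha
  have : IsIso g.τ₂ := inferInstanceAs (IsIso (𝟙 _))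
  have : Mono g.τ₃ := inferInstanceAs (Mono (𝟙 _))
  exact (ShortComplex.exact_iff_of_epi_of_isIso_of_mono g).mpr
    (S.exact_of_f_is_kernel (kernelIsKernel b))

lemma isQuasicoherent_of_isConstOn {F : Shv k X}
    (h : ∀ x, ∃ W : Opens X, x ∈ W ∧ isConstOn k W F) : isQuasicoherent k X F := by
  intro x
  obtain ⟨W, hW, M, ⟨e⟩⟩ := h x
  obtain ⟨I, J, a, b, w, hex, hb⟩ := exists_presentation k M
  let C := constSheaf k ((Opens.toTopCat X).obj W)
  let i₁ := PreservesCoproduct.iso C (fun _ : I ↦ ModuleCat.of k k)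
  let i₂ := PreservesCoproduct.iso C (fun _ : J ↦ ModuleCat.of k k)
  have w' : (i₁.inv ≫ C.map a ≫ i₂.hom) ≫ i₂.inv ≫ C.map b ≫ e.hom = 0 := by
    have : C.map a ≫ C.map b = 0 := by rw [← C.map_comp, w, C.map_zero]
    simp [reassoc_of% this]
  refine ⟨W, hW, I, J, i₁.inv ≫ C.map a ≫ i₂.hom, i₂.inv ≫ C.map b ≫ e.hom, w',
    ShortComplex.exact_of_iso (ShortComplex.isoMk i₁ i₂ e
      (Iso.hom_inv_id_assoc i₁ _) (Iso.hom_inv_id_assoc i₂ _)) (hex.map C), inferInstance⟩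

lemma exists_isConstOn {F : Shv k X} (h : isQuasicoherent k X F) (x : X) :
    ∃ U : Opens X, x ∈ U ∧ ∀ W : Opens X, W ≤ U → IsConnected (W : Set X) → isConstOn k W F := by
  obtain ⟨U, hU, I, J, a, b, w, hex, hb⟩ := h x
  refine ⟨U, hU, fun W hW hc ↦ ?_⟩
  have : ConnectedSpace ((Opens.toTopCat X).obj W) := isConnected_iff_connectedSpace.mp hc
  let f : (Opens.toTopCat X).obj W ⟶ (Opens.toTopCat X).obj U :=
    (Opens.toTopCat X).map (homOfLE hW)
  have hf : f ≫ U.inclusion' = W.inclusion' := rfl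
  let S := (ShortComplex.mk a b w).map (inverseImage k f)
  have hS : S.Exact := hex.map (inverseImage k f)
  have : Epi S.g := inferInstanceAs (Epi ((inverseImage k f).map b))
  have key := isConst_cokernel k _ (a := S.f) (b := S.g) hS this
    (isConst_pull k f (coprod_const_mem k _ I _)) (isConst_pull k f (coprod_const_mem k _ J _))
  exact ObjectProperty.prop_of_iso (constSheaf k _).essImage ((inverseImageComp k hf).app F) key

lemma isQuasicoherent_iff [LocallyConnectedSpace X] (F : Shv k X) : isQuasicoherent k X F ↔
    ∀ x, ∃ U : Opens X, x ∈ U ∧ ∀ W : Opens X, W ≤ U → IsConnected (W : Set X) →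
      isConstOn k W F := by
  refine ⟨exists_isConstOn k, fun h ↦ isQuasicoherent_of_isConstOn k fun x ↦ ?_⟩
  obtain ⟨U, hU, h⟩ := h x
  exact ⟨⟨connectedComponentIn U x, U.isOpen.connectedComponentIn⟩, mem_connectedComponentIn hU,
    h _ (connectedComponentIn_subset _ _) (isConnected_connectedComponentIn_iff.mpr hU)⟩

lemma exists_common [LocallyConnectedSpace X] {ι : Type} [Finite ι] {F : ι → Shv k X}
    (h : ∀ j, isQuasicoherent k X (F j)) (x : X) :
    ∃ U : Opens X, x ∈ U ∧ ∀ W : Opens X, W ≤ U → IsConnected (W : Set X) →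
      ∀ j, isConstOn k W (F j) := by
  choose U hU hF using fun j ↦ (isQuasicoherent_iff k _).mp (h j) x
  refine ⟨⟨⋂ j, U j, isOpen_iInter_of_finite fun j ↦ (U j).isOpen⟩,
    Set.mem_iInter.mpr hU, fun W hW hc j ↦ hF j W (hW.trans (Set.iInter_subset _ j)) hc⟩

lemma qcoh_limits [LocallyConnectedSpace X] (J : Type) [SmallCategory J] [FinCategory J] :
    (isQuasicoherent k X).IsClosedUnderLimitsOfShape J where
  limitsOfShape_le := by
    rintro F ⟨p⟩
    rw [isQuasicoherent_iff]
    intro x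
    obtain ⟨U, hU, h⟩ := exists_common k p.prop_diag_obj x
    refine ⟨U, hU, fun W hW hc ↦ ?_⟩
    have : ConnectedSpace ((Opens.toTopCat X).obj W) := isConnected_iff_connectedSpace.mp hc
    exact (isConstOn k W).prop_of_isLimit p.isLimit (h W hW hc)

lemma qcoh_colimits [LocallyConnectedSpace X] (J : Type) [SmallCategory J] [FinCategory J] :
    (isQuasicoherent k X).IsClosedUnderColimitsOfShape J where
  colimitsOfShape_le := by
    rintro F ⟨p⟩
    rw [isQuasicoherent_iff]
    intro x
    obtain ⟨U, hU, h⟩ := exists_common k p.prop_diag_obj x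
    refine ⟨U, hU, fun W hW hc ↦ ?_⟩
    have : ConnectedSpace ((Opens.toTopCat X).obj W) := isConnected_iff_connectedSpace.mp hc
    exact (isConstOn k W).prop_of_isColimit p.isColimit (h W hW hc)

variable [LocallyConnectedSpace X]

instance : (isQuasicoherent k X).IsClosedUnderFiniteProducts where
  isClosedUnderLimitsOfShape J _ :=
    have := Fintype.ofFinite J
    have := Classical.decEq J
    qcoh_limits k _

instance : (isQuasicoherent k X).ContainsZero where
  exists_zero := ⟨⊤_ _, IsZero.of_iso (isZero_zero _) (terminalIsTerminal.uniqueUpToIso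
    (isZero_zero _).isTerminal), ObjectProperty.prop_terminal _⟩

instance : (isQuasicoherent k X).IsClosedUnderKernels where
  kernels_le := by
    rintro _ ⟨f, c, hc, hf⟩
    have := qcoh_limits k (X := X) WalkingParallelPair
    refine (isQuasicoherent k X).prop_of_isLimit hc ?_
    rintro (_ | _)
    · exact hf.1
    · exact hf.2

instance : (isQuasicoherent k X).IsClosedUnderCokernels where
  cokernels_le := by
    rintro _ ⟨f, c, hc, hf⟩
    have := qcoh_colimits k (X := X) WalkingParallelPair
    refine (isQuasicoherent k X).prop_of_isColimit hc ?_
    rintro (_ | _)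
    · exact hf.1
    · exact hf.2

/-- The category of quasi-coherent sheaves of `k`-modules on `X`. -/
abbrev Qcoh (X : TopCat.{u}) := (isQuasicoherent k X).FullSubcategory

end Quasicoherent

section Topological

open scoped Topology

/-- A covering `p : E → Y` is trivial if it is isomorphic over `Y` to `Y × I → Y` for a discrete
space `I`. -/
def IsTrivialCovering {E Y : Type u} [TopologicalSpace E] [TopologicalSpace Y] (p : E → Y) : Prop :=
  ∃ (I : Type u) (_ : TopologicalSpace I) (_ : DiscreteTopology I) (e : E ≃ₜ Y × I),
    ∀ z, (e z).1 = p z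

/-- A space is simply connected if it is connected and all its coverings are trivial. -/
structure IsSimplyConnected (Y : Type u) [TopologicalSpace Y] : Prop where
  connected : ConnectedSpace Y
  trivial_covering (E : Type u) [TopologicalSpace E] (p : E → Y) (hp : IsCoveringMap p) :
    IsTrivialCovering p

/-- A space is locally simply connected if its simply connected open subsets form a basis of the
topology. -/
class LocallySimplyConnected (X : Type u) [TopologicalSpace X] : Prop where
  exists_isSimplyConnected (x : X) (V : Set X) (hV : V ∈ 𝓝 x) :
    ∃ U : Set X, IsOpen U ∧ x ∈ U ∧ U ⊆ V ∧ IsSimplyConnected U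

instance (X : Type u) [TopologicalSpace X] [LocallySimplyConnected X] : LocallyConnectedSpace X :=
  locallyConnectedSpace_iff_subsets_isOpen_isConnected.mpr fun x V hV ↦ by
    obtain ⟨U, hU, hx, hUV, h⟩ := LocallySimplyConnected.exists_isSimplyConnected x V hV
    exact ⟨U, hUV, hU, hx, isConnected_iff_connectedSpace.mpr h.connected⟩

end Topological

section Main

variable (k : Type u) [Ring k] {X X' : TopCat.{u}} (φ : X' ⟶ X)

/-- A universal covering is a covering whose total space is simply connected. -/
structure IsUniversalCovering : Prop where
  isCoveringMap : IsCoveringMap φ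
  isSimplyConnected : IsSimplyConnected X'

/-- The functor `F ↦ Γ(X', φ⁻¹F)` from sheaves on `X` to `G`-modules, where `G = Aut_X(X')`. -/
def sectionsRep : Shv k X ⥤ Rep.{u} k (deckGroup φ) :=
  toRep k _ (deckSectionsHom k φ)

/-- The functor `L ↦ Γ(X', φ⁻¹L)` from quasi-coherent sheaves on `X` to `G`-modules. -/
def qcohRep : Qcoh k X ⥤ Rep.{u} k (deckGroup φ) :=
  (isQuasicoherent k X).ι ⋙ sectionsRep k φ

/-- The functor `F ↦ Hⁱ(X', φ⁻¹F)` from `D⁺(X)` to `G`-modules. -/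
def cohomologyRep [HasDerivedCategory (Shv k X)] [HasDerivedCategory (Shv k X')]
    [HasDerivedCategory (ModuleCat.{u} k)] (i : ℤ) :
    DerivedCategory.Plus (Shv k X) ⥤ Rep.{u} k (deckGroup φ) :=
  toRep k _ (deckCohomologyHom k φ i)

variable {k}

/-- The functor `Rⁱ Qc = Hⁱ ∘ R Qc`, `D⁺(X) ⥤ Qcoh_k(X)`, for a right adjoint `Qc` of the inclusion
of quasi-coherent sheaves. -/
def higherQc [LocallyConnectedSpace X] [HasDerivedCategory (Shv k X)]
    [HasDerivedCategory (Qcoh k X)] {Qc : Shv k X ⥤ Qcoh k X} (adj : (isQuasicoherent k X).ι ⊣ Qc)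
    (i : ℤ) : DerivedCategory.Plus (Shv k X) ⥤ Qcoh k X :=
  have : Qc.Additive := adj.right_adjoint_additive
  Qc.rightDerivedFunctorPlus ⋙ DerivedCategory.Plus.homologyFunctor (Qcoh k X) i

end Main

end LocSys

end

/-! On a locally connected space the quasi-coherent sheaves are the locally constant ones, by
`isQuasicoherent_iff`. For such `L` the sheaf `φ⁻¹L` is locally constant on the simply connected
space `X'`; its étale space is a covering, hence trivial, so germs extend uniquely to global
sections and `φ⁻¹L` is constant (`germAt_top_bijective`,
`essImage_inverseImage_of_isQuasicoherent`).

Call a connected open `V ⊆ X'` on which `φ` is injective a sheet. Since `φ` is open, `(φ⁻¹F)(V) =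
F(φ(V))` for every sheaf `F` (`pull_bijective`), and for quasi-coherent `L` this gives `L(φ(V)) =
Γ(X', φ⁻¹L)`. The images of sheets form a basis of `X`. Hence a linear map `Γ(X', φ⁻¹L) → Γ(X',
φ⁻¹A)` yields maps `L(φ(V)) → A(φ(V))`; they commute with restriction when the linear map is
equivariant, because a sheet over a smaller open set is moved into `V` by a deck transformation. So
`Hom(L, A) = Hom_G(Γ(X', φ⁻¹L), Γ(X', φ⁻¹A))` for `L` quasi-coherent and `A` arbitrary
(`sectionsRep_map_injective`, `sectionsRep_map_surjective`).

Taking `A` quasi-coherent gives full faithfulness in (a); essential surjectivity comes from the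
sheaf of equivariant locally constant functions on `X'` (`exists_iso_sectionsRep`). Taking `A`
arbitrary gives (b) formally: `Qc(A)` is the quasi-coherent sheaf with representation `Γ(X', φ⁻¹A)`,
and the counit `Qc(A) → A` becomes an isomorphism on these representations
(`isLeftAdjoint_of_bijective_map`, `isIso_map_counit`).

For (d), the presheaf `U ↦ ⨁ P(V)`, summed over the open `V` mapped bijectively to `U`, plays the
role of extension by zero. It preserves monomorphisms, and an injective sheaf is injective as a
presheaf, which gives the required extensions (`injective_inverseImage`).

For (c), every object of `D⁺(X)` is represented by a complex `I` of injectives. Then `R Qc` is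
computed by `Qc(I)`, and `RΓ` of `φ⁻¹I` by `Γ(X', φ⁻¹I)`, using (d). The counit identifies `Γ(X',
φ⁻¹Qc(I))` with `Γ(X', φ⁻¹I)`, and `L ↦ Γ(X', φ⁻¹L)` is exact on quasi-coherent sheaves, so it
commutes with cohomology (`exists_comparison`). All these identifications respect the operators
given by deck transformations. -/

noncomputable section
namespace LocSys

/-! ### Covering spaces: lifts, deck transformations and sheets. -/

section CoveringSpaces

open Topology

section

variable {E Y A : Type*} [TopologicalSpace E] [TopologicalSpace Y] [TopologicalSpace A]
  {p : E → Y}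

/-- The base change of a covering map along a continuous map is a covering map. -/
lemma isCoveringMap_pullback_fst (hp : IsCoveringMap p) {f : A → Y} (hf : Continuous f) :
    IsCoveringMap (fun z : {z : A × E // f z.1 = p z.2} ↦ z.1.1) := by
  intro a
  obtain ⟨hI, U, haU, hU, hpU, H, hH⟩ := hp (f a)
  -- The trivialization of `p` near `f a` is reused: a point of the fibre product keeps its
  -- `A`-coordinate and the sheet coordinate of its `E`-component.
  refine IsEvenlyCovered.to_isEvenlyCovered_preimage (I := p ⁻¹' {f a})
    ⟨hI, f ⁻¹' U, haU, hU.preimage hf, (hU.preimage hf).preimage (by fun_prop), ?_⟩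
  have mem (z : (fun z : {z : A × E // f z.1 = p z.2} ↦ z.1.1) ⁻¹' (f ⁻¹' U)) :
      p z.1.1.2 ∈ U := z.1.2 ▸ z.2
  have hs (x : U × p ⁻¹' {f a}) : p (H.symm x) = x.1 := by
    rw [← hH, H.apply_symm_apply]
  refine ⟨{ toFun z := (⟨z.1.1.1, z.2⟩, (H ⟨z.1.1.2, mem z⟩).2)
            invFun x := ⟨⟨(x.1.1, H.symm (⟨f x.1.1, x.1.2⟩, x.2)), (hs (⟨f x.1.1, x.1.2⟩, x.2)).symm⟩, x.1.2⟩
            left_inv z := ?_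
            right_inv x := by simp
            continuous_toFun := by fun_prop
            continuous_invFun := ?_ }, fun _ ↦ rfl⟩
  swap
  · refine Continuous.subtype_mk (Continuous.subtype_mk (Continuous.prodMk (by fun_prop) ?_) _) _
    exact continuous_subtype_val.comp (H.symm.continuous.comp (by fun_prop))
  have : ((⟨f z.1.1.1, z.2⟩ : U), (H ⟨z.1.1.2, mem z⟩).2) = H ⟨z.1.1.2, mem z⟩ :=
    Prod.ext (Subtype.ext (z.1.2.trans (hH ⟨z.1.1.2, mem z⟩).symm)) rfl
  refine Subtype.ext (Subtype.ext (Prod.ext rfl ?_))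
  simp only [this, H.symm_apply_apply]

/-- The range is clopen. Its complement is open because over an evenly covered set one nonempty
fibre forces all fibres to be nonempty. -/
lemma isCoveringMap_surjective [PreconnectedSpace Y] [Nonempty E] (hp : IsCoveringMap p) :
    Function.Surjective p := by
  refine Set.range_eq_univ.mp (IsClopen.eq_univ ⟨⟨?_⟩, hp.isOpenMap.isOpen_range⟩
    (Set.range_nonempty p))
  refine isOpen_iff_forall_mem_open.mpr fun y hy ↦ ?_
  obtain ⟨-, U, hyU, hU, -, H, hH⟩ := hp y
  refine ⟨U, ?_, hU, hyU⟩
  rintro _ hz ⟨e, rfl⟩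
  refine hy ⟨H.symm (⟨y, hyU⟩, (H ⟨e, hz⟩).2), ?_⟩
  rw [← hH, H.apply_symm_apply]

/-- Take the connected component of the point in the image of a chart and transport it back;
components of open subsets of `Y` are open. -/
lemma exists_connected_injOn [LocallyConnectedSpace Y] (hp : IsLocalHomeomorph p) {e : E}
    {O : Set E} (hO : IsOpen O) (he : e ∈ O) :
    ∃ V : Set E, IsOpen V ∧ e ∈ V ∧ V ⊆ O ∧ IsConnected V ∧ V.InjOn p := by
  obtain ⟨t, het, rfl⟩ := hp e
  have hN : IsOpen (t.source ∩ O) := t.open_source.inter hO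
  have hW : IsOpen (connectedComponentIn (t '' (t.source ∩ O)) (t e)) :=
    (hp.isOpenMap _ hN).connectedComponentIn
  have heN : t e ∈ t '' (t.source ∩ O) := ⟨e, ⟨het, he⟩, rfl⟩
  have hsub := connectedComponentIn_subset (t '' (t.source ∩ O)) (t e)
  refine ⟨t.symm '' (connectedComponentIn (t '' (t.source ∩ O)) (t e)),
    t.symm.isOpen_image_of_subset_source hW ?_, ⟨t e, mem_connectedComponentIn heN,
    t.left_inv het⟩, ?_, ?_, ?_⟩
  · intro y hy
    obtain ⟨z, hz, rfl⟩ := hsub hy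
    exact t.map_source hz.1
  · rintro _ ⟨y, hy, rfl⟩
    obtain ⟨z, hz, rfl⟩ := hsub hy
    rw [t.left_inv hz.1]
    exact hz.2
  · refine (isConnected_connectedComponentIn_iff.mpr heN).image _ (t.continuousOn_symm.mono ?_)
    intro y hy
    obtain ⟨z, hz, rfl⟩ := hsub hy
    exact t.map_source hz.1
  · refine t.injOn.mono ?_
    rintro _ ⟨y, hy, rfl⟩
    obtain ⟨z, hz, rfl⟩ := hsub hy
    rw [t.left_inv hz.1]
    exact hz.1

end

section

variable {E Y : Type u} [TopologicalSpace E] [TopologicalSpace Y] {p : E → Y}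

/-- The base change of `p` along itself is a covering of `E`, hence trivial, so a continuous section
of it passes through `(e₁, e₂)`. The second coordinate of this section is `g`. -/
lemma exists_lift_of_isSimplyConnected (hE : IsSimplyConnected E) (hp : IsCoveringMap p)
    {e₁ e₂ : E} (h : p e₁ = p e₂) :
    ∃ g : E → E, Continuous g ∧ (∀ e, p (g e) = p e) ∧ g e₁ = e₂ := by
  obtain ⟨I, _, _, H, hH⟩ := hE.trivial_covering _ _ (isCoveringMap_pullback_fst hp hp.continuous)
  have key (e : E) (i : I) : (H.symm (e, i)).1.1 = e :=
    (hH _).symm.trans (congrArg Prod.fst (H.apply_symm_apply _))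
  refine ⟨fun e ↦ (H.symm (e, (H ⟨(e₁, e₂), h⟩).2)).1.2, by fun_prop, fun e ↦ ?_, ?_⟩
  · refine (H.symm (e, (H ⟨(e₁, e₂), h⟩).2)).2.symm.trans ?_
    rw [key]
  · have : (e₁, (H ⟨(e₁, e₂), h⟩).2) = H ⟨(e₁, e₂), h⟩ := Prod.ext (hH ⟨(e₁, e₂), h⟩).symm rfl
    dsimp only
    rw [this, H.symm_apply_apply]

end

variable {X X' : TopCat.{u}} {φ : X' ⟶ X}

/-- The self-maps over `X` taking `y₁` to `y₂` and `y₂` to `y₁` are inverse to each other by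
uniqueness of lifts. Thus the fibres of `φ` are orbits of the deck group. -/
lemma exists_deck (hφ : IsUniversalCovering φ) {y₁ y₂ : X'} (h : φ y₁ = φ y₂) :
    ∃ g : deckGroup φ, g.1 y₁ = y₂ := by
  have := hφ.isSimplyConnected.connected
  obtain ⟨g, hg, hgp, hg1⟩ :=
    exists_lift_of_isSimplyConnected hφ.isSimplyConnected hφ.isCoveringMap h
  obtain ⟨g', hg', hgp', hg1'⟩ :=
    exists_lift_of_isSimplyConnected hφ.isSimplyConnected hφ.isCoveringMap h.symm
  have h1 : g' ∘ g = id := hφ.isCoveringMap.eq_of_comp_eq (hg'.comp hg) continuous_id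
    (funext fun e ↦ (hgp' _).trans (hgp e)) y₁ (by simp [hg1, hg1'])
  have h2 : g ∘ g' = id := hφ.isCoveringMap.eq_of_comp_eq (hg.comp hg') continuous_id
    (funext fun e ↦ (hgp _).trans (hgp' e)) y₂ (by simp [hg1, hg1'])
  exact ⟨⟨⟨⟨g, g', congrFun h1, congrFun h2⟩, hg, hg'⟩, hgp⟩, hg1⟩

lemma deck_ext (hφ : IsUniversalCovering φ) {g h : deckGroup φ} {y : X'} (e : g.1 y = h.1 y) :
    g = h := by
  have := hφ.isSimplyConnected.connected
  refine Subtype.ext (Homeomorph.ext fun z ↦ ?_)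
  exact congrFun (hφ.isCoveringMap.eq_of_comp_eq g.1.continuous h.1.continuous
    (funext fun e ↦ (g.2 e).trans (h.2 e).symm) y e) z

/-- A sheet of `φ` is a connected open subset on which `φ` is injective. -/
structure IsSheet (φ : X' ⟶ X) (V : Opens X') : Prop where
  isConnected : IsConnected (V : Set X')
  injOn : Set.InjOn φ V

lemma exists_isSheet [LocallyConnectedSpace X] (hφ : IsLocalHomeomorph φ) {y : X'} {O : Opens X'}
    (hy : y ∈ O) : ∃ V : Opens X', y ∈ V ∧ V ≤ O ∧ IsSheet φ V := by
  obtain ⟨V, hV, hyV, hVO, hc, hi⟩ := exists_connected_injOn hφ O.isOpen hy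
  exact ⟨⟨V, hV⟩, hyV, hVO, hc, hi⟩

/-- The sheets form a basis of the topology. -/
lemma isBasis_isSheet [LocallyConnectedSpace X] (hφ : IsLocalHomeomorph φ) :
    Opens.IsBasis (Set.range (Subtype.val : {V : Opens X' // IsSheet φ V} → Opens X')) := by
  rw [Opens.isBasis_iff_nbhd]
  intro O y hy
  obtain ⟨V, hyV, hVO, hV⟩ := exists_isSheet hφ hy
  exact ⟨V, ⟨⟨V, hV⟩, rfl⟩, hyV, hVO⟩

/-- If the image of a sheet is contained in the image of an open subset on which the covering is
injective, then a deck transformation maps the sheet into this open subset. -/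
lemma exists_deck_image (hφ : IsUniversalCovering φ) {V₁ V₂ : Opens X'} (h₁ : IsSheet φ V₁)
    (h : φ '' V₁ ⊆ φ '' V₂) (hinj : Set.InjOn φ V₂) :
    ∃ g : deckGroup φ, ∀ y ∈ V₁, g.1 y ∈ V₂ := by
  obtain ⟨y₁, hy₁⟩ := h₁.isConnected.nonempty
  have hl := hφ.isCoveringMap.isLocalHomeomorph
  -- On `V₁` the map `s` is `φ` followed by the inverse of `φ` on `V₂`. It lifts `φ`, so a deck
  -- transformation agreeing with it at one point agrees with it on the connected set `V₁`.
  choose! s hs hs' using fun y (hy : y ∈ V₁) ↦ h ⟨y, hy, rfl⟩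
  obtain ⟨g, hg⟩ := exists_deck hφ (hs' y₁ hy₁).symm
  have hcont : ContinuousOn s V₁ := by
    rw [continuousOn_iff']
    intro O hO
    refine ⟨φ ⁻¹' (φ '' (O ∩ V₂)), (hl.isOpenMap _ (hO.inter V₂.isOpen)).preimage hl.continuous, ?_⟩
    ext y
    refine ⟨fun ⟨hy, hyV⟩ ↦ ⟨⟨s y, ⟨hy, hs y hyV⟩, hs' y hyV⟩, hyV⟩, ?_⟩
    rintro ⟨⟨z, ⟨hzO, hzV⟩, hz⟩, hyV⟩
    refine ⟨?_, hyV⟩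
    have : s y = z := hinj (hs y hyV) hzV ((hs' y hyV).trans hz.symm)
    exact Set.mem_preimage.mpr (this ▸ hzO)
  have := hφ.isCoveringMap.eqOn_of_comp_eqOn h₁.isConnected.isPreconnected
    g.1.continuous.continuousOn hcont (fun y hy ↦ (g.2 y).trans (hs' y hy).symm) hy₁ hg
  exact ⟨g, fun y hy ↦ (this hy).symm ▸ hs y hy⟩

end CoveringSpaces

end LocSys
end

noncomputable section
namespace LocSys

/-! ### Sections of sheaves and bases of the topology. -/

section Sections

variable {k : Type u} [Ring k] {X Y Z : TopCat.{u}}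

/-- The module of sections of a sheaf over an open subset. -/
def sec (F : Shv k X) (U : Opens X) : ModuleCat.{u} k := F.1.obj (op U)

/-- The restriction of sections. -/
def res (F : Shv k X) {U V : Opens X} (h : V ≤ U) : sec F U →ₗ[k] sec F V :=
  (F.1.map (homOfLE h).op).hom

/-- The action of a morphism of sheaves on sections. -/
def onSec {F F' : Shv k X} (a : F ⟶ F') (U : Opens X) : sec F U →ₗ[k] sec F' U :=
  (a.hom.app (op U)).hom

lemma res_res (F : Shv k X) {U V W : Opens X} (h : V ≤ U) (h' : W ≤ V) (s : sec F U) :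
    res F h' (res F h s) = res F (h'.trans h) s :=
  (ConcreteCategory.congr_hom (F.1.map_comp (homOfLE h).op (homOfLE h').op) s).symm

lemma res_self (F : Shv k X) {U : Opens X} (h : U ≤ U) (s : sec F U) : res F h s = s :=
  ConcreteCategory.congr_hom (F.1.map_id (op U)) s

lemma onSec_res {F F' : Shv k X} (a : F ⟶ F') {U V : Opens X} (h : V ≤ U) (s : sec F U) :
    onSec a V (res F h s) = res F' h (onSec a U s) :=
  ConcreteCategory.congr_hom (a.hom.naturality (homOfLE h).op) s

lemma onSec_comp {F F' F'' : Shv k X} (a : F ⟶ F') (b : F' ⟶ F'') (U : Opens X) (s : sec F U) :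
    onSec (a ≫ b) U s = onSec b U (onSec a U s) := rfl

lemma onSec_id (F : Shv k X) (U : Opens X) (s : sec F U) : onSec (𝟙 F) U s = s := rfl

lemma bijective_onSec {F F' : Shv k X} (a : F ⟶ F') [IsIso a] (U : Opens X) :
    Function.Bijective (onSec a U) := by
  refine Function.bijective_iff_has_inverse.mpr ⟨onSec (inv a) U, fun s ↦ ?_, fun s ↦ ?_⟩
  · rw [← onSec_comp, IsIso.hom_inv_id, onSec_id]
  · rw [← onSec_comp, IsIso.inv_hom_id, onSec_id]

lemma sec_ext (F : Shv k X) {ι : Type*} {U : Opens X} (W : ι → Opens X) (hW : ∀ i, W i ≤ U)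
    (hc : ∀ x ∈ U, ∃ i, x ∈ W i) {s t : sec F U} (h : ∀ i, res F (hW i) s = res F (hW i) t) :
    s = t :=
  TopCat.Sheaf.eq_of_locally_eq' F W U (fun i ↦ homOfLE (hW i))
    (fun x hx ↦ Opens.mem_iSup.mpr (hc x hx)) s t h

lemma exists_glue (F : Shv k X) {ι : Type*} {U : Opens X} (W : ι → Opens X) (hW : ∀ i, W i ≤ U)
    (hc : ∀ x ∈ U, ∃ i, x ∈ W i) (sf : ∀ i, sec F (W i))
    (h : ∀ i j, res F (inf_le_left : W i ⊓ W j ≤ W i) (sf i) = res F inf_le_right (sf j)) :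
    ∃ s : sec F U, ∀ i, res F (hW i) s = sf i :=
  (TopCat.Sheaf.existsUnique_gluing' F W U (fun i ↦ homOfLE (hW i))
    (fun x hx ↦ Opens.mem_iSup.mpr (hc x hx)) sf h).exists

lemma shv_hom_ext {F F' : Shv k X} {a b : F ⟶ F'} (h : ∀ U s, onSec a U s = onSec b U s) :
    a = b :=
  ObjectProperty.hom_ext _ (NatTrans.ext (funext fun U ↦ by
    ext s
    exact h U.unop s))

section Basis

variable {F F' : Shv k X} {ι : Type*} {B : ι → Opens X}

lemma exists_le_of_isBasis (hB : Opens.IsBasis (Set.range B)) {U : Opens X} {x : X} (hx : x ∈ U) :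
    ∃ i, x ∈ B i ∧ B i ≤ U := by
  obtain ⟨_, ⟨i, rfl⟩, h⟩ := Opens.isBasis_iff_nbhd.mp hB hx
  exact ⟨i, h⟩

/-- Two sections which agree on the members of a basis are equal. -/
lemma sec_ext_basis (F : Shv k X) (hB : Opens.IsBasis (Set.range B)) {U : Opens X} {s t : sec F U}
    (h : ∀ i (hi : B i ≤ U), res F hi s = res F hi t) : s = t :=
  sec_ext F (fun i : {i // B i ≤ U} ↦ B i) (fun i ↦ i.2) (fun x hx ↦ by
    obtain ⟨i, hi, h⟩ := exists_le_of_isBasis hB hx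
    exact ⟨⟨i, h⟩, hi⟩) fun i ↦ h i i.2

lemma hom_ext_basis (hB : Opens.IsBasis (Set.range B)) {a b : F ⟶ F'}
    (h : ∀ i s, onSec a (B i) s = onSec b (B i) s) : a = b :=
  shv_hom_ext fun U s ↦ sec_ext_basis F' hB fun i hi ↦ by
    rw [← onSec_res, ← onSec_res, h]

lemma isIso_of_bijective_basis (hB : Opens.IsBasis (Set.range B)) (a : F ⟶ F')
    (h : ∀ i, Function.Bijective (onSec a (B i))) : IsIso a :=
  TopCat.Sheaf.isIso_iff_isIso_basis hB fun i ↦ (ConcreteCategory.isIso_iff_bijective _).mpr (h i)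

/-- The morphism of sheaves given by a compatible family of maps on a basis. -/
def homOfBasis (hB : Opens.IsBasis (Set.range B)) (a : ∀ i, sec F (B i) →ₗ[k] sec F' (B i))
    (ha : ∀ i j (h : B j ≤ B i) s, a j (res F h s) = res F' h (a i s)) : F ⟶ F' :=
  ⟨TopCat.Sheaf.restrictHomEquivHom F.1 F' hB
    { app i := ModuleCat.ofHom (a i.unop)
      naturality i j f := by
        ext s
        exact ha _ _ _ s }⟩

lemma homOfBasis_onSec (hB : Opens.IsBasis (Set.range B))
    (a : ∀ i, sec F (B i) →ₗ[k] sec F' (B i))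
    (ha : ∀ i j (h : B j ≤ B i) s, a j (res F h s) = res F' h (a i s)) (i : ι) (s : sec F (B i)) :
    onSec (homOfBasis hB a ha) (B i) s = a i s :=
  ConcreteCategory.congr_hom (TopCat.Sheaf.extend_hom_app F.1 F' hB _ i) s

end Basis

end Sections

/-! ### Pullback of sections along a continuous map. -/

section PullbackOfSections

variable (k : Type u) [Ring k] {X Y Z : TopCat.{u}}

variable {k} in
/-- The pullback of sections `F(U) ⟶ (f⁻¹F)(V)` for open subsets with `f(V) ⊆ U`. -/
def pull (f : X ⟶ Y) (F : Shv k Y) {U : Opens Y} {V : Opens X} (h : V ≤ (Opens.map f).obj U) :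
    sec F U →ₗ[k] sec ((inverseImage k f).obj F) V :=
  res _ h ∘ₗ onSec (F' := (TopCat.Sheaf.pushforward (ModuleCat.{u} k) f).obj
    ((inverseImage k f).obj F)) ((inverseImageAdj k f).unit.app F) U

variable {k}

lemma res_pull (f : X ⟶ Y) (F : Shv k Y) {U : Opens Y} {V V' : Opens X}
    (h : V ≤ (Opens.map f).obj U) (i : V' ≤ V) (s : sec F U) :
    res _ i (pull f F h s) = pull f F (i.trans h) s :=
  res_res _ _ _ _

lemma pull_res (f : X ⟶ Y) (F : Shv k Y) {U U' : Opens Y} {V : Opens X}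
    (h : V ≤ (Opens.map f).obj U') (i : U' ≤ U) (s : sec F U) :
    pull f F h (res F i s) = pull f F (h.trans ((Opens.map f).map (homOfLE i)).le) s := by
  refine (congrArg (res _ h) (onSec_res ((inverseImageAdj k f).unit.app F) i s)).trans ?_
  exact res_res ((inverseImage k f).obj F) _ _ _

lemma onSec_pull (f : X ⟶ Y) {F F' : Shv k Y} (a : F ⟶ F') {U : Opens Y} {V : Opens X}
    (h : V ≤ (Opens.map f).obj U) (s : sec F U) :
    onSec ((inverseImage k f).map a) V (pull f F h s) = pull f F' h (onSec a U s) := by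
  refine (onSec_res ((inverseImage k f).map a) h _).trans (congrArg (res _ h) ?_)
  exact (ConcreteCategory.congr_hom (congrArg (fun b ↦ b.hom.app (op U))
    ((inverseImageAdj k f).unit.naturality a)) s).symm

lemma pull_top (f : X ⟶ Y) (F : Shv k Y) (s : sec F ⊤) :
    pull f F (U := ⊤) (V := ⊤) le_top s = ((sectionsPull k f).app F).hom s :=
  res_self _ _ _

/-- The isomorphism `inverseImageComp` is characterized by matching the units of the two
adjunctions, and `pull` is a unit followed by restriction. For deck transformations this says that
sections coming from the base are invariant. -/
lemma inverseImageComp_pull {f : X ⟶ Y} {g : Y ⟶ Z} {h : X ⟶ Z} (w : f ≫ g = h) (F : Shv k Z)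
    {U : Opens Z} {V : Opens Y} {W : Opens X} (hV : V ≤ (Opens.map g).obj U)
    (hW : W ≤ (Opens.map f).obj V) (hW' : W ≤ (Opens.map h).obj U) (s : sec F U) :
    onSec ((inverseImageComp k w).hom.app F) W
      (pull f ((inverseImage k g).obj F) hW (pull g F hV s)) = pull h F hW' s := by
  subst w
  have h1 := Adjunction.unit_leftAdjointUniq_hom_app
    ((inverseImageAdj k g).comp (inverseImageAdj k f)) (inverseImageAdj k (f ≫ g)) F
  have h2 := congrArg (fun b ↦ onSec b U s) h1
  refine Eq.trans ?_ (congrArg (res _ hW') h2)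
  rw [Adjunction.comp_unit_app]
  have h3 : pull f ((inverseImage k g).obj F) hW (pull g F hV s) =
      pull f ((inverseImage k g).obj F) hW' (pull g F le_rfl s) := by
    rw [← res_pull g F le_rfl hV, pull_res]
  rw [h3]
  refine (onSec_res ((inverseImageComp k (rfl : f ≫ g = f ≫ g)).hom.app F) hW' _).trans
    (congrArg (res _ hW') ?_)
  have e : pull g F (le_refl ((Opens.map g).obj U)) s =
    onSec ((inverseImageAdj k g).unit.app F) U s := res_self ((inverseImage k g).obj F) _ _
  rw [e]
  rfl

end PullbackOfSections

/-! ### Inverse images along open maps. -/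

section OpenMaps

variable (k : Type u) [Ring k] {X Y : TopCat.{u}} {f : X ⟶ Y} (hf : IsOpenMap f)

/-- The sheafification of `V ↦ F(f(V))` is left adjoint to the direct image by an open map. -/
def openMapAdj : sheafToPresheaf (Opens.grothendieckTopology Y) (ModuleCat.{u} k) ⋙
    (Functor.whiskeringLeft _ _ _).obj hf.functor.op ⋙
      presheafToSheaf (Opens.grothendieckTopology X) (ModuleCat.{u} k) ⊣
    TopCat.Sheaf.pushforward (ModuleCat.{u} k) f :=
  ((hf.adjunction.op.whiskerLeft (ModuleCat.{u} k)).comp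
    (sheafificationAdjunction (Opens.grothendieckTopology X) (ModuleCat.{u} k))).restrictFullyFaithful
    (fullyFaithfulSheafToPresheaf (Opens.grothendieckTopology Y) (ModuleCat.{u} k))
      (Functor.FullyFaithful.id _) (Iso.refl _) (Iso.refl _)

variable {k}

lemma openMapAdj_unit_app (F : Shv k Y) (U : Opens Y) :
    ((openMapAdj k hf).unit.app F).hom.app (op U) =
      F.1.map (hf.adjunction.counit.app U).op ≫
        (toSheafify (Opens.grothendieckTopology X) (hf.functor.op ⋙ F.1)).app
          (op ((Opens.map f).obj U)) := by
  have := Adjunction.map_restrictFullyFaithful_unit_app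
    (iC := sheafToPresheaf (Opens.grothendieckTopology Y) (ModuleCat.{u} k)) (iD := 𝟭 _)
    (hiC := fullyFaithfulSheafToPresheaf (Opens.grothendieckTopology Y) (ModuleCat.{u} k))
    (hiD := Functor.FullyFaithful.id _)
    (L := sheafToPresheaf (Opens.grothendieckTopology Y) (ModuleCat.{u} k) ⋙
      (Functor.whiskeringLeft _ _ _).obj hf.functor.op ⋙
      presheafToSheaf (Opens.grothendieckTopology X) (ModuleCat.{u} k))
    (R := TopCat.Sheaf.pushforward (ModuleCat.{u} k) f)
    (adj := (hf.adjunction.op.whiskerLeft (ModuleCat.{u} k)).comp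
      (sheafificationAdjunction (Opens.grothendieckTopology X) (ModuleCat.{u} k)))
    (comm1 := Iso.refl _) (comm2 := Iso.refl _) F
  refine (congrArg (fun b ↦ NatTrans.app b (op U)) this).trans ?_
  rw [Adjunction.comp_unit_app]
  rfl

/-- The sheafification of `V ↦ F(f(V))`. -/
def openMapSheaf (F : Shv k Y) : Shv k X :=
  (presheafToSheaf (Opens.grothendieckTopology X) (ModuleCat.{u} k)).obj (hf.functor.op ⋙ F.1)

/-- The map from `F(f(V))` to the sections over `V` of the sheafification of `V ↦ F(f(V))`. -/
def openMapEta (F : Shv k Y) (V : Opens X) :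
    sec F (hf.functor.obj V) →ₗ[k] sec (openMapSheaf hf F) V :=
  ((toSheafify (Opens.grothendieckTopology X) (hf.functor.op ⋙ F.1)).app (op V)).hom

lemma openMapEta_res (F : Shv k Y) {V W : Opens X} (h : W ≤ V) (s : sec F (hf.functor.obj V)) :
    openMapEta hf F W (res F (hf.functor.map (homOfLE h)).le s) =
      res (openMapSheaf hf F) h (openMapEta hf F V s) :=
  ConcreteCategory.congr_hom ((toSheafify (Opens.grothendieckTopology X)
    (hf.functor.op ⋙ F.1)).naturality (homOfLE h).op) s

/-- The presheaf `V ↦ F(f(V))` is separated: the images of a cover of `V` cover `f(V)`. -/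
lemma openMapEta_injective (F : Shv k Y) (V : Opens X) :
    Function.Injective (openMapEta hf F V) := by
  intro s t h
  have hs := Presheaf.equalizerSieve_mem (Opens.grothendieckTopology X)
    (toSheafify (Opens.grothendieckTopology X) (hf.functor.op ⋙ F.1)) (X := op V) s t h
  choose W i hi hx using fun x : V ↦ hs x.1 x.2
  refine sec_ext F (fun x ↦ hf.functor.obj (W x)) (fun x ↦ (hf.functor.map (i x)).le) ?_ fun x ↦ hi x
  rintro _ ⟨x, hxV, rfl⟩
  exact ⟨⟨x, hxV⟩, x, hx ⟨x, hxV⟩, rfl⟩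

/-- Local preimages of `s` are glued in `F` over `f(V)`. -/
lemma openMapEta_bijective (F : Shv k Y) {V : Opens X} (hV : Set.InjOn f V) :
    Function.Bijective (openMapEta hf F V) := by
  refine ⟨openMapEta_injective hf F V, fun s ↦ ?_⟩
  have hs := Presheaf.imageSieve_mem (Opens.grothendieckTopology X)
    (toSheafify (Opens.grothendieckTopology X) (hf.functor.op ⋙ F.1)) (U := op V) s
  choose W i hi hx using fun x : V ↦ hs x.1 x.2
  choose c hc using hi
  let c' (x : V) : sec F (hf.functor.obj (W x)) := c x
  have hc' (x : V) : openMapEta hf F (W x) (c' x) = res (openMapSheaf hf F) (i x).le s := hc x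
  obtain ⟨t, ht⟩ := exists_glue F (U := hf.functor.obj V) (fun x ↦ hf.functor.obj (W x))
    (fun x ↦ (hf.functor.map (i x)).le) (by
      rintro _ ⟨x, hxV, rfl⟩
      exact ⟨⟨x, hxV⟩, x, hx ⟨x, hxV⟩, rfl⟩) c' (fun x y ↦ by
      -- Injectivity of `f` on `V` enters here: the image of the intersection is the whole
      -- intersection of the images, so agreement upstairs gives agreement on overlaps downstairs.
      have e : hf.functor.obj (W x) ⊓ hf.functor.obj (W y) ≤ hf.functor.obj (W x ⊓ W y) := by
        rintro _ ⟨⟨a, ha, rfl⟩, b, hb, hab⟩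
        obtain rfl := hV ((i y).le hb) ((i x).le ha) hab
        exact ⟨b, ⟨ha, hb⟩, rfl⟩
      have key : res F (hf.functor.map (homOfLE (inf_le_left : W x ⊓ W y ≤ W x))).le (c' x) =
          res F (hf.functor.map (homOfLE (inf_le_right : W x ⊓ W y ≤ W y))).le (c' y) := by
        apply openMapEta_injective hf F
        rw [openMapEta_res _ _ inf_le_left, openMapEta_res _ _ inf_le_right, hc', hc', res_res,
          res_res]
      have := congrArg (res F e) key
      rwa [res_res, res_res] at this)
  refine ⟨t, sec_ext (openMapSheaf hf F) W (fun x ↦ (i x).le) (fun x hxV ↦ ⟨⟨x, hxV⟩, hx _⟩) fun x ↦ ?_⟩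
  rw [← openMapEta_res, ht, hc']

/-- If `f` is open and injective on `V`, then the sections of `f⁻¹F` over `V` are the sections
of `F` over `f(V)`. -/
lemma pull_bijective (hf : IsOpenMap f) (F : Shv k Y) {V : Opens X} (hV : Set.InjOn f V) {U : Opens Y}
    (hU : f '' V = U) (h : V ≤ (Opens.map f).obj U) : Function.Bijective (pull f F h) := by
  obtain rfl : U = hf.functor.obj V := Opens.ext hU.symm
  let e : (inverseImage k f).obj F ≅ openMapSheaf hf F :=
    ((inverseImageAdj k f).leftAdjointUniq (openMapAdj k hf)).app F
  have h1 := Adjunction.unit_leftAdjointUniq_hom_app (inverseImageAdj k f) (openMapAdj k hf) F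
  -- By uniqueness of left adjoints the inverse image is the sheafification of `V ↦ F(f(V))`;
  -- comparing units turns `pull` into the sheafification map.
  have key (s) : onSec e.hom V (pull f F h s) = openMapEta hf F V s := by
    refine (onSec_res e.hom h _).trans ?_
    refine (congrArg (fun b : F ⟶ (TopCat.Sheaf.pushforward (ModuleCat.{u} k) f).obj
      (openMapSheaf hf F) ↦ res (openMapSheaf hf F) h (onSec b _ s)) h1).trans ?_
    refine (congrArg (fun b ↦ res (openMapSheaf hf F) h (b.hom s)) (openMapAdj_unit_app hf F _)).trans ?_
    refine (openMapEta_res hf F h _).symm.trans (congrArg _ ?_)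
    exact (res_res F _ _ s).trans (res_self F _ s)
  refine (Function.Bijective.of_comp_iff' (bijective_onSec e.hom V) _).mp ?_
  rw [show onSec e.hom V ∘ pull f F h = openMapEta hf F V from funext key]
  exact openMapEta_bijective hf F hV

end OpenMaps

end LocSys
end

noncomputable section
namespace LocSys

/-! ### Extension by zero as a presheaf, and injective sheaves. -/

section ExtensionByZero

open DirectSum

variable (k : Type u) [Ring k] {X Y : TopCat.{u}} (f : X ⟶ Y)

lemma injective_onSec_of_mono {k : Type u} [Ring k] {X : TopCat.{u}} {F F' : Shv k X} (a : F ⟶ F')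
    [Mono a] (U : Opens X) : Function.Injective (onSec a U) := by
  have : (sheafToPresheaf (Opens.grothendieckTopology X) (ModuleCat.{u} k)).PreservesMonomorphisms :=
    inferInstance
  have h : Mono ((sheafToPresheaf (Opens.grothendieckTopology X) (ModuleCat.{u} k)).map a) :=
    @Functor.map_mono _ _ _ _ (sheafToPresheaf (Opens.grothendieckTopology X) (ModuleCat.{u} k))
      this _ _ a ‹_›
  rw [NatTrans.mono_iff_mono_app] at h
  exact (ModuleCat.mono_iff_injective _).mp (h (op U))

/-- The open subsets of `X` which are mapped bijectively to `U` by `f`. -/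
def Lift (U : Opens Y) : Type u := {V : Opens X // Set.InjOn f V ∧ f '' V = U}

variable {f}

/-- The part of a lift which lies over a smaller open subset. -/
def Lift.restrict {U U' : Opens Y} (h : U' ≤ U) (V : Lift f U) : Lift f U' :=
  ⟨V.1 ⊓ (Opens.map f).obj U', V.2.1.mono fun _ hx ↦ hx.1, by
    ext y
    constructor
    · rintro ⟨x, hx, rfl⟩
      exact hx.2
    · intro hy
      have hy' := h hy
      rw [← SetLike.mem_coe, ← V.2.2] at hy'
      obtain ⟨x, hx, rfl⟩ := hy'
      exact ⟨x, ⟨hx, hy⟩, rfl⟩⟩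

lemma Lift.restrict_le {U U' : Opens Y} (h : U' ≤ U) (V : Lift f U) : (V.restrict h).1 ≤ V.1 :=
  inf_le_left

lemma Lift.le_map {U : Opens Y} (V : Lift f U) : V.1 ≤ (Opens.map f).obj U := fun x hx ↦ by
  change f x ∈ (U : Set Y)
  rw [← V.2.2]
  exact ⟨x, hx, rfl⟩

/-- A lift contained in another one is its restriction. -/
lemma Lift.eq_restrict {U U' : Opens Y} (h : U' ≤ U) (V : Lift f U) (V' : Lift f U')
    (hV : V'.1 ≤ V.1) : V' = V.restrict h := by
  refine Subtype.ext (le_antisymm (fun x hx ↦ ⟨hV hx, V'.le_map hx⟩) fun x hx ↦ ?_)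
  have hx' : f x ∈ (U' : Set Y) := hx.2
  rw [← V'.2.2] at hx'
  obtain ⟨x', hx', e⟩ := hx'
  rwa [← V.2.1 (hV hx') hx.1 e]

variable {k}

open Classical in
-- Equal lifts index summands of different types; this moves an element from one summand to the
-- other without a cast.
lemma lof_res_congr (P : Shv k X) {U : Opens Y} {V V' : Lift f U} (e : V = V') {O : Opens X}
    (h : V.1 ≤ O) (h' : V'.1 ≤ O) (s : sec P O) :
    lof k (Lift f U) (fun V ↦ sec P V.1) V (res P h s) = lof k _ _ V' (res P h' s) := by
  subst e
  rfl

variable (f) in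
/-- The direct sum of the `P(V)`, where `V` runs through the lifts of `U`. -/
abbrev ExtSec (P : Shv k X) (U : Opens Y) : Type u := ⨁ V : Lift f U, sec P V.1

open Classical in
lemma toModule_lof_sec (P : Shv k X) {U : Opens Y} {N : Type*} [AddCommGroup N] [Module k N]
    (a : ∀ V : Lift f U, sec P V.1 →ₗ[k] N) (V : Lift f U) (s : sec P V.1) :
    toModule k _ N a (lof k (Lift f U) (fun V ↦ sec P V.1) V s) = a V s :=
  toModule_lof (M := fun V : Lift f U ↦ sec P V.1) (φ := a) k V s

open Classical in
lemma extSec_hom_ext (P : Shv k X) {U : Opens Y} {N : Type*} [AddCommGroup N] [Module k N]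
    {a b : ExtSec f P U →ₗ[k] N} (h : ∀ V s, a (lof k (Lift f U) (fun V ↦ sec P V.1) V s) =
      b (lof k (Lift f U) (fun V ↦ sec P V.1) V s)) : a = b := by
  refine DirectSum.linearMap_ext k fun V ↦ LinearMap.ext fun s ↦ ?_
  exact h V s

open Classical in
/-- The restriction of an element of the direct sum. -/
def extRes (P : Shv k X) {U U' : Opens Y} (h : U' ≤ U) : ExtSec f P U →ₗ[k] ExtSec f P U' :=
  toModule k _ _ fun V ↦ lof k (Lift f U') (fun V ↦ sec P V.1) (V.restrict h) ∘ₗ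
    res P (V.restrict_le h)

open Classical in
lemma extRes_lof (P : Shv k X) {U U' : Opens Y} (h : U' ≤ U) (V : Lift f U) (V' : Lift f U')
    (h' : V'.1 ≤ V.1) (s : sec P V.1) :
    extRes P h (lof k (Lift f U) (fun V ↦ sec P V.1) V s) =
      lof k (Lift f U') (fun V ↦ sec P V.1) V' (res P h' s) :=
  (toModule_lof_sec P _ V s).trans (lof_res_congr P (V.eq_restrict h V' h').symm _ _ s)

lemma extRes_self (P : Shv k X) {U : Opens Y} (h : U ≤ U) :
    extRes P h = (LinearMap.id : ExtSec f P U →ₗ[k] _) :=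
  extSec_hom_ext P fun V s ↦ (extRes_lof P h V V le_rfl s).trans
    (by rw [res_self, LinearMap.id_apply])

lemma extRes_comp (P : Shv k X) {U U' U'' : Opens Y} (h : U' ≤ U) (h' : U'' ≤ U') :
    extRes P (h'.trans h) = (extRes P h' ∘ₗ extRes P h : ExtSec f P U →ₗ[k] _) := by
  refine extSec_hom_ext P fun V s ↦ ?_
  have h1 := (V.restrict h).restrict_le h'
  rw [LinearMap.comp_apply, extRes_lof P h V (V.restrict h) (V.restrict_le h),
    extRes_lof P h' (V.restrict h) _ h1,
    extRes_lof P (h'.trans h) V ((V.restrict h).restrict h') (h1.trans (V.restrict_le h)), res_res]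

variable (f)

/-- The presheaf `U ↦ ⨁ P(V)`, the sum over the lifts `V` of `U`. -/
def extPresheaf (P : Shv k X) : (Opens Y)ᵒᵖ ⥤ ModuleCat.{u} k where
  obj U := ModuleCat.of k (ExtSec f P U.unop)
  map i := ModuleCat.ofHom (extRes P i.unop.le)
  map_id _ := ModuleCat.hom_ext (extRes_self P _)
  map_comp i j := ModuleCat.hom_ext (extRes_comp P i.unop.le j.unop.le)

open Classical in
/-- The inclusion of `P(V)` in the sections over `f(V)` of `extPresheaf f P`. -/
def extι (P : Shv k X) {U : Opens Y} (V : Lift f U) :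
    sec P V.1 →ₗ[k] (extPresheaf f P).obj (op U) :=
  lof k (Lift f U) (fun V ↦ sec P V.1) V

lemma extPresheaf_map_ι (P : Shv k X) {U U' : Opens Y} (i : U' ⟶ U) (V : Lift f U) (V' : Lift f U')
    (h : V'.1 ≤ V.1) (s : sec P V.1) :
    ((extPresheaf f P).map i.op).hom (extι f P V s) = extι f P V' (res P h s) := by
  classical
  exact extRes_lof P i.le V V' h s

lemma ext_linearMap_ext (P : Shv k X) {U : Opens Y} {N : Type*} [AddCommGroup N] [Module k N]
    {a b : (extPresheaf f P).obj (op U) →ₗ[k] N}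
    (h : ∀ V s, a (extι f P V s) = b (extι f P V s)) : a = b := by
  exact extSec_hom_ext P fun V s ↦ h V s

open Classical in
/-- The morphism of presheaves given by compatible maps `P(V) ⟶ Q(f(V))`. -/
def extDesc (P : Shv k X) (Q : (Opens Y)ᵒᵖ ⥤ ModuleCat.{u} k)
    (a : ∀ (U : Opens Y) (V : Lift f U), sec P V.1 →ₗ[k] Q.obj (op U))
    (ha : ∀ (U U' : Opens Y) (i : U' ⟶ U) (V : Lift f U) (V' : Lift f U') (h : V'.1 ≤ V.1) s,
      a U' V' (res P h s) = (Q.map i.op).hom (a U V s)) : extPresheaf f P ⟶ Q where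
  app U := ModuleCat.ofHom (toModule k _ _ fun V ↦ a U.unop V)
  naturality U U' i := by
    refine ModuleCat.hom_ext (ext_linearMap_ext f P fun V s ↦ ?_)
    refine (congrArg (toModule k _ _ fun V ↦ a U'.unop V) (extPresheaf_map_ι f P i.unop V
      (V.restrict i.unop.le) (V.restrict_le _) s)).trans ?_
    refine (toModule_lof_sec P _ (V.restrict i.unop.le) _).trans ?_
    refine (ha _ _ i.unop V _ _ s).trans ?_
    exact congrArg (Q.map i).hom (toModule_lof_sec P _ V s).symm

lemma extDesc_ι (P : Shv k X) (Q : (Opens Y)ᵒᵖ ⥤ ModuleCat.{u} k)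
    (a : ∀ (U : Opens Y) (V : Lift f U), sec P V.1 →ₗ[k] Q.obj (op U))
    (ha : ∀ (U U' : Opens Y) (i : U' ⟶ U) (V : Lift f U) (V' : Lift f U') (h : V'.1 ≤ V.1) s,
      a U' V' (res P h s) = (Q.map i.op).hom (a U V s)) {U : Opens Y} (V : Lift f U)
    (s : sec P V.1) : ((extDesc f P Q a ha).app (op U)).hom (extι f P V s) = a U V s := by
  classical
  exact toModule_lof_sec P _ V s

/-- The functoriality of `extPresheaf`. -/
def extMap {P P' : Shv k X} (a : P ⟶ P') : extPresheaf f P ⟶ extPresheaf f P' :=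
  extDesc f P _ (fun _ V ↦ extι f P' V ∘ₗ onSec a V.1) fun U U' i V V' h s ↦ by
    dsimp
    rw [onSec_res, extPresheaf_map_ι f P' i V V' h]

lemma extMap_ι {P P' : Shv k X} (a : P ⟶ P') {U : Opens Y} (V : Lift f U) (s : sec P V.1) :
    ((extMap f a).app (op U)).hom (extι f P V s) = extι f P' V (onSec a V.1 s) :=
  extDesc_ι f P _ _ _ V s

/-- Over each open set the map is a direct sum of injective maps of sections. -/
instance {P P' : Shv k X} (a : P ⟶ P') [Mono a] : Mono (extMap f a) := by
  classical
  refine (NatTrans.mono_iff_mono_app _).mpr fun U ↦ (ModuleCat.mono_iff_injective _).mpr ?_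
  have e : ((extMap f a).app U).hom = DFinsupp.mapRange.linearMap fun V : Lift f U.unop ↦ onSec a V.1 := by
    refine ext_linearMap_ext f P fun V s ↦ (extMap_ι f a V s).trans ?_
    exact (DFinsupp.mapRange_single (f := fun V : Lift f U.unop ↦ onSec a V.1)
      (hf := fun V ↦ map_zero (onSec a V.1))).symm
  have := (DFinsupp.mapRange_injective (fun V : Lift f U.unop ↦ onSec a V.1)
    fun V ↦ map_zero (onSec a V.1)).mpr fun V ↦ injective_onSec_of_mono a V.1
  intro s t h
  refine this ?_
  have h' : ((extMap f a).app U).hom s = ((extMap f a).app U).hom t := h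
  rw [e] at h'
  exact h'

/-- The inclusion of sheaves into presheaves is right adjoint to sheafification, which preserves
monomorphisms. This makes it unnecessary to sheafify `extPresheaf`. -/
lemma injective_presheaf {k : Type u} [Ring k] {X : TopCat.{u}} (I : Shv k X) [h : Injective I] :
    Injective I.1 := by
  have : (presheafToSheaf (Opens.grothendieckTopology X)
    (ModuleCat.{u} k)).PreservesMonomorphisms := inferInstance
  exact @Injective.injective_of_adjoint _ _ _ _ _ _ this
    (sheafificationAdjunction (Opens.grothendieckTopology X) (ModuleCat.{u} k)) I h

/-- The inverse image by a local homeomorphism preserves injective sheaves. -/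
theorem injective_inverseImage (hf : IsLocalHomeomorph f) (I : Shv k Y) [Injective I] :
    Injective ((inverseImage k f).obj I) where
  factors {A B} a i _ := by
    have hI : Injective I.1 := injective_presheaf I
    let p {U : Opens Y} (V : Lift f U) : sec I U ≃ₗ[k] sec ((inverseImage k f).obj I) V.1 :=
      LinearEquiv.ofBijective (pull f I V.le_map) (pull_bijective hf.isOpenMap I V.2.1 V.2.2 _)
    have hp {U U' : Opens Y} (i : U' ⟶ U) (V : Lift f U) (V' : Lift f U') (h : V'.1 ≤ V.1)
        (s : sec I U) : p V' (res I i.le s) = res _ h (p V s) :=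
      (pull_res f I V'.le_map i.le s).trans (res_pull f I V.le_map h s).symm
    -- The transpose of `a`: on the summand of a lift `V` of `U`, apply `a` and identify the
    -- sections of `f⁻¹I` over `V` with `I(U)`.
    let d : extPresheaf f A ⟶ I.1 := extDesc f A I.1
      (fun U V ↦ (p V).symm.toLinearMap ∘ₗ onSec a V.1) (fun U U' i V V' h s ↦ by
        apply (p V').injective
        refine ((p V').apply_symm_apply _).trans ?_
        refine Eq.trans ?_ (hp i V V' h _).symm
        refine (onSec_res a h s).trans (congrArg _ ?_)
        exact ((p V).apply_symm_apply _).symm)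
    obtain ⟨b, hb⟩ := hI.factors d (extMap f i)
    -- Open sets on which `f` is injective form a basis, and each is a lift of its own image.
    -- Restricting `b` to that summand yields the desired extension on the basis.
    let B' : {V : Opens X // Set.InjOn f V} → Opens X := Subtype.val
    have hB : Opens.IsBasis (Set.range B') := by
      rw [Opens.isBasis_iff_nbhd]
      intro U x hx
      obtain ⟨t, hxt, ht⟩ := hf x
      refine ⟨⟨t.source, t.open_source⟩ ⊓ U, ⟨⟨_, ht ▸ t.injOn.mono fun _ h ↦ h.1⟩, rfl⟩, ⟨hxt, hx⟩,
        inf_le_right⟩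
    let l (V : {V : Opens X // Set.InjOn f V}) : Lift f (hf.isOpenMap.functor.obj V.1) :=
      ⟨V.1, V.2, rfl⟩
    refine ⟨homOfBasis hB (fun V ↦ (p (l V)).toLinearMap ∘ₗ (b.app _).hom ∘ₗ extι f B (l V))
      fun V V' h s ↦ ?_, hom_ext_basis hB fun V s ↦ ?_⟩
    · let i := hf.isOpenMap.functor.map (homOfLE h)
      refine Eq.trans ?_ (hp i (l V) (l V') h _)
      refine congrArg (p (l V')) ?_
      refine (congrArg _ (extPresheaf_map_ι f B i (l V) (l V') h s).symm).trans ?_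
      exact ConcreteCategory.congr_hom (b.naturality i.op) (extι f B (l V) s)
    · refine (homOfBasis_onSec hB _ _ V _).trans ?_
      have h1 := ConcreteCategory.congr_hom (congrArg (fun c ↦ c.app
        (op (hf.isOpenMap.functor.obj V.1))) hb) (extι f A (l V) s)
      have h2 : (b.app (op (hf.isOpenMap.functor.obj V.1))).hom
          (((extMap f i).app (op (hf.isOpenMap.functor.obj V.1))).hom (extι f A (l V) s)) =
          (p (l V)).symm (onSec a V.1 s) := h1.trans (extDesc_ι f A I.1 _ _ (l V) s)
      rw [extMap_ι] at h2
      exact (congrArg (p (l V)) h2).trans ((p (l V)).apply_symm_apply _)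

end ExtensionByZero

end LocSys
end

noncomputable section
namespace LocSys

/-! ### Constant sheaves on connected open sets. -/

section ConstantSheaves

variable {k : Type u} [Ring k] {X Y : TopCat.{u}}

/-- The section of a constant sheaf given by an element. -/
def cst (X : TopCat.{u}) (M : ModuleCat.{u} k) (V : Opens X) : M →ₗ[k] sec ((constSheaf k X).obj M) V :=
  ((constEta M X).app (op V)).hom

lemma res_cst (M : ModuleCat.{u} k) {V W : Opens X} (h : V ≤ W) (m : M) :
    res _ h (cst X M W m) = cst X M V m :=
  constEta_map M (homOfLE h) m

/-- A section is locally given by elements of `M`. These elements form a locally constant function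
on `U`, hence a constant one. -/
lemma cst_bijective (M : ModuleCat.{u} k) {U : Opens X} (hU : IsConnected (U : Set X)) :
    Function.Bijective (cst X M U) := by
  obtain ⟨x₀, hx₀⟩ := hU.nonempty
  refine ⟨fun s t h ↦ constEta_inj M hx₀ s t h, fun s ↦ ?_⟩
  have hs := Presheaf.imageSieve_mem (Opens.grothendieckTopology X) (constEta M X) (U := op U) s
  choose V f hf hxV using fun x : U ↦ hs x.1 x.2
  choose c hc using hf
  let c' : U → M := c
  replace hc (x : U) : cst X M (V x) (c' x) = res ((constSheaf k X).obj M) (f x).le s := hc x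
  have hloc : IsLocallyConstant c' := by
    rw [IsLocallyConstant.iff_exists_open]
    refine fun x ↦ ⟨Subtype.val ⁻¹' V x, (V x).isOpen.preimage continuous_subtype_val, hxV x,
      fun y hy ↦ ?_⟩
    refine Eq.symm <| constEta_inj M (V := V x ⊓ V y) (x := y) ⟨hy, hxV y⟩ _ _ ?_
    change cst X M _ _ = cst X M _ _
    rw [← res_cst M inf_le_left, ← res_cst M inf_le_right, hc, hc, res_res, res_res]
  have : PreconnectedSpace U := Subtype.preconnectedSpace hU.isPreconnected
  refine ⟨c' ⟨x₀, hx₀⟩, sec_ext _ V (fun x ↦ (f x).le) (fun x hx ↦ ⟨⟨x, hx⟩, hxV _⟩) fun x ↦ ?_⟩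
  rw [res_cst, ← hc, hloc.apply_eq_of_preconnectedSpace _ x]

lemma bijective_res_of_essImage {F : Shv k X} (hF : (constSheaf k X).essImage F) {U V : Opens X}
    (hU : IsConnected (U : Set X)) (hV : IsConnected (V : Set X)) (h : V ≤ U) :
    Function.Bijective (res F h) := by
  obtain ⟨M, ⟨e⟩⟩ := hF
  have h1 := (bijective_onSec e.hom U).comp (cst_bijective M hU)
  have h2 := (bijective_onSec e.hom V).comp (cst_bijective M hV)
  refine (Function.Bijective.of_comp_iff _ h1).mp ?_
  convert h2 using 1
  ext m
  simp only [Function.comp_apply]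
  rw [← onSec_res, res_cst]

/-- The canonical morphism from the constant sheaf of global sections. -/
def constCounit (F : Shv k X) : (constSheaf k X).obj (sec F ⊤) ⟶ F :=
  (constSheafAdj k X).counit.app F

/-- Over `⊤` this is a triangle identity of the adjunction; the general case follows by restriction.
-/
lemma counit_cst (F : Shv k X) (V : Opens X) (s : sec F ⊤) :
    onSec (constCounit F) V (cst X (sec F ⊤) V s) = res F le_top s := by
  have hu (M : ModuleCat.{u} k) : (constSheafAdj k X).unit.app M = (constEta M X).app (op ⊤) := by
    refine (Adjunction.comp_unit_app _ _ _).trans ?_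
    refine Category.id_comp _
  have h := ConcreteCategory.congr_hom ((constSheafAdj k X).right_triangle_components F) s
  have h' : onSec (constCounit F) ⊤ (cst X (sec F ⊤) ⊤ s) = s := by
    refine Eq.trans ?_ h
    rw [hu]
    rfl
  rw [← res_cst _ le_top, onSec_res, h']

/-- A sheaf whose global sections restrict bijectively to the members of a basis consisting of
connected open subsets is constant. -/
lemma isIso_counit_of_basis {F : Shv k X} {ι : Type*} {B : ι → Opens X}
    (hB : Opens.IsBasis (Set.range B)) (hc : ∀ i, IsConnected (B i : Set X))
    (h : ∀ i, Function.Bijective (res F (le_top : B i ≤ ⊤))) :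
    IsIso (constCounit F) := by
  refine isIso_of_bijective_basis hB _ fun i ↦ ?_
  refine (Function.Bijective.of_comp_iff _ (cst_bijective (sec F ⊤) (hc i))).mp ?_
  convert h i using 1
  exact funext fun s ↦ counit_cst F _ s

lemma essImage_of_basis {F : Shv k X} {ι : Type*} {B : ι → Opens X}
    (hB : Opens.IsBasis (Set.range B)) (hc : ∀ i, IsConnected (B i : Set X))
    (h : ∀ i, Function.Bijective (res F (le_top : B i ≤ ⊤))) :
    (constSheaf k X).essImage F :=
  have := isIso_counit_of_basis hB hc h
  ⟨_, ⟨asIso (constCounit F)⟩⟩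

lemma isBasis_isConnected (X : TopCat.{u}) [LocallyConnectedSpace X] : Opens.IsBasis
    (Set.range (Subtype.val : {V : Opens X // IsConnected (V : Set X)} → Opens X)) := by
  rw [Opens.isBasis_iff_nbhd]
  intro U x hx
  exact ⟨⟨connectedComponentIn U x, U.isOpen.connectedComponentIn⟩,
    ⟨⟨_, isConnected_connectedComponentIn_iff.mpr hx⟩, rfl⟩, mem_connectedComponentIn hx,
    connectedComponentIn_subset _ _⟩

/-- The restriction to an open subset on which a sheaf has constant sections is constant. -/
lemma isConstOn_of_bijective [LocallyConnectedSpace X] (F : Shv k X) (W : Opens X)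
    (h : ∀ V : Opens X, IsConnected (V : Set X) → (hV : V ≤ W) → Function.Bijective (res F hV)) :
    isConstOn k W F := by
  have ho : IsOpenMap W.inclusion' := W.isOpenEmbedding.isOpenMap
  have : LocallyConnectedSpace ((Opens.toTopCat X).obj W) :=
    W.isOpen.locallyConnectedSpace
  refine essImage_of_basis (isBasis_isConnected _) (fun V ↦ V.2) fun ⟨V, hV⟩ ↦ ?_
  have hT : W.inclusion' '' (⊤ : Opens ((Opens.toTopCat X).obj W)) = W := by
    refine Set.image_univ.trans ?_
    exact Subtype.range_coe
  have h1 := pull_bijective ho F (V := ⊤) (Subtype.val_injective.injOn) (U := W) hT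
    (fun x _ ↦ x.2)
  have hVW : ho.functor.obj V ≤ W := by
    rintro _ ⟨x, -, rfl⟩
    exact x.2
  have hle : V ≤ (Opens.map W.inclusion').obj (ho.functor.obj V) := fun x hx ↦ ⟨x, hx, rfl⟩
  have h2 := pull_bijective ho F (V := V) (Subtype.val_injective.injOn)
    (U := ho.functor.obj V) rfl hle
  have h3 := h (ho.functor.obj V) (hV.image _ W.inclusion'.hom.continuous.continuousOn) hVW
  refine (Function.Bijective.of_comp_iff _ h1).mp ?_
  convert h2.comp h3 using 1
  exact funext fun s ↦ (res_pull W.inclusion' F _ _ s).trans (pull_res W.inclusion' F hle hVW s).symm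

/-- By `pull_bijective` for the open embedding of `W`, the restriction map of `F` is the restriction
map of the constant sheaf `F|_W` between connected open sets. -/
lemma bijective_res_of_isConstOn {F : Shv k X} {W : Opens X} (hF : isConstOn k W F)
    {U V : Opens X} (hU : IsConnected (U : Set X)) (hV : IsConnected (V : Set X)) (h : V ≤ U)
    (hW : U ≤ W) : Function.Bijective (res F h) := by
  have ho : IsOpenMap W.inclusion' := W.isOpenEmbedding.isOpenMap
  let f := W.inclusion'
  have im {O : Opens X} (hO : O ≤ W) : f '' ((Opens.map f).obj O) = O := by
    ext x
    exact ⟨fun ⟨y, hy, e⟩ ↦ e ▸ hy, fun hx ↦ ⟨⟨x, hO hx⟩, hx, rfl⟩⟩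
  have con {O : Opens X} (hO : O ≤ W) (hc : IsConnected (O : Set X)) :
      IsConnected ((Opens.map f).obj O : Set ((Opens.toTopCat X).obj W)) := by
    refine ⟨?_, ?_⟩
    · obtain ⟨x, hx⟩ := hc.nonempty
      exact ⟨⟨x, hO hx⟩, hx⟩
    · refine (W.isOpenEmbedding.isInducing.isPreconnected_image).mp ?_
      exact (im hO).symm ▸ hc.isPreconnected
  have h1 := pull_bijective ho F (V := (Opens.map f).obj U) (Subtype.val_injective.injOn)
    (im hW) le_rfl
  have h2 := pull_bijective ho F (V := (Opens.map f).obj V) (Subtype.val_injective.injOn)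
    (im (h.trans hW)) le_rfl
  have h3 := bijective_res_of_essImage hF (con hW hU) (con (h.trans hW) hV)
    ((Opens.map f).map (homOfLE h)).le
  refine (Function.Bijective.of_comp_iff' h2 _).mp ?_
  convert h3.comp h1 using 1
  ext s
  simp only [Function.comp_apply]
  rw [res_pull, pull_res]

end ConstantSheaves

end LocSys
end

noncomputable section
namespace LocSys

/-! ### Locally constant sheaves on simply connected spaces. -/

section LocallyConstantSheaves

open Topology

variable {k : Type u} [Ring k] {Y : TopCat.{u}}

/-- The germ of a section at a point. -/
def germAt (S : Shv k Y) {U : Opens Y} {y : Y} (hy : y ∈ U) (s : sec S U) :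
    ToType (TopCat.Presheaf.stalk S.1 y) :=
  TopCat.Presheaf.germ S.1 U y hy s

lemma germAt_res (S : Shv k Y) {U V : Opens Y} {y : Y} (hy : y ∈ V) (h : V ≤ U) (s : sec S U) :
    germAt S hy (res S h s) = germAt S (h hy) s :=
  TopCat.Presheaf.germ_res_apply S.1 (homOfLE h) y hy s

lemma exists_res_eq_of_germAt_eq (S : Shv k Y) {U V : Opens Y} {y : Y} (hU : y ∈ U) (hV : y ∈ V)
    {s : sec S U} {t : sec S V} (h : germAt S hU s = germAt S hV t) :
    ∃ (W : Opens Y) (_ : y ∈ W) (h₁ : W ≤ U) (h₂ : W ≤ V), res S h₁ s = res S h₂ t := by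
  obtain ⟨W, hy, i, j, e⟩ := TopCat.Presheaf.germ_eq S.1 y hU hV s t h
  exact ⟨W, hy, i.le, j.le, e⟩

lemma exists_germAt_eq (S : Shv k Y) {y : Y} (g : ToType (TopCat.Presheaf.stalk S.1 y)) :
    ∃ (W : Opens Y) (hy : y ∈ W) (s : sec S W), germAt S hy s = g := by
  obtain ⟨W, hy, s, e⟩ := TopCat.Presheaf.exists_germ_eq S.1 g
  exact ⟨W, hy, s, e⟩

lemma sec_ext_germAt (S : Shv k Y) {U : Opens Y} {s t : sec S U}
    (h : ∀ y (hy : y ∈ U), germAt S hy s = germAt S hy t) : s = t := by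
  choose W hW h1 h2 e using fun y : U ↦ exists_res_eq_of_germAt_eq S y.2 y.2 (h y.1 y.2)
  exact sec_ext S W h1 (fun y hy ↦ ⟨⟨y, hy⟩, hW _⟩) e

lemma germAt_congr (S : Shv k Y) {U V : Opens Y} {y z : Y} (e : z = y) (hU : z ∈ U) (hV : z ∈ V)
    (hU' : y ∈ U) (hV' : y ∈ V) {s : sec S U} {t : sec S V} (h : germAt S hU s = germAt S hV t) :
    germAt S hU' s = germAt S hV' t := by
  subst e
  exact h

/-- The germs of sections over connected open subsets on which a sheaf has constant sections. -/
lemma germAt_bijective [LocallyConnectedSpace Y] (S : Shv k Y) {U : Opens Y}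
    (h : ∀ V : Opens Y, IsConnected (V : Set Y) → ∀ hV : V ≤ U, Function.Bijective (res S hV))
    {y : Y} (hy : y ∈ U) : Function.Bijective (germAt S hy) := by
  constructor
  · intro s t e
    obtain ⟨W, hyW, h1, h2, e⟩ := exists_res_eq_of_germAt_eq S hy hy e
    obtain ⟨⟨V, hV⟩, hyV, hVW⟩ := exists_le_of_isBasis (isBasis_isConnected Y) hyW
    refine (h V hV (hVW.trans h1)).1 ?_
    have := congrArg (res S hVW) e
    rwa [res_res, res_res] at this
  · intro g
    obtain ⟨W, hyW, s, rfl⟩ := exists_germAt_eq S g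
    obtain ⟨⟨V, hV⟩, hyV, hVW⟩ := exists_le_of_isBasis (isBasis_isConnected Y)
      (show y ∈ W ⊓ U from ⟨hyW, hy⟩)
    obtain ⟨t, ht⟩ := (h V hV (hVW.trans inf_le_right)).2 (res S (hVW.trans inf_le_left) s)
    refine ⟨t, ?_⟩
    rw [← germAt_res S hyV (hVW.trans inf_le_right) t, ht, germAt_res]

/-- On a simply connected space, a germ of a locally constant sheaf extends uniquely to a global
section. -/
lemma germAt_top_bijective [LocallyConnectedSpace Y] (hY : IsSimplyConnected Y) (S : Shv k Y)
    (h : ∀ y : Y, ∃ U : Opens Y, ∃ _ : y ∈ U, ∀ z (hz : z ∈ U), Function.Bijective (germAt S hz))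
    (y : Y) : Function.Bijective (germAt S (Opens.mem_top y)) := by
  have := hY.connected
  constructor
  · intro s t e
    let A : Set Y := {z | germAt S (Opens.mem_top z) s = germAt S (Opens.mem_top z) t}
    -- Agreement of germs is always an open condition. It is closed because near every point a
    -- section over `U` is determined by its germ at any point of `U`.
    have hA : IsClopen A := by
      refine ⟨⟨isOpen_iff_forall_mem_open.mpr fun z hz ↦ ?_⟩,
        isOpen_iff_forall_mem_open.mpr fun z hz ↦ ?_⟩
      · obtain ⟨U, hzU, hU⟩ := h z
        refine ⟨U, fun a ha e ↦ hz ?_, U.isOpen, hzU⟩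
        have : res S (le_top : U ≤ ⊤) s = res S le_top t := by
          refine (hU a ha).1 ?_
          rw [germAt_res, germAt_res]
          exact e
        have := congrArg (germAt S hzU) this
        rwa [germAt_res, germAt_res] at this
      · obtain ⟨W, hzW, h1, h2, e⟩ := exists_res_eq_of_germAt_eq S _ _ hz
        refine ⟨W, fun a ha ↦ ?_, W.isOpen, hzW⟩
        have := congrArg (germAt S ha) e
        rwa [germAt_res, germAt_res] at this
    have hA' := hA.eq_univ ⟨y, e⟩
    exact sec_ext_germAt S fun z _ ↦ (hA' ▸ Set.mem_univ z : z ∈ A)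
  · intro g₀
    let E := TopCat.Presheaf.EtaleSpace S.1
    let p : E → Y := TopCat.Presheaf.EtaleSpace.base
    -- Bijectivity of germ maps over the sets `U` trivializes the étale space locally. As a covering
    -- of `Y` it is then globally trivial, and the slice through `g₀` is a continuous section `σ`.
    have hp : IsCoveringMap p := by
      refine TopCat.Presheaf.EtaleSpace.isCoveringMap_base fun y ↦ ?_
      obtain ⟨U, hU, h⟩ := h y
      exact ⟨U, hU, h⟩
    obtain ⟨I, _, _, H, hH⟩ := hY.trivial_covering E p hp
    let e₀ : E := ⟨y, g₀⟩
    let σ (z : Y) : E := H.symm (z, (H e₀).2)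
    have hσ : Continuous σ := by fun_prop
    have hσp (z : Y) : (σ z).base = z :=
      (hH _).symm.trans (congrArg Prod.fst (H.apply_symm_apply _))
    have hσy : σ y = e₀ := by
      have : (y, (H e₀).2) = H e₀ := Prod.ext (hH e₀).symm rfl
      change H.symm (y, (H e₀).2) = e₀
      rw [this, H.symm_apply_apply]
    -- A continuous section of the étale space is locally the family of germs of a section of `S`.
    -- These local sections have the same germs on overlaps and so glue.
    have loc (z : Y) : ∃ (W : Opens Y) (_ : z ∈ W) (s : sec S W), ∀ a ∈ W,
        ∃ ha : (σ a).base ∈ W, (σ a).germ = germAt S ha s := by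
      obtain ⟨U, hzU, s, hs⟩ := TopCat.Presheaf.EtaleSpace.exists_section_of_tendsto (hσ.tendsto z)
      obtain ⟨W, hW, hWo, hzW⟩ := mem_nhds_iff.mp hs
      rw [hσp] at hzU
      refine ⟨⟨W, hWo⟩ ⊓ U, ⟨hzW, hzU⟩, res S inf_le_right s, fun a ha ↦ ?_⟩
      obtain ⟨ha', e⟩ := hW ha.1
      have ha'' : (σ a).base ∈ (⟨W, hWo⟩ ⊓ U : Opens Y) := (hσp a).symm ▸ ha
      exact ⟨ha'', e.trans (germAt_res S ha'' inf_le_right s).symm⟩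
    choose W hW s hs using loc
    obtain ⟨t, ht⟩ := exists_glue S W (fun _ ↦ le_top) (fun z _ ↦ ⟨z, hW z⟩) s fun i j ↦ by
      refine sec_ext_germAt S fun a ha ↦ ?_
      obtain ⟨hi, ei⟩ := hs i a ha.1
      obtain ⟨hj, ej⟩ := hs j a ha.2
      rw [germAt_res, germAt_res]
      exact germAt_congr S (hσp a) hi hj _ _ (ei.symm.trans ej)
    refine ⟨t, ?_⟩
    obtain ⟨hy, e⟩ := hs y y (hW y)
    have key (e' : E) (h1 : σ y = e') (hb : e'.base ∈ W y) : germAt S hb (s y) = e'.germ := by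
      subst h1
      exact e.symm
    refine Eq.trans ?_ (key e₀ hσy (hW y))
    exact (germAt_res S (hW y) le_top t).symm.trans (congrArg _ (ht y))

/-- For small connected `V` and `y ∈ V`, the germ at `y` is bijective both on `S(V)` and on global
sections. Hence restriction from global sections to `S(V)` is bijective, and `essImage_of_basis`
applies. -/
lemma isConstant_of_isSimplyConnected [LocallyConnectedSpace Y] (hY : IsSimplyConnected Y)
    (S : Shv k Y) (h : ∀ y : Y, ∃ U : Opens Y, y ∈ U ∧ ∀ V₁ V₂ : Opens Y,
      IsConnected (V₁ : Set Y) → IsConnected (V₂ : Set Y) → ∀ hV : V₁ ≤ V₂, V₂ ≤ U →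
        Function.Bijective (res S hV)) : (constSheaf k Y).essImage S := by
  let B : {V : Opens Y // IsConnected (V : Set Y) ∧ ∀ V₁ : Opens Y, IsConnected (V₁ : Set Y) →
    ∀ hV : V₁ ≤ V, Function.Bijective (res S hV)} → Opens Y := Subtype.val
  have hB : Opens.IsBasis (Set.range B) := by
    rw [Opens.isBasis_iff_nbhd]
    intro O y hy
    obtain ⟨U, hyU, hU⟩ := h y
    obtain ⟨⟨V, hV⟩, hyV, hVO⟩ := exists_le_of_isBasis (isBasis_isConnected Y)
      (show y ∈ O ⊓ U from ⟨hy, hyU⟩)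
    exact ⟨V, ⟨⟨V, hV, fun V₁ h1 h2 ↦ hU V₁ V h1 hV h2 (hVO.trans inf_le_right)⟩, rfl⟩, hyV,
      hVO.trans inf_le_left⟩
  refine essImage_of_basis hB (fun V ↦ V.2.1) fun V ↦ ?_
  obtain ⟨y, hy⟩ := V.2.1.nonempty
  have h1 := germAt_bijective S V.2.2 hy
  have h2 := germAt_top_bijective hY S (fun y ↦ by
    obtain ⟨V, hy, -⟩ := exists_le_of_isBasis hB (Opens.mem_top y)
    exact ⟨V.1, hy, fun z hz ↦ germAt_bijective S V.2.2 hz⟩) y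
  refine (Function.Bijective.of_comp_iff' h1 _).mp ?_
  convert h2 using 1
  exact funext fun s ↦ germAt_res S hy le_top s

end LocallyConstantSheaves

/-! ### Quasi-coherent sheaves become constant on the universal covering. -/

section Pullback

variable {k : Type u} [Ring k] {X X' : TopCat.{u}} {φ : X' ⟶ X}

lemma locallyConnectedSpace_of_isLocalHomeomorph [LocallyConnectedSpace X]
    (hφ : IsLocalHomeomorph φ) : LocallyConnectedSpace X' :=
  locallyConnectedSpace_iff_subsets_isOpen_isConnected.mpr fun y V hV ↦ by
    obtain ⟨O, hOV, hO, hyO⟩ := mem_nhds_iff.mp hV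
    obtain ⟨U, hU, hyU, hUO, hc, -⟩ := exists_connected_injOn hφ hO hyO
    exact ⟨U, hUO.trans hOV, hU, hyU, hc⟩

/-- The pullback of a quasi-coherent sheaf to the universal covering is constant. -/
lemma essImage_inverseImage_of_isQuasicoherent [LocallyConnectedSpace X]
    (hφ : IsUniversalCovering φ) {L : Shv k X} (hL : isQuasicoherent k X L) :
    (constSheaf k X').essImage ((inverseImage k φ).obj L) := by
  have hl := hφ.isCoveringMap.isLocalHomeomorph
  have := locallyConnectedSpace_of_isLocalHomeomorph hl
  refine isConstant_of_isSimplyConnected hφ.isSimplyConnected _ fun y ↦ ?_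
  obtain ⟨U, hyU, hU⟩ := exists_isConstOn k hL (φ y)
  -- Inside a sheet over `U`, sections of `φ⁻¹L` over a connected `V` are sections of `L` over the
  -- connected set `φ(V) ⊆ U`, where `L` is constant.
  obtain ⟨O, hyO, hOU, hO⟩ := exists_isSheet hl (O := (Opens.map φ).obj U) hyU
  refine ⟨O, hyO, fun V₁ V₂ h₁ h₂ h₁₂ h₂O ↦ ?_⟩
  let f := hl.isOpenMap.functor
  have hc {V : Opens X'} (hV : IsConnected (V : Set X')) : IsConnected (f.obj V : Set X) :=
    hV.image _ hl.continuous.continuousOn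
  have hle : f.obj V₂ ≤ U := by
    rintro _ ⟨x, hx, rfl⟩
    exact hOU (h₂O hx)
  have b (V : Opens X') (hV : V ≤ O) := pull_bijective hl.isOpenMap L (hO.injOn.mono hV)
    (U := f.obj V) rfl fun x hx ↦ ⟨x, hx, rfl⟩
  have h3 := bijective_res_of_isConstOn (hU (f.obj V₂) hle (hc h₂)) (hc h₂) (hc h₁)
    (f.map (homOfLE h₁₂)).le le_rfl
  refine (Function.Bijective.of_comp_iff _ (b V₂ h₂O)).mp ?_
  convert (b V₁ (h₁₂.trans h₂O)).comp h3 using 1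
  exact funext fun s ↦ (res_pull φ L _ _ s).trans (pull_res φ L _ _ s).symm

lemma bijective_res_inverseImage [LocallyConnectedSpace X] (hφ : IsUniversalCovering φ)
    {L : Shv k X} (hL : isQuasicoherent k X L) {V : Opens X'} (hV : IsConnected (V : Set X')) :
    Function.Bijective (res ((inverseImage k φ).obj L) (le_top : V ≤ ⊤)) := by
  have := hφ.isSimplyConnected.connected
  exact bijective_res_of_essImage (essImage_inverseImage_of_isQuasicoherent hφ hL)
    (connectedSpace_iff_univ.mp this) hV _

end Pullback

end LocSys
end

noncomputable section
namespace LocSys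

/-! ### The action of deck transformations on sections. -/

section DeckAction

variable {k : Type u} [Ring k] {X X' : TopCat.{u}} {φ : X' ⟶ X}

lemma le_deckMap_top (g : deckGroup φ) (W : Opens X') : W ≤ (Opens.map (deckMap g)).obj ⊤ :=
  fun _ _ ↦ Opens.mem_top _

/-- The pullback of sections of `φ⁻¹F` along a deck transformation. -/
def deckPull (g : deckGroup φ) (F : Shv k X) {V W : Opens X'}
    (h : W ≤ (Opens.map (deckMap g)).obj V) :
    sec ((inverseImage k φ).obj F) V →ₗ[k] sec ((inverseImage k φ).obj F) W :=
  onSec ((deckIso k g).hom.app F) W ∘ₗ pull (deckMap g) ((inverseImage k φ).obj F) h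

lemma res_deckPull (g : deckGroup φ) (F : Shv k X) {V W W' : Opens X'}
    (h : W ≤ (Opens.map (deckMap g)).obj V) (i : W' ≤ W) (s) :
    res _ i (deckPull g F h s) = deckPull g F (i.trans h) s := by
  refine (onSec_res ((deckIso k g).hom.app F) i _).symm.trans (congrArg _ ?_)
  exact res_pull _ _ _ _ _

lemma deckPull_res (g : deckGroup φ) (F : Shv k X) {V V' W : Opens X'}
    (h : W ≤ (Opens.map (deckMap g)).obj V') (i : V' ≤ V) (s) :
    deckPull g F h (res _ i s) =
      deckPull g F (h.trans ((Opens.map (deckMap g)).map (homOfLE i)).le) s :=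
  congrArg (onSec ((deckIso k g).hom.app F) W) (pull_res _ _ _ _ _)

lemma deckPull_pull (g : deckGroup φ) (F : Shv k X) {U : Opens X} {V W : Opens X'}
    (h : W ≤ (Opens.map (deckMap g)).obj V) (hV : V ≤ (Opens.map φ).obj U)
    (hW : W ≤ (Opens.map φ).obj U) (s : sec F U) :
    deckPull g F h (pull φ F hV s) = pull φ F hW s :=
  inverseImageComp_pull (deckMap_comp g) F hV h hW s

lemma sectionsRep_ρ (F : Shv k X) (g : deckGroup φ) (s : sec ((inverseImage k φ).obj F) ⊤) :
    ((sectionsRep k φ).obj F).ρ g s = deckPull g⁻¹ F (le_deckMap_top g⁻¹ ⊤) s :=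
  congrArg (onSec ((deckIso k g⁻¹).hom.app F) ⊤) (pull_top (deckMap g⁻¹) _ s).symm

/-- The linear map underlying a morphism between representations on sections. -/
def repHomSec {F F' : Shv k X} (h : (sectionsRep k φ).obj F ⟶ (sectionsRep k φ).obj F') :
    sec ((inverseImage k φ).obj F) ⊤ →ₗ[k] sec ((inverseImage k φ).obj F') ⊤ :=
  h.hom.toLinearMap

lemma repHomSec_deckPull {F F' : Shv k X} (h : (sectionsRep k φ).obj F ⟶ (sectionsRep k φ).obj F')
    (g : deckGroup φ) (s) : repHomSec h (deckPull g F (le_deckMap_top g ⊤) s) =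
      deckPull g F' (le_deckMap_top g ⊤) (repHomSec h s) := by
  -- The element `g` acts by pullback along `g⁻¹`, so pullback along `g` is the action of `g⁻¹`.
  have h1 := sectionsRep_ρ F g⁻¹ s
  have h2 := sectionsRep_ρ F' g⁻¹ (repHomSec h s)
  rw [inv_inv] at h1 h2
  rw [← h1, ← h2]
  exact Rep.hom_comm_apply h g⁻¹ s

end DeckAction

/-! ### Morphisms out of a quasi-coherent sheaf are equivariant maps. -/

section Homs

variable {k : Type u} [Ring k] {X X' : TopCat.{u}} {φ : X' ⟶ X}

/-- Connectedness of `X` makes `φ` surjective, so every point of `X` lies under small sheets. -/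
lemma isBasis_image_isSheet [ConnectedSpace X] [LocallyConnectedSpace X]
    (hφ : IsUniversalCovering φ) : Opens.IsBasis (Set.range
      (fun V : {V : Opens X' // IsSheet φ V} ↦ hφ.isCoveringMap.isOpenMap.functor.obj V.1)) := by
  have := hφ.isSimplyConnected.connected
  rw [Opens.isBasis_iff_nbhd]
  intro U x hx
  obtain ⟨y, rfl⟩ := isCoveringMap_surjective hφ.isCoveringMap x
  obtain ⟨V, hyV, hVU, hV⟩ := exists_isSheet hφ.isCoveringMap.isLocalHomeomorph
    (O := (Opens.map φ).obj U) hx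
  refine ⟨_, ⟨⟨V, hV⟩, rfl⟩, ⟨y, hyV, rfl⟩, ?_⟩
  rintro _ ⟨z, hz, rfl⟩
  exact hVU hz

lemma le_map_functor (hφ : IsOpenMap φ) (V : Opens X') :
    V ≤ (Opens.map φ).obj (hφ.functor.obj V) := fun x hx ↦ ⟨x, hx, rfl⟩

variable [ConnectedSpace X] [LocallyConnectedSpace X] (hφ : IsUniversalCovering φ)
  {L : Shv k X} (hL : isQuasicoherent k X L) (A : Shv k X)

-- A section of `L` over `φ(V)` pulls back to the sheet `V`, and there it extends to a global
-- section because `φ⁻¹L` is constant. So a morphism out of `L` is determined by its effect on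
-- global sections upstairs.
include hφ hL in
lemma sectionsRep_map_injective {a b : L ⟶ A}
    (h : (sectionsRep k φ).map a = (sectionsRep k φ).map b) : a = b := by
  refine hom_ext_basis (isBasis_image_isSheet hφ) fun ⟨V, hV⟩ s ↦ ?_
  have ho := hφ.isCoveringMap.isOpenMap
  have hp := pull_bijective ho A hV.injOn rfl (le_map_functor ho V)
  apply hp.1
  obtain ⟨t, ht⟩ := (bijective_res_inverseImage hφ hL hV.isConnected).2
    (pull φ L (le_map_functor ho V) s)
  have key (c : L ⟶ A) : pull φ A (le_map_functor ho V) (onSec c _ s) =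
      res _ le_top (onSec ((inverseImage k φ).map c) ⊤ t) := by
    rw [← onSec_pull, ← ht, onSec_res]
  rw [key, key]
  exact congrArg (fun c ↦ res ((inverseImage k φ).obj A) (le_top : V ≤ ⊤) (repHomSec c t)) h

-- On the image of a sheet: pull a section back to the sheet, extend it globally, apply `h`,
-- restrict to the sheet and descend to the image. Nothing is required of `A`, because extension is
-- only needed on the side of `L`.
include hφ hL in
lemma sectionsRep_map_surjective (h : (sectionsRep k φ).obj L ⟶ (sectionsRep k φ).obj A) :
    ∃ a : L ⟶ A, (sectionsRep k φ).map a = h := by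
  have ho := hφ.isCoveringMap.isOpenMap
  let pA (V : {V : Opens X' // IsSheet φ V}) :=
    LinearEquiv.ofBijective _ (pull_bijective ho A V.2.injOn rfl (le_map_functor ho V.1))
  let r (V : {V : Opens X' // IsSheet φ V}) :=
    LinearEquiv.ofBijective _ (bijective_res_inverseImage hφ hL V.2.isConnected)
  let a (V : {V : Opens X' // IsSheet φ V}) :
      sec L (ho.functor.obj V.1) →ₗ[k] sec A (ho.functor.obj V.1) :=
    (pA V).symm.toLinearMap ∘ₗ res _ le_top ∘ₗ repHomSec h ∘ₗ (r V).symm.toLinearMap ∘ₗ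
      pull φ L (le_map_functor ho V.1)
  have ha (V : {V : Opens X' // IsSheet φ V}) (s : sec L (ho.functor.obj V.1))
      (t : sec ((inverseImage k φ).obj L) ⊤) (ht : res _ le_top t = pull φ L (le_map_functor ho V.1) s) :
      pull φ A (le_map_functor ho V.1) (a V s) = res _ le_top (repHomSec h t) := by
    refine ((pA V).apply_symm_apply _).trans ?_
    have : (r V).symm (pull φ L (le_map_functor ho V.1) s) = t := by
      rw [← ht]
      exact (r V).symm_apply_apply t
    exact congrArg (fun t ↦ res ((inverseImage k φ).obj A) (le_top : V.1 ≤ ⊤) (repHomSec h t)) this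
  refine ⟨homOfBasis (isBasis_image_isSheet hφ) a fun V V' hV s ↦ ?_, ?_⟩
  -- From `φ(V') ⊆ φ(V)` it does not follow that `V' ⊆ V`, so `V'` is first moved into `V` by a deck
  -- transformation `g`. If `t` extends the pullback of `s` from `V`, its pullback along `g` extends
  -- the pullback from `V'`; equivariance of `h` then concludes.
  · obtain ⟨g, hg⟩ := exists_deck_image hφ V'.2 hV V.2.injOn
    have hg' : V'.1 ≤ (Opens.map (deckMap g)).obj V.1 := hg
    obtain ⟨t, ht⟩ := (r V).surjective (pull φ L (le_map_functor ho V.1) s)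
    replace ht : res _ le_top t = pull φ L (le_map_functor ho V.1) s := ht
    have h1 : res _ le_top (deckPull g L (le_deckMap_top g ⊤) t) =
        pull φ L (le_map_functor ho V'.1) (res L hV s) := by
      rw [res_deckPull, ← deckPull_res g L hg' le_top t, ht, pull_res,
        deckPull_pull g L hg' (le_map_functor ho V.1)]
    apply (pA V').injective
    refine (ha V' _ _ h1).trans ?_
    rw [repHomSec_deckPull, res_deckPull, ← deckPull_res g A hg' le_top, ← ha V s t ht]
    have hVV : V'.1 ≤ (Opens.map φ).obj (ho.functor.obj V.1) := fun x hx ↦ hV ⟨x, hx, rfl⟩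
    exact (deckPull_pull g A hg' _ hVV _).trans (pull_res φ A _ hV _).symm
  · suffices key : ∀ t : sec ((inverseImage k φ).obj L) ⊤,
        onSec ((inverseImage k φ).map (homOfBasis (isBasis_image_isSheet hφ) a _)) ⊤ t =
          repHomSec h t from Rep.hom_ext (by ext t; exact key t)
    intro t
    refine sec_ext_basis _ (isBasis_isSheet hφ.isCoveringMap.isLocalHomeomorph) fun V hV ↦ ?_
    obtain ⟨s, hs⟩ := (pull_bijective ho L V.2.injOn rfl (le_map_functor ho V.1)).2 (res _ le_top t)
    rw [← onSec_res, ← hs, onSec_pull, ← ha V s t hs.symm]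
    exact congrArg _ (homOfBasis_onSec (isBasis_image_isSheet hφ) a _ V s)

end Homs

end LocSys
end

noncomputable section
namespace LocSys

/-- An equivariant linear equivalence induces an isomorphism of representations. -/
def repIso {k : Type u} [Ring k] {G : Type u} [Group G] {A B : Rep.{u} k G} (e : A ≃ₗ[k] B)
    (h : ∀ g x, e (A.ρ g x) = B.ρ g (e x)) : A ≅ B :=
  Rep.mkIso (Representation.Equiv.mk e fun g ↦ LinearMap.ext (h g))

/-! ### The local system of a representation, and its representation on sections. -/

section LocalSystem

variable {k : Type u} [Ring k] {X X' : TopCat.{u}} {φ : X' ⟶ X} (M : Rep.{u} k (deckGroup φ))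

lemma deck_mem {U : Opens X} (g : deckGroup φ) {y : X'} (hy : y ∈ (Opens.map φ).obj U) :
    g.1 y ∈ (Opens.map φ).obj U := by
  change φ (g.1 y) ∈ U
  rw [g.2 y]
  exact hy

/-- The sections of the local system associated to a representation: the equivariant locally
constant functions on the inverse image of an open subset. -/
def localSystemSections (U : Opens X) : Submodule k ((Opens.map φ).obj U → M) where
  carrier := {f | IsLocallyConstant f ∧
    ∀ (g : deckGroup φ) (y : (Opens.map φ).obj U), f ⟨g.1 y.1, deck_mem g y.2⟩ = M.ρ g (f y)}
  zero_mem' := ⟨IsLocallyConstant.const 0, fun _ _ ↦ (map_zero _).symm⟩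
  add_mem' ha hb := ⟨ha.1.add hb.1, fun g y ↦ by
    rw [Pi.add_apply, Pi.add_apply, map_add, ha.2, hb.2]⟩
  smul_mem' c f hf := ⟨hf.1.comp (c • ·), fun g y ↦ by
    rw [Pi.smul_apply, Pi.smul_apply, map_smul, hf.2]⟩

/-- The restriction of sections of the local system associated to a representation. -/
def localSystemRes {U V : Opens X} (h : V ≤ U) :
    localSystemSections M U →ₗ[k] localSystemSections M V where
  toFun f := ⟨fun y ↦ f.1 ⟨y.1, h y.2⟩,
    f.2.1.comp_continuous (f := fun y : (Opens.map φ).obj V ↦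
      (⟨y.1, h y.2⟩ : (Opens.map φ).obj U)) (by fun_prop), fun g y ↦ f.2.2 g ⟨y.1, h y.2⟩⟩
  map_add' _ _ := rfl
  map_smul' _ _ := rfl

/-- The presheaf of sections of the local system associated to a representation. -/
def localSystemPresheaf : TopCat.Presheaf (ModuleCat.{u} k) X where
  obj U := ModuleCat.of k (localSystemSections M U.unop)
  map i := ModuleCat.ofHom (localSystemRes M i.unop.le)
  map_id _ := rfl
  map_comp _ _ := rfl

/-- Sections are functions on inverse images, and both local constancy and equivariance can be
checked over a cover of the base. -/
lemma localSystemPresheaf_isSheaf : (localSystemPresheaf M).IsSheaf := by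
  have : (forget (ModuleCat.{u} k)).ReflectsIsomorphisms := inferInstance
  refine (TopCat.Presheaf.isSheaf_iff_isSheafUniqueGluing _).mpr fun ι U sf hsf ↦ ?_
  let f (i : ι) : localSystemSections M (U i) := sf i
  have hf (i j : ι) (y : X') (hi : φ y ∈ U i) (hj : φ y ∈ U j) :
      (f i).1 ⟨y, hi⟩ = (f j).1 ⟨y, hj⟩ :=
    congrFun (congrArg Subtype.val (hsf i j)) ⟨y, hi, hj⟩
  have hU (y : (Opens.map φ).obj (iSup U)) : ∃ i, φ y.1 ∈ U i := Opens.mem_iSup.mp y.2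
  choose n hn using hU
  let s : (Opens.map φ).obj (iSup U) → M := fun y ↦ (f (n y)).1 ⟨y.1, hn y⟩
  have hs (i : ι) (y : X') (hi : φ y ∈ U i) (h) : s ⟨y, h⟩ = (f i).1 ⟨y, hi⟩ := hf _ _ _ _ _
  refine ⟨⟨s, ?_, fun g y ↦ ?_⟩, fun i ↦ ?_, fun t ht ↦ ?_⟩
  · rw [IsLocallyConstant.iff_exists_open]
    intro y
    obtain ⟨O, hO, hyO, h⟩ := (IsLocallyConstant.iff_exists_open _).mp (f (n y)).2.1 ⟨y.1, hn y⟩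
    obtain ⟨O', hO', rfl⟩ := isOpen_induced_iff.mp hO
    refine ⟨Subtype.val ⁻¹' (O' ∩ (Opens.map φ).obj (U (n y))),
      (hO'.inter ((Opens.map φ).obj _).isOpen).preimage continuous_subtype_val, ⟨hyO, hn y⟩, ?_⟩
    intro z hz
    refine (hs (n y) z.1 hz.2 z.2).trans (h ⟨z.1, hz.2⟩ hz.1)
  · refine (hs (n y) _ (deck_mem g (hn y)) _).trans ((f (n y)).2.2 g ⟨y.1, hn y⟩)
  · exact Subtype.ext (funext fun y ↦ hs i y.1 y.2 _)
  · refine Subtype.ext (funext fun y ↦ ?_)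
    exact congrFun (congrArg Subtype.val (ht (n y))) ⟨y.1, hn y⟩

/-- The local system associated to a representation of the group of deck transformations. -/
def localSystem : Shv k X := ⟨localSystemPresheaf M, localSystemPresheaf_isSheaf M⟩

/-- The evaluation of a section of the local system associated to a representation. -/
def evalAt {U : Opens X} (y : X') (hy : φ y ∈ U) : sec (localSystem M) U →ₗ[k] M :=
  (LinearMap.proj (R := k) (φ := fun _ ↦ M) ⟨y, hy⟩) ∘ₗ (localSystemSections M U).subtype

lemma evalAt_deck {U : Opens X} (g : deckGroup φ) (y : X') (hy : φ y ∈ U)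
    (s : sec (localSystem M) U) : evalAt M (g.1 y) (deck_mem g hy) s = M.ρ g (evalAt M y hy s) :=
  s.2.2 g ⟨y, hy⟩

lemma evalAt_ext {U : Opens X} {s t : sec (localSystem M) U}
    (h : ∀ y (hy : φ y ∈ U), evalAt M y hy s = evalAt M y hy t) : s = t :=
  Subtype.ext (funext fun y ↦ h y.1 y.2)

/-- The section of the local system with given values. -/
def secMk {U : Opens X} (f : (Opens.map φ).obj U → M) (hf : IsLocallyConstant f)
    (hg : ∀ (g : deckGroup φ) y, f ⟨g.1 y.1, deck_mem g y.2⟩ = M.ρ g (f y)) :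
    sec (localSystem M) U := ⟨f, hf, hg⟩

lemma evalAt_secMk {U : Opens X} (f : (Opens.map φ).obj U → M) (hf hg) (y : X') (hy : φ y ∈ U) :
    evalAt M y hy (secMk M f hf hg) = f ⟨y, hy⟩ := rfl

lemma isLocallyConstant_evalAt {U : Opens X} (s : sec (localSystem M) U) :
    IsLocallyConstant (fun y : (Opens.map φ).obj U ↦ evalAt M y.1 y.2 s) := s.2.1

/-- The zero locus of `s` and its complement in `φ⁻¹(U)` are open and stable under deck
transformations. Since fibres are orbits, their images are disjoint; these images are open and cover
the connected set `U`, so one of them is empty. -/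
lemma evalAt_injective [ConnectedSpace X] (hφ : IsUniversalCovering φ) {U : Opens X} (hU : IsConnected (U : Set X))
    (y : X') (hy : φ y ∈ U) : Function.Injective (evalAt M y hy) := by
  rw [injective_iff_map_eq_zero]
  intro s hs
  have hcont := (isLocallyConstant_evalAt M s)
  have hl := hφ.isCoveringMap.isOpenMap
  have img (A : Set M) : IsOpen (φ '' (Subtype.val '' {z : (Opens.map φ).obj U | evalAt M z.1 z.2 s ∈ A})) :=
    hl _ (((Opens.map φ).obj U).isOpen.isOpenMap_subtype_val _ (hcont A))
  have hz : (U : Set X) ∩ (φ '' (Subtype.val '' {z : (Opens.map φ).obj U | evalAt M z.1 z.2 s ∈ ({0} : Set M)}) ∩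
      φ '' (Subtype.val '' {z : (Opens.map φ).obj U | evalAt M z.1 z.2 s ∈ ({0}ᶜ : Set M)})) = ∅ := by
    rw [Set.eq_empty_iff_forall_notMem]
    rintro _ ⟨-, ⟨_, ⟨⟨z, hz⟩, h0, rfl⟩, rfl⟩, ⟨_, ⟨⟨w, hw⟩, h1, rfl⟩, e⟩⟩
    obtain ⟨g, hg⟩ := exists_deck hφ e.symm
    dsimp only at hg
    subst hg
    refine h1 ((evalAt_deck M g z hz s).trans ?_)
    rw [Set.mem_singleton_iff.mp h0, map_zero]
  refine evalAt_ext M fun w hw ↦ ?_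
  rw [map_zero]
  by_contra hne
  have := hU.isPreconnected _ _ (img {0}) (img {0}ᶜ) ?_ ⟨φ y, hy, ⟨y, ⟨⟨y, hy⟩, hs, rfl⟩, rfl⟩⟩
    ⟨φ w, hw, ⟨w, ⟨⟨w, hw⟩, hne, rfl⟩, rfl⟩⟩
  · rw [hz] at this
    exact Set.not_nonempty_empty this
  · have := hφ.isSimplyConnected.connected
    intro x hx
    obtain ⟨z, rfl⟩ := isCoveringMap_surjective hφ.isCoveringMap x
    by_cases h0 : evalAt M z hx s = 0
    · exact Or.inl ⟨z, ⟨⟨z, hx⟩, h0, rfl⟩, rfl⟩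
    · exact Or.inr ⟨z, ⟨⟨z, hx⟩, h0, rfl⟩, rfl⟩

/-- Every point `z` over `U` lies in exactly one translate `cV` with `c` in the deck group, and the
section with value `m` on `V` must be `ρ(c) m` at `z`. -/
lemma evalAt_surjective (hφ : IsUniversalCovering φ) {U : Opens X} {V : Opens X'}
    (hV : Set.InjOn φ V) (hVU : φ '' V = U) (y : X') (hyV : y ∈ V) (hy : φ y ∈ U) :
    Function.Surjective (evalAt M y hy) := by
  intro m
  have h (z : (Opens.map φ).obj U) : ∃ g : deckGroup φ, ∃ y' ∈ V, g.1 y' = z.1 := by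
    obtain ⟨y', hy', e⟩ : φ z.1 ∈ φ '' V := hVU ▸ z.2
    obtain ⟨g, hg⟩ := exists_deck hφ e
    exact ⟨g, y', hy', hg⟩
  choose c v hv hc using h
  have uniq (g : deckGroup φ) (y' : X') (hy' : y' ∈ V) (z) (e : g.1 y' = z.1) : c z = g := by
    have : v z = y' := by
      refine hV (hv z) hy' ?_
      rw [← g.2 y', e, ← hc z]
      exact ((c z).2 _).symm
    refine deck_ext hφ (y := y') ?_
    rw [e, ← hc z, this]
  refine ⟨secMk M (fun z ↦ M.ρ (c z) m) ?_ fun g z ↦ ?_, ?_⟩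
  · rw [IsLocallyConstant.iff_exists_open]
    intro z
    -- This open set is the translate of `V` containing `z`, on which `c` is constant.
    refine ⟨{w | (c z).1.symm w.1 ∈ V}, V.isOpen.preimage
      ((c z).1.symm.continuous.comp continuous_subtype_val), ?_, fun w hw ↦ ?_⟩
    · change (c z).1.symm z.1 ∈ V
      rw [← hc z, Homeomorph.symm_apply_apply]
      exact hv z
    · rw [uniq (c z) _ hw w ((c z).1.apply_symm_apply _)]
  · rw [uniq (g * c z) _ (hv z) _ (by
      change g.1 ((c z).1 (v z)) = g.1 z.1
      rw [hc z]), map_mul]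
    rfl
  · rw [evalAt_secMk, uniq 1 y hyV ⟨y, hy⟩ rfl, map_one]
    rfl

section

variable [ConnectedSpace X] [LocallyConnectedSpace X] (hφ : IsUniversalCovering φ)

-- Over the image of a sheet, and over any connected open subset of it, evaluation at a common point
-- `z` of the sheet identifies sections with `M`. So restriction between them is bijective.
include hφ in
lemma isQuasicoherent_localSystem : isQuasicoherent k X (localSystem M) := by
  have := hφ.isSimplyConnected.connected
  have ho := hφ.isCoveringMap.isOpenMap
  refine isQuasicoherent_of_isConstOn k fun x ↦ ?_
  obtain ⟨y, rfl⟩ := isCoveringMap_surjective hφ.isCoveringMap x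
  obtain ⟨V, hyV, -, hV⟩ := exists_isSheet hφ.isCoveringMap.isLocalHomeomorph (Opens.mem_top y)
  refine ⟨ho.functor.obj V, ⟨y, hyV, rfl⟩, isConstOn_of_bijective _ _ fun U hU hUV ↦ ?_⟩
  obtain ⟨_, hx⟩ := hU.nonempty
  obtain ⟨z, hz, rfl⟩ := hUV hx
  have hc : IsConnected (ho.functor.obj V : Set X) := hV.isConnected.image _ φ.hom.continuous.continuousOn
  have hz' : φ z ∈ ho.functor.obj V := ⟨z, hz, rfl⟩
  have b1 : Function.Bijective (evalAt M z hz') :=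
    ⟨evalAt_injective M hφ hc z hz', evalAt_surjective M hφ hV.injOn rfl z hz hz'⟩
  have b2 : Function.Bijective (evalAt M z hx) := by
    refine ⟨evalAt_injective M hφ hU z hx, evalAt_surjective M hφ
      (V := V ⊓ (Opens.map φ).obj U) (hV.injOn.mono Set.inter_subset_left) ?_ z ⟨hz, hx⟩ hx⟩
    ext x
    refine ⟨fun ⟨w, hw, e⟩ ↦ e ▸ hw.2, fun h ↦ ?_⟩
    obtain ⟨w, hw, rfl⟩ := hUV h
    exact ⟨w, ⟨hw, h⟩, rfl⟩
  exact (Function.Bijective.of_comp_iff' b2 _).mp b1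

end

section Fiber

variable [LocallyConnectedSpace X] (hφ : IsCoveringMap φ)

/-- A sheet containing a given point. -/
def sheetAt (y : X') : Opens X' :=
  (exists_isSheet hφ.isLocalHomeomorph (Opens.mem_top y)).choose

lemma mem_sheetAt (y : X') : y ∈ sheetAt hφ y :=
  (exists_isSheet hφ.isLocalHomeomorph (Opens.mem_top y)).choose_spec.1

lemma isSheet_sheetAt (y : X') : IsSheet φ (sheetAt hφ y) :=
  (exists_isSheet hφ.isLocalHomeomorph (Opens.mem_top y)).choose_spec.2.2

/-- The identification of the sections over a sheet with the sections over its image. -/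
def sheetEquiv (F : Shv k X) (y : X') :
    sec F (hφ.isOpenMap.functor.obj (sheetAt hφ y)) ≃ₗ[k]
      sec ((inverseImage k φ).obj F) (sheetAt hφ y) :=
  LinearEquiv.ofBijective _ (pull_bijective hφ.isOpenMap F (isSheet_sheetAt hφ y).injOn rfl
    (le_map_functor hφ.isOpenMap _))

/-- The value at a point of a section of the inverse image of the local system associated to a
representation. -/
def valueAt (y : X') : sec ((inverseImage k φ).obj (localSystem M)) ⊤ →ₗ[k] M :=
  evalAt M (U := hφ.isOpenMap.functor.obj (sheetAt hφ y)) y ⟨y, mem_sheetAt hφ y, rfl⟩ ∘ₗ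
    (sheetEquiv hφ (localSystem M) y).symm.toLinearMap ∘ₗ res _ le_top

/-- The value may be computed from any section of the local system representing `s` near `y`: two
representatives agree over the image of the intersection of `V` with the chosen sheet, where `pull`
is injective. -/
lemma valueAt_eq {U : Opens X} {V : Opens X'} (hVU : V ≤ (Opens.map φ).obj U) (y : X') (hy : y ∈ V)
    (f : sec (localSystem M) U) (s : sec ((inverseImage k φ).obj (localSystem M)) ⊤)
    (hs : res _ le_top s = pull φ (localSystem M) hVU f) :
    valueAt M hφ y s = evalAt M y (hVU hy) f := by
  let f' := (sheetEquiv hφ (localSystem M) y).symm (res _ le_top s)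
  have hf' : res _ le_top s = pull φ (localSystem M) (le_map_functor hφ.isOpenMap _) f' :=
    ((sheetEquiv hφ (localSystem M) y).apply_symm_apply _).symm
  let V' := V ⊓ sheetAt hφ y
  let U' := hφ.isOpenMap.functor.obj V'
  have hU : U' ≤ U := by
    rintro _ ⟨z, hz, rfl⟩
    exact hVU hz.1
  have hU' : U' ≤ hφ.isOpenMap.functor.obj (sheetAt hφ y) := by
    rintro _ ⟨z, hz, rfl⟩
    exact ⟨z, hz.2, rfl⟩
  have hi := (pull_bijective hφ.isOpenMap (localSystem M) (V := V')
    ((isSheet_sheetAt hφ y).injOn.mono Set.inter_subset_right) rfl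
    (le_map_functor hφ.isOpenMap V')).1
  have key : res _ hU f = res _ hU' f' := by
    apply hi
    refine (pull_res φ _ _ hU f).trans ((res_pull φ _ hVU (inf_le_left : V' ≤ V) f).symm.trans ?_)
    refine Eq.trans ?_ (pull_res φ _ _ hU' f').symm
    refine Eq.trans ?_ (res_pull φ _ (le_map_functor hφ.isOpenMap _)
      (inf_le_right : V' ≤ sheetAt hφ y) f')
    rw [← hs, ← hf', res_res, res_res]
  have hy' : φ y ∈ U' := ⟨y, ⟨hy, mem_sheetAt hφ y⟩, rfl⟩
  exact congrArg (evalAt M y hy') key.symm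

/-- On a sheet all values of `s` are evaluations of one section of the local system, so they vary
locally constantly along `X'`. -/
lemma valueAt_eq_of_preconnected [PreconnectedSpace X'] (y z : X')
    (s : sec ((inverseImage k φ).obj (localSystem M)) ⊤) :
    valueAt M hφ y s = valueAt M hφ z s := by
  have : IsLocallyConstant (fun y ↦ valueAt M hφ y s) := by
    rw [IsLocallyConstant.iff_exists_open]
    intro y
    have hf := ((sheetEquiv hφ (localSystem M) y).apply_symm_apply (res _ le_top s)).symm
    let U := hφ.isOpenMap.functor.obj (sheetAt hφ y)
    obtain ⟨O, hO, hyO, h⟩ := (IsLocallyConstant.iff_exists_open _).mp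
      (isLocallyConstant_evalAt M ((sheetEquiv hφ (localSystem M) y).symm (res _ le_top s)))
      ⟨y, le_map_functor hφ.isOpenMap _ (mem_sheetAt hφ y)⟩
    obtain ⟨O', hO', rfl⟩ := isOpen_induced_iff.mp hO
    refine ⟨O' ∩ sheetAt hφ y, hO'.inter (sheetAt hφ y).isOpen, ⟨hyO, mem_sheetAt hφ y⟩, ?_⟩
    intro z hz
    refine (valueAt_eq M hφ (le_map_functor hφ.isOpenMap _) z hz.2 _ s hf).trans (Eq.trans ?_
      (valueAt_eq M hφ (le_map_functor hφ.isOpenMap _) y (mem_sheetAt hφ y) _ s hf).symm)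
    exact h ⟨z, le_map_functor hφ.isOpenMap _ hz.2⟩ hz.1
  exact this.apply_eq_of_preconnectedSpace y z

/-- If `f` represents `s` on a sheet `V` at `y`, the same `f` represents the translated section on
the translate of `V` by `g`. Equivariance of `f` gives the factor `ρ(g)`. -/
lemma valueAt_deckPull (g : deckGroup φ) (y : X')
    (s : sec ((inverseImage k φ).obj (localSystem M)) ⊤) :
    valueAt M hφ (g.1 y) (deckPull g⁻¹ (localSystem M) (le_deckMap_top g⁻¹ ⊤) s) =
      M.ρ g (valueAt M hφ y s) := by
  have hf := ((sheetEquiv hφ (localSystem M) y).apply_symm_apply (res _ le_top s)).symm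
  replace hf : res _ le_top s = pull φ (localSystem M) (le_map_functor hφ.isOpenMap _) _ := hf
  let V := sheetAt hφ y
  let W : Opens X' := (Opens.map (deckMap g⁻¹)).obj V
  have hW : W ≤ (Opens.map φ).obj (hφ.isOpenMap.functor.obj V) := by
    intro z hz
    exact ⟨_, hz, (g⁻¹).2 z⟩
  have hyW : g.1 y ∈ W := by
    change g.1.symm (g.1 y) ∈ V
    rw [Homeomorph.symm_apply_apply]
    exact mem_sheetAt hφ y
  refine (valueAt_eq M hφ hW (g.1 y) hyW
    ((sheetEquiv hφ (localSystem M) y).symm (res _ le_top s)) _ ?_).trans ?_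
  · refine (res_deckPull g⁻¹ _ _ (le_top : W ≤ ⊤) s).trans ?_
    refine (deckPull_res g⁻¹ (localSystem M) (le_refl W) (le_top : V ≤ ⊤) s).symm.trans ?_
    refine (congrArg _ hf).trans ?_
    exact deckPull_pull g⁻¹ _ (le_refl W) _ hW _
  · exact evalAt_deck M g y _ _

end Fiber

variable [ConnectedSpace X] [LocallyConnectedSpace X] (hφ : IsUniversalCovering φ)

include hφ in
lemma bijective_valueAt (y : X') : Function.Bijective (valueAt M hφ.isCoveringMap y) := by
  have hs := isSheet_sheetAt hφ.isCoveringMap y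
  have h1 := bijective_res_inverseImage hφ (isQuasicoherent_localSystem M hφ) hs.isConnected
  have h2 := (sheetEquiv hφ.isCoveringMap (localSystem M) y).symm.bijective
  have h3 : Function.Bijective (evalAt M
      (U := hφ.isCoveringMap.isOpenMap.functor.obj (sheetAt hφ.isCoveringMap y)) y
        ⟨y, mem_sheetAt hφ.isCoveringMap y, rfl⟩) :=
    ⟨evalAt_injective M hφ (hs.isConnected.image _ φ.hom.continuous.continuousOn) y _,
      evalAt_surjective M hφ hs.injOn rfl y (mem_sheetAt hφ.isCoveringMap y) _⟩
  exact h3.comp (h2.comp h1)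

-- Evaluation at any fixed `y` works: the value at `y` of the translate of `s` by `g` equals its
-- value at `g y`, since values do not depend on the point, and that is `ρ(g)` applied to the value
-- of `s` at `y`.
include hφ in
lemma exists_iso_sectionsRep : Nonempty ((sectionsRep k φ).obj (localSystem M) ≅ M) := by
  have := hφ.isSimplyConnected.connected
  let y : X' := Classical.arbitrary X'
  let e := LinearEquiv.ofBijective _ (bijective_valueAt M hφ y)
  refine ⟨repIso e fun g s ↦ ?_⟩
  refine (congrArg (valueAt M hφ.isCoveringMap y) (sectionsRep_ρ (localSystem M) g s)).trans ?_
  exact (valueAt_eq_of_preconnected M hφ.isCoveringMap y (g.1 y) _).trans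
    (valueAt_deckPull M hφ.isCoveringMap g y s)

end LocalSystem

end LocSys
end

noncomputable section
namespace LocSys

/-! ### Formal construction of the right adjoint. -/

section Coreflection

variable {A C R : Type*} [Category* A] [Category* C] [Category* R] {ι : A ⥤ C} {Φ : C ⥤ R}
  (e : A ≌ R) (i : ι ⋙ Φ ≅ e.functor)
  (h : ∀ (L : A) (F : C), Function.Bijective (fun a : ι.obj L ⟶ F ↦ Φ.map a))

include i h

/-- The right adjoint is `Φ ⋙ e.inverse`: morphisms `ι L ⟶ F` are morphisms `Φ(ι L) ⟶ Φ(F)`, that is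
`e(L) ⟶ Φ(F)`, that is `L ⟶ e⁻¹(Φ(F))`. -/
lemma isLeftAdjoint_of_bijective_map : ι.IsLeftAdjoint := by
  let r (L : A) (F : C) : (ι.obj L ⟶ F) ≃ (L ⟶ (Φ ⋙ e.inverse).obj F) :=
    ((Equiv.ofBijective _ (h L F)).trans ((i.app L).homCongr (Iso.refl _))).trans
      (e.toAdjunction.homEquiv L _)
  have hr {L : A} {F : C} (a : ι.obj L ⟶ F) :
      r L F a = e.unit.app L ≫ e.inverse.map (i.inv.app L ≫ Φ.map a) := by
    simp [r, Iso.homCongr, Adjunction.homEquiv_unit]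
  refine (Adjunction.mkOfHomEquiv
    { homEquiv := r
      homEquiv_naturality_left_symm {L L' F} f g := ?_
      homEquiv_naturality_right {L F F'} f g := ?_ }).isLeftAdjoint
  · obtain ⟨a, rfl⟩ := (r L' F).surjective g
    rw [Equiv.symm_apply_apply, Equiv.symm_apply_eq, hr, hr, Functor.map_comp]
    have h1 := i.inv.naturality f
    dsimp only [Functor.comp_map] at h1
    have h2 := congrArg e.inverse.map h1
    have h3 := e.unit.naturality f
    simp only [Functor.map_comp, Functor.comp_map, Functor.id_map] at h2 h3 ⊢
    rw [← reassoc_of% h2, ← reassoc_of% h3]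
  · rw [hr, hr, Functor.map_comp Φ]
    simp only [Functor.map_comp, Functor.comp_map, Category.assoc]

lemma isIso_map_counit {G : C ⥤ A} (adj : ι ⊣ G) (F : C) : IsIso (Φ.map (adj.counit.app F)) := by
  let L := e.functor.objPreimage (Φ.obj F)
  let e' : Φ.obj (ι.obj L) ≅ Φ.obj F := i.app L ≪≫ e.functor.objObjPreimageIso _
  -- Choose `L` with `Φ(ι L) ≅ Φ(F)` and lift this isomorphism to `ι L ⟶ F`. The lift factors
  -- through the counit, which gives a right inverse `s` of the image of the counit.
  obtain ⟨b, hb⟩ := (h L F).2 e'.hom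
  obtain ⟨b', rfl⟩ := (adj.homEquiv _ _).symm.surjective b
  rw [adj.homEquiv_counit] at hb
  dsimp only at hb
  let s : Φ.obj F ⟶ Φ.obj (ι.obj (G.obj F)) := e'.inv ≫ Φ.map (ι.map b')
  have hs : s ≫ Φ.map (adj.counit.app F) = 𝟙 _ := by
    rw [Category.assoc, ← Functor.map_comp, hb, e'.inv_hom_id]
  have : (ι ⋙ Φ).Full := Functor.Full.of_iso i.symm
  -- The other composite comes from an endomorphism `d` of `G(F)`. Composing with the counit, and
  -- using injectivity of `Φ` on morphisms out of `ι`, forces `d` to be the identity.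
  obtain ⟨d, hd⟩ := (ι ⋙ Φ).map_surjective (Φ.map (adj.counit.app F) ≫ s)
  have hd1 : d = 𝟙 _ := by
    apply (adj.homEquiv _ _).symm.injective
    rw [adj.homEquiv_counit, adj.homEquiv_counit]
    refine (h _ _).1 ?_
    dsimp only
    rw [Functor.map_comp]
    refine (congrArg (· ≫ _) hd).trans ?_
    rw [Category.assoc, hs, ι.map_id, Category.id_comp]
    exact Category.comp_id _
  refine ⟨s, ?_, hs⟩
  rw [← hd, hd1]
  exact (ι ⋙ Φ).map_id _

end Coreflection

/-! ### Parts (a) and (b). -/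

section Equivalence

variable {k : Type u} [Ring k] {X X' : TopCat.{u}} {φ : X' ⟶ X} [ConnectedSpace X]
  [LocallyConnectedSpace X] (hφ : IsUniversalCovering φ)

include hφ

lemma qcohRep_isEquivalence : (qcohRep k φ).IsEquivalence where
  faithful := ⟨fun {L _} _ _ h ↦ ObjectProperty.hom_ext _ (sectionsRep_map_injective hφ L.2 _ h)⟩
  full := ⟨fun {L L'} h ↦ by
    obtain ⟨a, ha⟩ := sectionsRep_map_surjective hφ L.2 L'.1 h
    exact ⟨ObjectProperty.homMk a, ha⟩⟩
  essSurj := ⟨fun M ↦ ⟨⟨localSystem M, isQuasicoherent_localSystem M hφ⟩,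
    exists_iso_sectionsRep M hφ⟩⟩

lemma sectionsRep_map_bijective (L : Qcoh k X) (F : Shv k X) : Function.Bijective
    (fun a : (isQuasicoherent k X).ι.obj L ⟶ F ↦ (sectionsRep k φ).map a) :=
  ⟨fun _ _ h ↦ sectionsRep_map_injective hφ L.2 F h,
    fun h ↦ sectionsRep_map_surjective hφ L.2 F h⟩

lemma isLeftAdjoint_ι : (isQuasicoherent k X).ι.IsLeftAdjoint :=
  have := qcohRep_isEquivalence (k := k) hφ
  isLeftAdjoint_of_bijective_map (qcohRep k φ).asEquivalence (Iso.refl _) (sectionsRep_map_bijective hφ)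

lemma isIso_sectionsRep_counit {Qc : Shv k X ⥤ Qcoh k X} (adj : (isQuasicoherent k X).ι ⊣ Qc)
    (F : Shv k X) : IsIso ((sectionsRep k φ).map (adj.counit.app F)) :=
  have := qcohRep_isEquivalence (k := k) hφ
  isIso_map_counit (qcohRep k φ).asEquivalence (Iso.refl _) (sectionsRep_map_bijective hφ) adj F

end Equivalence

/-! ### Exactness of `L ↦ Γ(X', φ⁻¹L)` on quasi-coherent sheaves. -/

section Exactness

variable {k : Type u} [Ring k] {X X' : TopCat.{u}} {φ : X' ⟶ X} [LocallyConnectedSpace X]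
  (hφ : IsUniversalCovering φ)

instance : PreservesFiniteLimits (isQuasicoherent k X).ι where
  preservesFiniteLimits J _ _ := by
    have := qcoh_limits k (X := X) J
    infer_instance

instance : PreservesFiniteColimits (isQuasicoherent k X).ι where
  preservesFiniteColimits J _ _ := by
    have := qcoh_colimits k (X := X) J
    infer_instance

/-- The functor `L ↦ Γ(X', φ⁻¹L)` from quasi-coherent sheaves on `X` to modules. -/
abbrev qcohSections (φ : X' ⟶ X) : Qcoh k X ⥤ ModuleCat.{u} k :=
  (isQuasicoherent k X).ι ⋙ inverseImage k φ ⋙ globalSections k X'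

-- Since `φ⁻¹L` is constant, the constant sheaf on `Γ(X', φ⁻¹L)` is `φ⁻¹L`, which is exact in `L`.
-- The constant sheaf functor on the connected space `X'` is fully faithful, so it reflects limits
-- and colimits.
include hφ in
lemma qcohSections_preserves : PreservesFiniteLimits (qcohSections (k := k) φ) ∧
    PreservesFiniteColimits (qcohSections (k := k) φ) := by
  have := hφ.isSimplyConnected.connected
  let S : Qcoh k X ⥤ Shv k X' := (isQuasicoherent k X).ι ⋙ inverseImage k φ
  have hi (L : Qcoh k X) : IsIso ((constSheafAdj k X').counit.app (S.obj L)) := by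
    rw [(constSheafAdj k X').isIso_counit_app_iff_mem_essImage]
    exact essImage_inverseImage_of_isQuasicoherent hφ L.2
  let i : qcohSections φ ⋙ constSheaf k X' ≅ S :=
    NatIso.ofComponents (fun L ↦ asIso ((constSheafAdj k X').counit.app (S.obj L)))
      (fun f ↦ (constSheafAdj k X').counit.naturality (S.map f))
  have : PreservesFiniteLimits S := comp_preservesFiniteLimits _ _
  have : PreservesFiniteColimits S := comp_preservesFiniteColimits _ _
  have h1 : PreservesFiniteLimits (qcohSections φ ⋙ constSheaf k X') :=
    preservesFiniteLimits_of_natIso i.symm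
  have h2 : PreservesFiniteColimits (qcohSections φ ⋙ constSheaf k X') :=
    preservesFiniteColimits_of_natIso i.symm
  exact ⟨⟨fun J _ _ ↦ preservesLimitsOfShape_of_reflects_of_preserves _ (constSheaf k X')⟩,
    ⟨fun J _ _ ↦ preservesColimitsOfShape_of_reflects_of_preserves _ (constSheaf k X')⟩⟩

end Exactness

end LocSys
end

noncomputable section
namespace LocSys

/-! ### Cohomology of complexes and exact functors. -/

section HomologyOfComplexes

variable {C D : Type*} [Category* C] [Category* D] [Abelian C] [Abelian D]

open DerivedCategory.Plus

/-- The natural transformation on bounded below complexes induced by a natural transformation. -/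
def complexMap {C D : Type*} [Category* C] [Category* D] [Preadditive C] [Preadditive D]
    {F G : C ⥤ D} [F.PreservesZeroMorphisms] [G.PreservesZeroMorphisms] (τ : F ⟶ G) :
    F.mapCochainComplexPlus ⟶ G.mapCochainComplexPlus where
  app K := ObjectProperty.homMk ((NatTrans.mapHomologicalComplex τ (ComplexShape.up ℤ)).app K.obj)
  naturality _ _ f := ObjectProperty.hom_ext _
    ((NatTrans.mapHomologicalComplex τ (ComplexShape.up ℤ)).naturality f.hom)

/-- The cohomology of complexes commutes with exact functors. -/
def homologyMapExact (T : C ⥤ D) [T.Additive] [PreservesFiniteLimits T] [PreservesFiniteColimits T]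
    (i : ℤ) : T.mapHomologicalComplex (ComplexShape.up ℤ) ⋙
      HomologicalComplex.homologyFunctor D (ComplexShape.up ℤ) i ≅
    HomologicalComplex.homologyFunctor C (ComplexShape.up ℤ) i ⋙ T :=
  NatIso.ofComponents (fun K ↦ (K.sc i).mapHomologyIso T)
    (fun f ↦ ShortComplex.mapHomologyIso_hom_naturality
      ((HomologicalComplex.shortComplexFunctor C (ComplexShape.up ℤ) i).map f) T)

lemma homologyMapExact_natural {T : C ⥤ D} [T.Additive] [PreservesFiniteLimits T]
    [PreservesFiniteColimits T] (σ : T ⟶ T) (i : ℤ) (K : CochainComplex C ℤ) :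
    HomologicalComplex.homologyMap
      ((NatTrans.mapHomologicalComplex σ (ComplexShape.up ℤ)).app K) i ≫
        (homologyMapExact T i).hom.app K =
      (homologyMapExact T i).hom.app K ≫ σ.app (K.homology i) := by
  have h := ShortComplex.homologyMap_mapNatTrans (K.sc i) σ
  refine (congrArg (· ≫ (homologyMapExact T i).hom.app K) h).trans ?_
  refine (Category.assoc _ _ _).trans (congrArg (_ ≫ ·) ((Category.assoc _ _ _).trans ?_))
  exact (congrArg (_ ≫ ·) (Iso.inv_hom_id _)).trans (Category.comp_id _)

variable [HasDerivedCategory C] [HasDerivedCategory D]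

variable (C) in
/-- The localization functor from bounded below complexes to the derived category. -/
abbrev complexQ : CochainComplex.Plus C ⥤ DerivedCategory.Plus C :=
  HomotopyCategory.Plus.quotient C ⋙ Qh

variable (C) in
/-- The cohomology in the derived category is the cohomology of complexes. -/
def homologyComplexQ (i : ℤ) : complexQ C ⋙ homologyFunctor C i ≅
    CochainComplex.Plus.ι C ⋙ HomologicalComplex.homologyFunctor C (ComplexShape.up ℤ) i :=
  Functor.isoWhiskerLeft (CochainComplex.Plus.ι C)
    (Functor.isoWhiskerRight (DerivedCategory.quotientCompQhIso C)
      (DerivedCategory.homologyFunctor C i) ≪≫ DerivedCategory.homologyFunctorFactors C i)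

/-- The cohomology in the derived category commutes with exact functors. -/
def homologyExact (T : C ⥤ D) [T.Additive] [PreservesFiniteLimits T] [PreservesFiniteColimits T]
    (i : ℤ) : T.mapCochainComplexPlus ⋙ complexQ D ⋙ homologyFunctor D i ≅
      (complexQ C ⋙ homologyFunctor C i) ⋙ T :=
  Functor.isoWhiskerLeft T.mapCochainComplexPlus (homologyComplexQ D i) ≪≫
    Functor.isoWhiskerLeft (CochainComplex.Plus.ι C) (homologyMapExact T i) ≪≫
      Functor.isoWhiskerRight (homologyComplexQ C i).symm T

lemma homologyExact_natural {T : C ⥤ D} [T.Additive] [PreservesFiniteLimits T]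
    [PreservesFiniteColimits T] (σ : T ⟶ T) (i : ℤ) (K : CochainComplex.Plus C) :
    (homologyFunctor D i).map ((complexQ D).map ((complexMap σ).app K)) ≫
      (homologyExact T i).hom.app K = (homologyExact T i).hom.app K ≫
        σ.app ((homologyFunctor C i).obj ((complexQ C).obj K)) := by
  have h1 := (homologyComplexQ D i).hom.naturality ((complexMap σ).app K)
  have h2 := homologyMapExact_natural σ i K.obj
  have h3 := σ.naturality ((homologyComplexQ C i).inv.app K)
  have e : (homologyExact T i).hom.app K = (homologyComplexQ D i).hom.app _ ≫
      (homologyMapExact T i).hom.app K.obj ≫ T.map ((homologyComplexQ C i).inv.app K) := by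
    rfl
  rw [e]
  refine (Category.assoc _ _ _).symm.trans ((congrArg (· ≫ _) h1).trans ?_)
  refine (Category.assoc _ _ _).trans (Eq.trans ?_ (Category.assoc _ _ _).symm)
  refine congrArg (_ ≫ ·) ?_
  refine (Category.assoc _ _ _).symm.trans ((congrArg (· ≫ _) h2).trans ?_)
  refine (Category.assoc _ _ _).trans (Eq.trans ?_ (Category.assoc _ _ _).symm)
  exact congrArg (_ ≫ ·) h3.symm

end HomologyOfComplexes

/-! ### Bounded below complexes of injectives in the derived category. -/

section Injectives

variable (C : Type*) [Category* C] [Abelian C]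

/-- The bounded below complexes of injective objects. -/
def injComplexes : ObjectProperty (CochainComplex.Plus C) := fun K ↦ ∀ n, Injective (K.obj.X n)

variable [HasDerivedCategory C]

/-- The functor from bounded below complexes of injective objects to the derived category. -/
abbrev injQ : (injComplexes C).FullSubcategory ⥤ DerivedCategory.Plus C :=
  (injComplexes C).ι ⋙ complexQ C

/-- Bounded below complexes of injectives are K-injective, so morphisms into them in the derived
category come from homotopy classes of maps of complexes. -/
instance : (injQ C).Full where
  map_surjective {K L} f := by
    obtain ⟨n, hn⟩ := L.1.2
    have (n : ℤ) : Injective (L.1.obj.X n) := L.2 n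
    have hL : CochainComplex.IsKInjective L.1.obj := CochainComplex.isKInjective_of_injective _ n
    obtain ⟨g, rfl⟩ := (DerivedCategory.Plus.Qh_map_bijective_of_isKInjective
      ((HomotopyCategory.Plus.quotient C).obj K.1) ((HomotopyCategory.Plus.quotient C).obj L.1)
      hL).2 f
    obtain ⟨g, rfl⟩ := (HomotopyCategory.Plus.quotient C).map_surjective g
    exact ⟨ObjectProperty.homMk g, rfl⟩

instance [EnoughInjectives C] : (injQ C).EssSurj where
  mem_essImage K := by
    obtain ⟨Y, ⟨e⟩⟩ := Functor.EssSurj.mem_essImage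
      (F := (InjectiveObject.ι C).mapHomotopyCategoryPlus ⋙ DerivedCategory.Plus.Qh) K
    obtain ⟨Y, rfl⟩ := HomotopyCategory.Plus.quotient_obj_surjective Y
    exact ⟨⟨(InjectiveObject.ι C).mapCochainComplexPlus.obj Y, fun n ↦ (Y.obj.X n).property⟩, ⟨e⟩⟩

variable {C} {M : Type*} [Category* M]

/-- Faithfulness of `L` is not needed: every morphism between image objects lifts, so naturality of
`θ` on `J` already gives naturality for all morphisms between objects `L j`. The last clause allows
later identities for `α` to be checked on such objects. -/
lemma exists_natIso_of_essSurj {J D : Type*} [Category* J] [Category* D] (L : J ⥤ D) [L.Full]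
    [L.EssSurj] {F G : D ⥤ M} (θ : L ⋙ F ≅ L ⋙ G) :
    ∃ α : F ≅ G, ∀ j, α.hom.app (L.obj j) = θ.hom.app j := by
  have key {j j' : J} (f : L.obj j ⟶ L.obj j') :
      F.map f ≫ θ.hom.app j' = θ.hom.app j ≫ G.map f := by
    obtain ⟨f, rfl⟩ := L.map_surjective f
    exact θ.hom.naturality f
  let e (X : D) := L.objObjPreimageIso X
  refine ⟨NatIso.ofComponents (fun X ↦ F.mapIso (e X).symm ≪≫ θ.app _ ≪≫ G.mapIso (e X))
    fun {X Y} f ↦ ?_, fun j ↦ ?_⟩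
  · have := key ((e X).hom ≫ f ≫ (e Y).inv)
    simp only [Functor.map_comp, Category.assoc] at this
    simp only [Iso.trans_hom, Functor.mapIso_hom, Iso.symm_hom, Iso.app_hom, Category.assoc]
    rw [← cancel_epi (F.map (e X).hom)]
    rw [reassoc_of% this]
    simp [← Functor.map_comp, ← Functor.map_comp_assoc]
  · have := key (e (L.obj j)).hom
    simp [← this, ← Functor.map_comp_assoc]

lemma natTrans_ext_of_essSurj {J D : Type*} [Category* J] [Category* D] (L : J ⥤ D)
    [L.EssSurj] {F G : D ⥤ M} {α β : F ⟶ G} (h : ∀ j, α.app (L.obj j) = β.app (L.obj j)) : α = β := by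
  ext X
  rw [← cancel_epi (F.map (L.objObjPreimageIso X).hom), α.naturality, β.naturality, h]

end Injectives

end LocSys
end

noncomputable section
namespace LocSys

/-! ### Comparison of two derived functors, with operators. -/

section Comparison

open DerivedCategory.Plus

lemma injComplexes_map {C D : Type*} [Category* C] [Category* D] [Abelian C] [Abelian D] (R : C ⥤ D)
    [R.Additive] (hR : ∀ I : C, Injective I → Injective (R.obj I)) (K : CochainComplex.Plus C)
    (hK : injComplexes C K) : injComplexes D (R.mapCochainComplexPlus.obj K) :=
  fun n ↦ hR _ (hK n)

section

variable {C D : Type*} [Category* C] [Category* D] [Abelian C] [Abelian D]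
  [HasDerivedCategory C] [HasDerivedCategory D] [EnoughInjectives C]

/-- The canonical morphism `F(K) ⟶ RF(K)` for bounded below complexes `K`. -/
def derivedUnit (F : C ⥤ D) [F.Additive] :
    F.mapCochainComplexPlus ⋙ complexQ D ⟶ complexQ C ⋙ F.rightDerivedFunctorPlus where
  app K := F.rightDerivedFunctorPlusUnit.app ((HomotopyCategory.Plus.quotient C).obj K)
  naturality _ _ f :=
    F.rightDerivedFunctorPlusUnit.naturality ((HomotopyCategory.Plus.quotient C).map f)

lemma isIso_derivedUnit (F : C ⥤ D) [F.Additive] (K : CochainComplex.Plus C)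
    (hK : injComplexes C K) : IsIso ((derivedUnit F).app K) := by
  have (n : ℤ) : Injective (K.obj.X n) := hK n
  have (n : ℤ) : Injective (((HomotopyCategory.Plus.quotient C).obj K).obj.as.X n) := hK n
  exact inferInstanceAs (IsIso (F.rightDerivedFunctorPlusUnit.app
    ((HomotopyCategory.Plus.quotient C).obj K)))

/-- Values of derived functors on a family of bounded below complexes of injective objects. -/
def derivedUnitIso (F : C ⥤ D) [F.Additive] {J : Type*} [Category* J]
    (N : J ⥤ CochainComplex.Plus C) (hN : ∀ j, injComplexes C (N.obj j)) :
    N ⋙ F.mapCochainComplexPlus ⋙ complexQ D ≅ N ⋙ complexQ C ⋙ F.rightDerivedFunctorPlus :=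
  have (j : J) := isIso_derivedUnit F (N.obj j) (hN j)
  NatIso.ofComponents (fun j ↦ asIso ((derivedUnit F).app (N.obj j)))
    (fun f ↦ (derivedUnit F).naturality (N.map f))

end

variable {C D E Q : Type*} [Category* C] [Category* D] [Category* E] [Category* Q]
  [Abelian C] [Abelian D] [Abelian E] [Abelian Q] [HasDerivedCategory C] [HasDerivedCategory D]
  [HasDerivedCategory E] [HasDerivedCategory Q] [EnoughInjectives C] [EnoughInjectives D]
  (S : C ⥤ Q) [S.Additive] (T : Q ⥤ E) [T.Additive] [PreservesFiniteLimits T]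
  [PreservesFiniteColimits T] (R : C ⥤ D) [R.Additive] [PreservesFiniteLimits R]
  [PreservesFiniteColimits R] (Γ : D ⥤ E) [Γ.Additive] (ε : S ⋙ T ≅ R ⋙ Γ)
  (hR : ∀ I : C, Injective I → Injective (R.obj I)) (i : ℤ)

/-- The isomorphism on complexes induced by an isomorphism between composites of functors. -/
def complexCompIso : S.mapCochainComplexPlus ⋙ T.mapCochainComplexPlus ≅
    R.mapCochainComplexPlus ⋙ Γ.mapCochainComplexPlus :=
  NatIso.ofComponents (fun K ↦ ObjectProperty.isoMk _
    ((NatIso.mapHomologicalComplex ε (ComplexShape.up ℤ)).app K.obj))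
    (fun f ↦ ObjectProperty.hom_ext _
      ((NatTrans.mapHomologicalComplex ε.hom (ComplexShape.up ℤ)).naturality f.hom))

/-- `T(Hⁱ(RS(K))) ≅ Hⁱ(RΓ(R(K)))` for bounded below complexes `K` of injective objects. -/
def comparisonInj : injQ C ⋙ (S.rightDerivedFunctorPlus ⋙ homologyFunctor Q i) ⋙ T ≅
    injQ C ⋙ (exactDerived R ⋙ Γ.rightDerivedFunctorPlus) ⋙ homologyFunctor E i :=
  -- On injectives `RS` is `S` termwise; `T` is exact and passes inside cohomology; `ε` replaces
  -- `T(S(K))` by `Γ(R(K))`; since `R(K)` again consists of injectives, `Γ` termwise is `RΓ`;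
  -- finally `R` termwise is its derived functor.
  Functor.isoWhiskerRight (derivedUnitIso S (injComplexes C).ι (fun K ↦ K.2)).symm
    (homologyFunctor Q i ⋙ T) ≪≫
  Functor.isoWhiskerLeft ((injComplexes C).ι ⋙ S.mapCochainComplexPlus) (homologyExact T i).symm ≪≫
  Functor.isoWhiskerRight (Functor.isoWhiskerLeft (injComplexes C).ι (complexCompIso S T R Γ ε))
    (complexQ E ⋙ homologyFunctor E i) ≪≫
  Functor.isoWhiskerRight (derivedUnitIso Γ ((injComplexes C).ι ⋙ R.mapCochainComplexPlus)
    (fun K ↦ injComplexes_map R hR K.1 K.2)) (homologyFunctor E i) ≪≫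
  Functor.isoWhiskerRight (Functor.isoWhiskerLeft ((injComplexes C).ι ⋙
    HomotopyCategory.Plus.quotient C) (exactDerivedFac R)).symm
      (Γ.rightDerivedFunctorPlus ⋙ homologyFunctor E i)

/-- One commutative square for each of the five factors of the comparison, pasted together. The
hypothesis `h` is used for the factor coming from `ε`, and `derivedPull_fac_app` for the one passing
from `Γ` to `RΓ`. -/
lemma comparisonInj_natural (σ : T ⟶ T) {A : D ⥤ D} [A.Additive] [PreservesFiniteLimits A]
    [PreservesFiniteColimits A] (u : Γ ⟶ A ⋙ Γ) (b : R ⋙ A ⟶ R)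
    (h : Functor.whiskerLeft S σ ≫ ε.hom = ε.hom ≫ sectionsOp Γ R A u b)
    (K : (injComplexes C).FullSubcategory) :
    σ.app ((homologyFunctor Q i).obj (S.rightDerivedFunctorPlus.obj ((injQ C).obj K))) ≫
      (comparisonInj S T R Γ ε hR i).hom.app K =
    (comparisonInj S T R Γ ε hR i).hom.app K ≫ (homologyFunctor E i).map
      ((Localization.liftNatTrans Qh (HomotopyCategory.Plus.quasiIso C)
        (R.mapHomotopyCategoryPlus ⋙ Qh ⋙ Γ.rightDerivedFunctorPlus)
        (R.mapHomotopyCategoryPlus ⋙ Qh ⋙ Γ.rightDerivedFunctorPlus)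
        (exactDerived R ⋙ Γ.rightDerivedFunctorPlus) (exactDerived R ⋙ Γ.rightDerivedFunctorPlus)
        (derivedOp Γ R A u b)).app ((injQ C).obj K)) := by
  have := isIso_derivedUnit S K.1 K.2
  let q := (HomotopyCategory.Plus.quotient C).obj K.1
  have s1 : CommSq (T.map ((homologyFunctor Q i).map (inv ((derivedUnit S).app K.1))))
      (σ.app _) (σ.app _) (T.map ((homologyFunctor Q i).map (inv ((derivedUnit S).app K.1)))) :=
    ⟨σ.naturality _⟩
  have s2 : CommSq ((homologyExact T i).inv.app (S.mapCochainComplexPlus.obj K.1))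
      (σ.app ((homologyFunctor Q i).obj ((complexQ Q).obj (S.mapCochainComplexPlus.obj K.1))))
      ((homologyFunctor E i).map ((complexQ E).map
        ((complexMap σ).app (S.mapCochainComplexPlus.obj K.1))))
      ((homologyExact T i).inv.app (S.mapCochainComplexPlus.obj K.1)) := by
    refine ⟨?_⟩
    let e := (homologyExact T i).app (S.mapCochainComplexPlus.obj K.1)
    have := homologyExact_natural σ i (S.mapCochainComplexPlus.obj K.1)
    exact (Iso.inv_comp_eq e).mpr (((Iso.eq_comp_inv e).mpr this).trans (Category.assoc _ _ _))
  have s3 : CommSq ((complexCompIso S T R Γ ε).hom.app K.1)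
      ((complexMap σ).app (S.mapCochainComplexPlus.obj K.1))
      ((complexMap (sectionsOp Γ R A u b)).app K.1)
      ((complexCompIso S T R Γ ε).hom.app K.1) := by
    refine ⟨ObjectProperty.hom_ext _ ?_⟩
    ext n
    exact (NatTrans.congr_app h (K.1.obj.X n)).symm
  have s4 : CommSq ((derivedUnit Γ).app (R.mapCochainComplexPlus.obj K.1))
      ((complexQ E).map ((complexMap (sectionsOp Γ R A u b)).app K.1))
      ((derivedOp Γ R A u b).app q)
      ((derivedUnit Γ).app (R.mapCochainComplexPlus.obj K.1)) := by
    refine ⟨?_⟩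
    have h1 := derivedPull_fac_app Γ (u := u) (R.mapHomotopyCategoryPlus.obj q)
    have h2 := Γ.rightDerivedFunctorPlusUnit.naturality ((mapPlusFrom b).app q)
    have h3 : (mapPlusTo u).app (R.mapHomotopyCategoryPlus.obj q) ≫
        Γ.mapHomotopyCategoryPlus.map ((mapPlusFrom b).app q) =
          (HomotopyCategory.Plus.quotient E).map ((complexMap (sectionsOp Γ R A u b)).app K.1) := rfl
    refine (Category.assoc _ _ _).symm.trans ((congrArg (· ≫ _) h1).trans ?_)
    refine (Category.assoc _ _ _).trans ((congrArg (_ ≫ ·) h2.symm).trans ?_)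
    refine (Category.assoc _ _ _).symm.trans (congrArg (· ≫ _) ?_)
    exact (Qh.map_comp _ _).symm.trans (congrArg Qh.map h3)
  have s5 : CommSq (Γ.rightDerivedFunctorPlus.map ((exactDerivedFac R).inv.app q))
      ((derivedOp Γ R A u b).app q)
      ((Localization.liftNatTrans Qh (HomotopyCategory.Plus.quasiIso C)
        (R.mapHomotopyCategoryPlus ⋙ Qh ⋙ Γ.rightDerivedFunctorPlus)
        (R.mapHomotopyCategoryPlus ⋙ Qh ⋙ Γ.rightDerivedFunctorPlus)
        (exactDerived R ⋙ Γ.rightDerivedFunctorPlus) (exactDerived R ⋙ Γ.rightDerivedFunctorPlus)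
        (derivedOp Γ R A u b)).app ((injQ C).obj K))
      (Γ.rightDerivedFunctorPlus.map ((exactDerivedFac R).inv.app q)) := by
    refine ⟨?_⟩
    refine (congrArg (Γ.rightDerivedFunctorPlus.map ((exactDerivedFac R).inv.app q) ≫ ·) (Localization.liftNatTrans_app Qh
      (HomotopyCategory.Plus.quasiIso C) _ _ _ _ (derivedOp Γ R A u b) q)).trans ?_
    refine (Category.assoc _ _ _).symm.trans ((congrArg (· ≫ _) ?_).trans (Category.id_comp _))
    refine (Γ.rightDerivedFunctorPlus.map_comp _ _).symm.trans ((congrArg _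
      ((exactDerivedFac R).inv_hom_id_app q)).trans (Γ.rightDerivedFunctorPlus.map_id _))
  exact (s1.horiz_comp (s2.horiz_comp ((s3.map (complexQ E ⋙ homologyFunctor E i)).horiz_comp
    ((s4.map (homologyFunctor E i)).horiz_comp (s5.map (homologyFunctor E i)))))).w.symm

include hR in
/-- `T(RⁱS(K)) ≅ RⁱΓ(R(K))`, naturally in `K` and compatibly with the operators on both sides. -/
lemma exists_comparison : ∃ α : (S.rightDerivedFunctorPlus ⋙ homologyFunctor Q i) ⋙ T ≅
    (exactDerived R ⋙ Γ.rightDerivedFunctorPlus) ⋙ homologyFunctor E i,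
    ∀ (σ : T ⟶ T) (A : D ⥤ D) [A.Additive] [PreservesFiniteLimits A] [PreservesFiniteColimits A]
      (u : Γ ⟶ A ⋙ Γ) (b : R ⋙ A ⟶ R),
      Functor.whiskerLeft S σ ≫ ε.hom = ε.hom ≫ sectionsOp Γ R A u b →
      Functor.whiskerLeft (S.rightDerivedFunctorPlus ⋙ homologyFunctor Q i) σ ≫ α.hom =
        α.hom ≫ Functor.whiskerRight (Localization.liftNatTrans Qh
          (HomotopyCategory.Plus.quasiIso C)
          (R.mapHomotopyCategoryPlus ⋙ Qh ⋙ Γ.rightDerivedFunctorPlus)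
          (R.mapHomotopyCategoryPlus ⋙ Qh ⋙ Γ.rightDerivedFunctorPlus)
          (exactDerived R ⋙ Γ.rightDerivedFunctorPlus)
          (exactDerived R ⋙ Γ.rightDerivedFunctorPlus)
          (derivedOp Γ R A u b)) (homologyFunctor E i) := by
  obtain ⟨α, hα⟩ := exists_natIso_of_essSurj (injQ C)
    (F := (S.rightDerivedFunctorPlus ⋙ homologyFunctor Q i) ⋙ T)
    (G := (exactDerived R ⋙ Γ.rightDerivedFunctorPlus) ⋙ homologyFunctor E i)
    (comparisonInj S T R Γ ε hR i)
  refine ⟨α, fun σ A _ _ _ u b h ↦ natTrans_ext_of_essSurj (injQ C) fun K ↦ ?_⟩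
  have := comparisonInj_natural S T R Γ ε hR i σ u b h K
  rw [← hα K] at this
  exact this

end Comparison

end LocSys
end

noncomputable section
namespace LocSys

/-! ### Isomorphisms of representations. -/

section Representations

variable {k : Type u} [Ring k] {G : Type u} [Group G]

lemma rep_hom_bijective {A B : Rep.{u} k G} (f : A ⟶ B) [IsIso f] :
    Function.Bijective f.hom.toLinearMap :=
  Function.bijective_iff_has_inverse.mpr ⟨(inv f).hom.toLinearMap,
    fun x ↦ congrArg (fun h : A ⟶ A ↦ h.hom x) (IsIso.hom_inv_id f),
    fun x ↦ congrArg (fun h : B ⟶ B ↦ h.hom x) (IsIso.inv_hom_id f)⟩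

/-- An equivariant natural isomorphism induces an isomorphism of functors to representations. -/
def toRepIso {C B : Type*} [Category* C] [Category* B] {L : C ⥤ B} {Φ : B ⥤ ModuleCat.{u} k}
    {Φ' : C ⥤ ModuleCat.{u} k} {ρ : G →* End Φ} {ρ' : G →* End Φ'} (α : L ⋙ Φ ≅ Φ')
    (h : ∀ g, Functor.whiskerLeft L (ρ g) ≫ α.hom = α.hom ≫ ρ' g) :
    L ⋙ toRep k Φ ρ ≅ toRep k Φ' ρ' :=
  NatIso.ofComponents (fun F ↦ repIso (α.app F).toLinearEquiv fun g x ↦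
      ConcreteCategory.congr_hom (NatTrans.congr_app (h g) F) x)
    fun f ↦ Rep.hom_ext (by ext x; exact ConcreteCategory.congr_hom (α.hom.naturality f) x)

end Representations

/-! ### Part (c): cohomology as a representation. -/

section Cohomology

variable {k : Type u} [Ring k] {X X' : TopCat.{u}} {φ : X' ⟶ X}
  {Qc : Shv k X ⥤ Qcoh k X} (adj : (isQuasicoherent k X).ι ⊣ Qc)

/-- The isomorphism `Γ(X', φ⁻¹Qc(F)) ≅ Γ(X', φ⁻¹F)` induced by the counit. -/
def sectionsCounitIso (h : ∀ F, IsIso ((sectionsRep k φ).map (adj.counit.app F))) :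
    Qc ⋙ qcohSections φ ≅ inverseImage k φ ⋙ globalSections k X' :=
  have (F : Shv k X) : IsIso ((inverseImage k φ ⋙ globalSections k X').map (adj.counit.app F)) :=
    (ConcreteCategory.isIso_iff_bijective _).mpr
      (have := h F; rep_hom_bijective ((sectionsRep k φ).map (adj.counit.app F)))
  NatIso.ofComponents
    (fun F ↦ asIso ((inverseImage k φ ⋙ globalSections k X').map (adj.counit.app F)))
    (fun f ↦ (Functor.whiskerRight adj.counit (inverseImage k φ ⋙ globalSections k X')).naturality f)

/-- Pullback of sections along `g` is natural in the sheaf; apply this to the counit. -/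
lemma sectionsCounitIso_natural (h : ∀ F, IsIso ((sectionsRep k φ).map (adj.counit.app F)))
    (g : deckGroup φ) :
    Functor.whiskerLeft Qc (Functor.whiskerLeft (isQuasicoherent k X).ι (deckSections k φ g)) ≫
      (sectionsCounitIso adj h).hom = (sectionsCounitIso adj h).hom ≫ deckSections k φ g :=
  NatTrans.ext (funext fun F ↦ ((deckSections k φ g).naturality (adj.counit.app F)).symm)

variable [ConnectedSpace X] [LocallyConnectedSpace X] [HasDerivedCategory (Shv k X)] [HasDerivedCategory (Shv k X')]
  [HasDerivedCategory (ModuleCat.{u} k)] [HasDerivedCategory (Qcoh k X)]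

lemma nonempty_higherQc_iso (hφ : IsUniversalCovering φ) (i : ℤ) :
    Nonempty (higherQc adj i ⋙ qcohRep k φ ≅ cohomologyRep k φ i) := by
  have : Qc.Additive := adj.right_adjoint_additive
  obtain ⟨_, _⟩ := qcohSections_preserves (k := k) hφ
  have : (qcohSections (k := k) φ).Additive := Functor.additive_of_preserves_binary_products _
  obtain ⟨α, hα⟩ := exists_comparison Qc (qcohSections φ) (inverseImage k φ) (globalSections k X')
    (sectionsCounitIso adj (isIso_sectionsRep_counit hφ adj))
    (fun I _ ↦ injective_inverseImage φ hφ.isCoveringMap.isLocalHomeomorph I) i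
  refine ⟨toRepIso (L := higherQc adj i ⋙ (isQuasicoherent k X).ι) (ρ := deckSectionsHom k φ)
    (ρ' := deckCohomologyHom k φ i) α fun g ↦ ?_⟩
  -- Both actions of `g` are defined by pullback along `g⁻¹`, so the compatibility is invoked for
  -- the operators attached to `g⁻¹`.
  exact hα (Functor.whiskerLeft (isQuasicoherent k X).ι (deckSections k φ g⁻¹))
    (inverseImage k (deckMap g⁻¹)) (sectionsPull k (deckMap g⁻¹)) (deckIso k g⁻¹).hom
    (sectionsCounitIso_natural adj (isIso_sectionsRep_counit hφ adj) g⁻¹)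

end Cohomology

end LocSys
end

theorem mainTheorem7 (k : Type u) [Ring k] (X X' : TopCat.{u}) [ConnectedSpace X]
    [LocSys.LocallySimplyConnected X] (φ : X' ⟶ X) (hφ : LocSys.IsUniversalCovering φ)
    [HasDerivedCategory (LocSys.Shv k X)] [HasDerivedCategory (LocSys.Shv k X')]
    [HasDerivedCategory (ModuleCat.{u} k)] [HasDerivedCategory (LocSys.Qcoh k X)] :
    (LocSys.qcohRep k φ).IsEquivalence ∧
    (LocSys.isQuasicoherent k X).ι.IsLeftAdjoint ∧
    (∀ (Qc : LocSys.Shv k X ⥤ LocSys.Qcoh k X) (adj : (LocSys.isQuasicoherent k X).ι ⊣ Qc) (i : ℤ),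
      Nonempty (LocSys.higherQc adj i ⋙ LocSys.qcohRep k φ ≅ LocSys.cohomologyRep k φ i)) ∧
    (∀ (Y Y' : TopCat.{u}) (ψ : Y' ⟶ Y), IsCoveringMap ψ →
      ∀ I : LocSys.Shv k Y, Injective I → Injective ((LocSys.inverseImage k ψ).obj I)) :=
  ⟨LocSys.qcohRep_isEquivalence hφ, LocSys.isLeftAdjoint_ι hφ,
    fun _ adj i ↦ LocSys.nonempty_higherQc_iso adj hφ i,
    fun _ _ ψ hψ I _ ↦ LocSys.injective_inverseImage ψ hψ.isLocalHomeomorph I⟩
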